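/- Let $d\ge 2$, $Y=(0,1)^d$, and let $Y_0$ be an open set of class $C^3$ with $\overline{Y_0}\subset Y$, boundary $\Gamma_0=\partial Y_0$ and outer unit normal $n$. Let $a>0$ be a tubular radius of $\Gamma_0$, i.e. the map $(\gamma,r)\mapsto\gamma+r\,n(\gamma)$ is injective on $\Gamma_0\times(-a,a)$, and assume that its image, the tubular neighborhood $U_\Gamma$, is contained in $Y$. Put $a^*=a/8$, and for $h\in[-a^*,a^*]$ let $$Y(h)=(Y_0\setminus U_\Gamma)\cup\{\gamma+r\,n(\gamma):\gamma\in\Gamma_0,\ -a<r<h\}$$ be the region inside the parallel surface $\Gamma(h)=\{\gamma+h\,n(\gamma):\gamma\in\Gamma_0\}$ (so $Y(0)=Y_0$). Let $\mathcal K\in\mathbb R^{d\times d}$ be symmetric and positive definite. Let $H^1_\#(Y\setminus Y(h))$ be the space of $\mathbb Z^d$-periodic functions on $\mathbb R^d\setminus\bigcup_{k\in\mathbb Z^d}(k+\overline{Y(h)})$ that have a weak gradient there and that are, together with this gradient, square integrable over $Y\setminus Y(h)$. Then the following hold. 1. For every $h\in[-a^*,a^*]$ and $j=1,\dots,d$ there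 is $\xi_j(h)\in H^1_\#(Y\setminus Y(h))$ with $$\int_{Y\setminus Y(h)}\mathcal K(\nabla\xi_j(h)+e_j)\cdot\nabla\phi\,dy=0\qquad\text{for all }\phi\in H^1_\#(Y\setminus Y(h)),$$ and the effective conductivity $$K(h)_{ij}=\int_{Y\setminus Y(h)}\mathcal K(\nabla\xi_j(h)+e_j)\cdot(\nabla\xi_i(h)+e_i)\,dy$$ does not depend on the choice of these solutions. 2. $K\in C^{1,1}([-a^*,a^*];\mathbb R^{d\times d})$, i.e. $K$ is differentiable on $[-a^*,a^*]$ (one-sidedly at the end points) with Lipschitz continuous derivative. 3. For $N\ge1$ let $\Delta h=2a^*/N$, $h_i=-a^*+i\,\Delta h$, and let $K_{\mathrm{lin}}$ be the continuous function on $[-a^*,a^*]$ that equals $K$ at $h_0,\dots,h_N$ and is affine on each $[h_i,h_{i+1}]$. There is a constant $C$, independent of $N$, such that $|K(h)-K_{\mathrm{lin}}(h)|\le C(\Delta h)^2$ for all $h\in[-a^*,a^*]$ and all $N\ge1$. -/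

import Mathlib

open Set MeasureTheory
open scoped ContDiff

attribute [local instance] Matrix.frobeniusNormedAddCommGroup Matrix.frobeniusNormedSpace

noncomputable section

namespace CellProblem

/-- The open unit cell `Y = (0,1)^d`. -/
def unitCell (d : ℕ) : Set (EuclideanSpace ℝ (Fin d)) :=
  {y | ∀ i, y i ∈ Ioo (0 : ℝ) 1}

/-! Geometry: sets with boundary of class `C^3`, normals, tubular neighborhoods. -/

/-- `ρ` describes the set `Ω` near its boundary point `p`: it is `C^3` near `p`, has nonzero
gradient at `p`, and `Ω` coincides with `{ρ < 0}` near `p`. -/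
def IsLocalDefiningFunction {d : ℕ} (Ω : Set (EuclideanSpace ℝ (Fin d)))
    (p : EuclideanSpace ℝ (Fin d)) (ρ : EuclideanSpace ℝ (Fin d) → ℝ) : Prop :=
  ContDiffAt ℝ 3 ρ p ∧ gradient ρ p ≠ 0 ∧ ∀ᶠ y in nhds p, (y ∈ Ω ↔ ρ y < 0)

/-- An open set whose boundary is locally a `C^3` hypersurface with the set on one side.
Connectedness is not required. -/
def IsC3Domain {d : ℕ} (Ω : Set (EuclideanSpace ℝ (Fin d))) : Prop :=
  IsOpen Ω ∧ ∀ p ∈ frontier Ω, ∃ ρ, IsLocalDefiningFunction Ω p ρ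

open Classical in
/-- The outer unit normal of `Ω` at a boundary point `p`: the normalized gradient of a local
defining function (it does not depend on which one is taken). -/
def outerNormal {d : ℕ} (Ω : Set (EuclideanSpace ℝ (Fin d)))
    (p : EuclideanSpace ℝ (Fin d)) : EuclideanSpace ℝ (Fin d) :=
  if H : ∃ ρ, IsLocalDefiningFunction Ω p ρ then
    ‖gradient H.choose p‖⁻¹ • gradient H.choose p
  else 0

/-- The map `Λ(γ, r) = γ + r n(γ)`. -/
def normalMap {d : ℕ} (Ω : Set (EuclideanSpace ℝ (Fin d)))
    (q : EuclideanSpace ℝ (Fin d) × ℝ) : EuclideanSpace ℝ (Fin d) :=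
  q.1 + q.2 • outerNormal Ω q.1

/-- The tubular neighborhood of `∂Ω` of radius `a`, the image of `∂Ω × (-a,a)` under `Λ`. -/
def tubularNhd {d : ℕ} (Ω : Set (EuclideanSpace ℝ (Fin d))) (a : ℝ) :
    Set (EuclideanSpace ℝ (Fin d)) :=
  normalMap Ω '' (frontier Ω ×ˢ Ioo (-a) a)

/-- `a` is a tubular radius of `∂Ω`: every point of the tubular neighborhood is `γ + r n(γ)` for
exactly one `γ ∈ ∂Ω` and `r ∈ (-a,a)`. -/
def IsTubularRadius {d : ℕ} (Ω : Set (EuclideanSpace ℝ (Fin d))) (a : ℝ) : Prop :=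
  0 < a ∧ InjOn (normalMap Ω) (frontier Ω ×ˢ Ioo (-a) a)

/-- The set `Ω(h)`, `|h| < a`, bounded by the parallel surface
`Γ(h) = {γ + h n(γ) : γ ∈ ∂Ω}`: the points of `Ω` outside the tubular neighborhood together with
the points of the tubular neighborhood whose signed distance to `∂Ω` (negative inside `Ω`) is
less than `h`. In particular `Ω(0) = Ω`. -/
def shifted {d : ℕ} (Ω : Set (EuclideanSpace ℝ (Fin d))) (a h : ℝ) :
    Set (EuclideanSpace ℝ (Fin d)) :=
  (Ω \ tubularNhd Ω a) ∪ normalMap Ω '' (frontier Ω ×ˢ Ioo (-a) h)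

/-! Periodic Sobolev functions on the perforated cell `Y \ P`. -/

/-- The point of the lattice `ℤ^d` with coordinates `k`. -/
def latticePoint {d : ℕ} (k : Fin d → ℤ) : EuclideanSpace ℝ (Fin d) :=
  WithLp.toLp 2 fun i => (k i : ℝ)

/-- Periodicity with respect to the unit cell. -/
def IsCellPeriodic {d : ℕ} {α : Type*} (f : EuclideanSpace ℝ (Fin d) → α) : Prop :=
  ∀ (k : Fin d → ℤ) (y : EuclideanSpace ℝ (Fin d)), f (y + latticePoint k) = f y

/-- The periodically perforated space: `ℝ^d` without all `ℤ^d`-translates of `closure P`. -/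
def perforatedSpace {d : ℕ} (P : Set (EuclideanSpace ℝ (Fin d))) :
    Set (EuclideanSpace ℝ (Fin d)) :=
  {y | ∀ k : Fin d → ℤ, y + latticePoint k ∉ closure P}

/-- `u` belongs to `H^1_#(Y \ P)` and its weak gradient is `g`: both are periodic and square
integrable on `Y \ P`, and `g` is the distributional gradient of `u` in the perforated space. -/
structure IsPeriodicSobolev {d : ℕ} (P : Set (EuclideanSpace ℝ (Fin d)))
    (u : EuclideanSpace ℝ (Fin d) → ℝ)
    (g : EuclideanSpace ℝ (Fin d) → EuclideanSpace ℝ (Fin d)) : Prop where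
  periodic : IsCellPeriodic u
  periodic_grad : IsCellPeriodic g
  memLp : MemLp u 2 (volume.restrict (unitCell d \ P))
  memLp_grad : MemLp g 2 (volume.restrict (unitCell d \ P))
  weak_grad : ∀ φ : EuclideanSpace ℝ (Fin d) → ℝ, ContDiff ℝ ∞ φ → HasCompactSupport φ →
    tsupport φ ⊆ perforatedSpace P → ∀ i : Fin d,
      ∫ y, u y * fderiv ℝ φ y (EuclideanSpace.single i 1) = - ∫ y, g y i * φ y

/-- `ξ`, with weak gradient `g`, solves the `j`-th cell problem on `Y \ P`:
`ξ ∈ H^1_#(Y \ P)` and `∫_{Y \ P} A (∇ξ + e_j) · ∇φ = 0` for every `φ ∈ H^1_#(Y \ P)`. -/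
def IsCellSolution {d : ℕ} (A : Matrix (Fin d) (Fin d) ℝ) (P : Set (EuclideanSpace ℝ (Fin d)))
    (j : Fin d) (ξ : EuclideanSpace ℝ (Fin d) → ℝ)
    (g : EuclideanSpace ℝ (Fin d) → EuclideanSpace ℝ (Fin d)) : Prop :=
  IsPeriodicSobolev P ξ g ∧
    ∀ φ w, IsPeriodicSobolev P φ w →
      ∫ y in unitCell d \ P,
        inner ℝ (A.toEuclideanLin (g y + EuclideanSpace.single j 1)) (w y) = 0

/-- The matrix with entries `∫_{Y \ P} A (g_j + e_j) · (g_i + e_i)`. -/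
def conductivityMatrix {d : ℕ} (A : Matrix (Fin d) (Fin d) ℝ)
    (P : Set (EuclideanSpace ℝ (Fin d)))
    (g : Fin d → EuclideanSpace ℝ (Fin d) → EuclideanSpace ℝ (Fin d)) :
    Matrix (Fin d) (Fin d) ℝ :=
  Matrix.of fun i j => ∫ y in unitCell d \ P,
    inner ℝ (A.toEuclideanLin (g j y + EuclideanSpace.single j 1))
      (g i y + EuclideanSpace.single i 1)

open Classical in
/-- The effective conductivity of the perforated cell `Y \ P`, built from solutions of the `d`
cell problems (set to `0` if there are none). -/
def effectiveConductivity {d : ℕ} (A : Matrix (Fin d) (Fin d) ℝ)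
    (P : Set (EuclideanSpace ℝ (Fin d))) : Matrix (Fin d) (Fin d) ℝ :=
  if H : ∃ (ξ : Fin d → EuclideanSpace ℝ (Fin d) → ℝ)
      (g : Fin d → EuclideanSpace ℝ (Fin d) → EuclideanSpace ℝ (Fin d)),
      ∀ j, IsCellSolution A P j (ξ j) (g j) then
    conductivityMatrix A P H.choose_spec.choose
  else 0

/-! Regularity and interpolation on an interval. -/

/-- `f` is of class `C^{1,1}` on `s`: it is differentiable on `s` (one-sidedly at the end points
of an interval) with a Lipschitz continuous derivative. -/
def IsC11On {F : Type*} [NormedAddCommGroup F] [NormedSpace ℝ F] (f : ℝ → F) (s : Set ℝ) : Prop :=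
  ∃ f' : ℝ → F, (∀ x ∈ s, HasDerivWithinAt f (f' x) s x) ∧ ∃ L, LipschitzOnWith L f' s

/-- The mesh width of the uniform partition of `[-b,b]` into `N` subintervals. -/
def gridStep (b : ℝ) (N : ℕ) : ℝ := 2 * b / N

/-- The `i`-th node of the uniform partition of `[-b,b]` into `N` subintervals. -/
def gridNode (b : ℝ) (N i : ℕ) : ℝ := -b + i * gridStep b N

/-- The piecewise linear interpolant of `f` on the uniform partition of `[-b,b]` into `N`
subintervals. The index is the `i` with `h ∈ [h_i, h_{i+1})`; at `h = b` it is `N`, where the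
value is `f b`. -/
def piecewiseLinear {F : Type*} [AddCommGroup F] [Module ℝ F] (f : ℝ → F) (b : ℝ) (N : ℕ)
    (h : ℝ) : F :=
  let i := ⌊(h + b) / gridStep b N⌋₊
  let t := (h - gridNode b N i) / gridStep b N
  (1 - t) • f (gridNode b N i) + t • f (gridNode b N (i + 1))

end CellProblem

end

open Filter Topology Metric
open scoped ENNReal NNReal

noncomputable section

namespace CellProblem

/-! ### Squared `L²` norms as lower integrals, and Jensen's inequality -/

section General

variable {α β F : Type*} [MeasurableSpace α] [MeasurableSpace β] [NormedAddCommGroup F]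

/-! Everything is transported to the reference cell `Y \ Y₀`. Let `X` be the outer normal field,
continued constantly along normals, tapered linearly to zero at distance `a/2` from the boundary,
and extended periodically. It has Lipschitz constant `6/a`, so for `|h| ≤ a/8` the map `f_h = id + h
X` is a perturbation of the identity by a field of Lipschitz constant at most `3/4`, hence a
bi-Lipschitz homeomorphism. It moves points along normals, respects the lattice and carries `Y₀`
onto `Y(h)` (`IsTubularRadius.deformationField`, `DeformationField.exists_isCellDeformation`).

If `g` is the gradient of a periodic Sobolev function on `Y \ Y(h)`, then `G = (Df_h)ᵀ (g ∘ f_h +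
e_j)` equals `e_j` plus the gradient of a periodic Sobolev function on `Y \ Y₀`, because `(Df_h)ᵀ
e_j = e_j + h ∇(e_j · X)`. So the unknown always lies in `e_j + V`, with `V` the space of periodic
gradients on the reference cell, and the cell problem reads `A_h G ⟂ V`, where `A_h` is
multiplication by `|det(1 + h DX)| (1 + h DX)⁻¹ 𝒦 (1 + h DX)⁻ᵀ`. All dependence on `h` sits in this
tensor. It is smooth in `h`, uniformly over the cell, since `‖h DX‖ ≤ 3/4`
(`exists_pullback_operators`).

Solvability is Lax–Milgram on `V`, once `V` is closed in `L²`. Closedness follows from Poincaré's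
inequality. As the perforated cell may be disconnected, the inequality is stated up to finitely many
averages over balls, which suffices because a finite-rank defect does not destroy closed range. The
inequality is elementary away from the inclusion, and `id + b X` with `b = a/8` pushes the part near
the inclusion into that region at the price of a gradient term (`DeformationField.exists_poincare`,
`DeformationField.isClosed_gradientSpace`).

For the regularity, let `G_h`, `G'_h` be the equilibria for two directions. Differences of
equilibria lie in `V`, so orthogonality and symmetry give `⟨A_h G_h, G'_h⟩ - ⟨A_k G_k, G'_k⟩ = ⟨(A_h
- A_k) G_h, G'_k⟩`. Replacing `G_h` by `G_k` here costs a further factor `|h - k|`. Hence `|K(h) -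
K(k) - (h - k) K'(k)| ≤ C (h - k)²` with one `C` for all `h` and `k` (`exists_energy_taylor`).
Exchanging `h` and `k` makes `K'` Lipschitz; expanding the two neighboring nodes about `h` bounds
the interpolation error. -/

lemma eLpNorm_two_sq (f : α → F) (μ : Measure α) :
    eLpNorm f 2 μ ^ 2 = ∫⁻ x, ‖f x‖ₑ ^ 2 ∂μ := by
  have h := eLpNorm_nnreal_pow_eq_lintegral (f := f) (μ := μ) (p := 2) (by norm_num)
  norm_num at h
  exact_mod_cast h

lemma eLpNorm_two_le_iff {G : Type*} [NormedAddCommGroup G] {f : α → F} {g : β → G}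
    {μ : Measure α} {ν : Measure β} {C : ℝ≥0∞} :
    eLpNorm f 2 μ ≤ C * eLpNorm g 2 ν ↔
      ∫⁻ x, ‖f x‖ₑ ^ 2 ∂μ ≤ C ^ 2 * ∫⁻ x, ‖g x‖ₑ ^ 2 ∂ν := by
  rw [← eLpNorm_two_sq, ← eLpNorm_two_sq, ← mul_pow]
  exact (ENNReal.pow_right_strictMono two_ne_zero).le_iff_le.symm

/-- The Cauchy-Schwarz inequality against the constant function. -/
lemma sq_lintegral_le {ν : Measure α} {f : α → ℝ≥0∞} (hf : AEMeasurable f ν) :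
    (∫⁻ x, f x ∂ν) ^ 2 ≤ ν univ * ∫⁻ x, f x ^ 2 ∂ν := by
  have h := ENNReal.lintegral_mul_le_Lp_mul_Lq ν (p := 2) (q := 2)
    (by rw [Real.holderConjugate_iff]; norm_num) hf (aemeasurable_const (b := (1 : ℝ≥0∞)))
  simp only [Pi.mul_apply, mul_one, ENNReal.one_rpow, lintegral_const, one_mul] at h
  calc (∫⁻ x, f x ∂ν) ^ 2
      ≤ ((∫⁻ x, f x ^ (2 : ℝ) ∂ν) ^ (1 / 2 : ℝ) * ν univ ^ (1 / 2 : ℝ)) ^ 2 := by gcongr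
    _ = ν univ * ∫⁻ x, f x ^ 2 ∂ν := by
      rw [mul_pow, ← ENNReal.rpow_natCast, ← ENNReal.rpow_mul, ← ENNReal.rpow_natCast,
        ← ENNReal.rpow_mul, mul_comm]
      norm_num

/-- Jensen's inequality for a weighted average with nonnegative weight of integral one. -/
lemma sq_lintegral_mul_le {ν : Measure α} {w f : α → ℝ≥0∞} (hw : Measurable w)
    (hw1 : ∫⁻ x, w x ∂ν = 1) (hf : AEMeasurable f ν) :
    (∫⁻ x, w x * f x ∂ν) ^ 2 ≤ ∫⁻ x, w x * f x ^ 2 ∂ν := by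
  have : IsProbabilityMeasure (ν.withDensity w) := ⟨by simp [hw1]⟩
  have h := sq_lintegral_le (ν := ν.withDensity w) (f := f)
    (hf.mono_ac (withDensity_absolutelyContinuous _ _))
  rwa [measure_univ, one_mul, lintegral_withDensity_eq_lintegral_mul₀ hw.aemeasurable hf,
    lintegral_withDensity_eq_lintegral_mul₀ hw.aemeasurable (hf.pow_const 2)] at h

end General

/-! ### Volume under anti-Lipschitz maps, and mollification in `L²` -/

section Euclidean

variable {d : ℕ} {F : Type*} [NormedAddCommGroup F] [NormedSpace ℝ F]

/-- Hausdorff measure is built from diameters, so its behavior under anti-Lipschitz maps involves no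
derivative. Through this proportionality volume inherits the factor `K ^ d`. -/
lemma volume_eq_smul_hausdorff (d : ℕ) : ∃ c : ℝ≥0, (volume : Measure (EuclideanSpace ℝ (Fin d))) =
    c • Measure.hausdorffMeasure (d : ℝ) := by
  have : (Measure.hausdorffMeasure (d : ℝ) : Measure (EuclideanSpace ℝ (Fin d))).IsAddHaarMeasure := by
    simpa using MeasureTheory.isAddHaarMeasure_hausdorffMeasure (E := EuclideanSpace ℝ (Fin d))
  exact ⟨_, Measure.isAddLeftInvariant_eq_smul _ _⟩

lemma volume_preimage_le {f : EuclideanSpace ℝ (Fin d) → EuclideanSpace ℝ (Fin d)} {K : ℝ≥0}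
    (hf : AntilipschitzWith K f) (s : Set (EuclideanSpace ℝ (Fin d))) :
    volume (f ⁻¹' s) ≤ (K : ℝ≥0∞) ^ d * volume s := by
  obtain ⟨c, hc⟩ := volume_eq_smul_hausdorff d
  have h := hf.hausdorffMeasure_preimage_le (d := d) (by positivity) s
  rw [hc, Measure.smul_apply, Measure.smul_apply, ENNReal.smul_def, ENNReal.smul_def, smul_eq_mul,
    smul_eq_mul, mul_left_comm]
  gcongr
  simpa using h

lemma map_restrict_le {f : EuclideanSpace ℝ (Fin d) → EuclideanSpace ℝ (Fin d)} {K : ℝ≥0}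
    (hf : AntilipschitzWith K f) (hm : Measurable f) {s t : Set (EuclideanSpace ℝ (Fin d))}
    (hst : MapsTo f s t) :
    (volume.restrict s).map f ≤ (K ^ d : ℝ≥0) • volume.restrict t := by
  refine Measure.le_iff.2 fun u hu => ?_
  rw [Measure.map_apply hm hu, Measure.restrict_apply (hm hu), Measure.smul_apply,
    Measure.restrict_apply hu, ENNReal.smul_def, smul_eq_mul, ENNReal.coe_pow]
  refine (measure_mono ?_).trans (volume_preimage_le hf (u ∩ t))
  rintro x ⟨hx, hxs⟩
  exact ⟨hx, hst hxs⟩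

/-- This is strong continuity of the translation action on `Lp`, spelled out for a representative;
the additive action by `-t` produces `f (x - t)`. -/
lemma tendsto_eLpNorm_translate {F : Type*} [NormedAddCommGroup F] {f : EuclideanSpace ℝ (Fin d) → F} (hf : MemLp f 2 volume) :
    Tendsto (fun t => eLpNorm (fun x => f (x - t) - f x) 2 volume) (𝓝 0) (𝓝 0) := by
  have : Fact ((2 : ℝ≥0∞) ≠ ⊤) := ⟨by norm_num⟩
  let c : EuclideanSpace ℝ (Fin d) → Lp F 2 (volume : Measure (EuclideanSpace ℝ (Fin d))) :=
    fun t => DomAddAct.mk (-t) +ᵥ hf.toLp f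
  have hc : Continuous c := by
    have h1 : Continuous (fun t : EuclideanSpace ℝ (Fin d) => DomAddAct.mk (-t)) :=
      DomAddAct.continuous_mk.comp continuous_neg
    exact h1.vadd continuous_const
  have h0 : c 0 = hf.toLp f := by
    have : c 0 = DomAddAct.mk (-0 : EuclideanSpace ℝ (Fin d)) +ᵥ hf.toLp f := rfl
    rw [this, neg_zero, DomAddAct.mk_vadd_toLp]
    simp
  have h2 : Tendsto (fun t => ENNReal.ofReal ‖c t - c 0‖) (𝓝 0) (𝓝 0) := by
    have : Tendsto (fun t => ENNReal.ofReal ‖c t - c 0‖) (𝓝 0) (𝓝 (ENNReal.ofReal ‖c 0 - c 0‖)) :=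
      (ENNReal.continuous_ofReal.comp (hc.sub continuous_const).norm).tendsto 0
    simpa using this
  refine h2.congr fun t => ?_
  have ht : c t = DomAddAct.mk (-t) +ᵥ hf.toLp f := rfl
  rw [h0, ht, DomAddAct.mk_vadd_toLp, ← MemLp.toLp_sub, Lp.norm_toLp, ENNReal.ofReal_toReal]
  · congr 1
    ext x
    simp [neg_add_eq_sub]
  · exact (((hf.comp_measurePreserving (measurePreserving_vadd (-t) volume)).sub hf).eLpNorm_ne_top)

/-- The kernel has mass one, so the error is a weighted average of the differences `f (x - t) - f
x`. Jensen moves the square inside, Tonelli exchanges the integrals, and only `t` in the support of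
the kernel count. -/
lemma eLpNorm_two_convolution_sub_le {f : EuclideanSpace ℝ (Fin d) → F} [CompleteSpace F]
    (hf : MemLp f 2 volume)
    (φ : ContDiffBump (0 : EuclideanSpace ℝ (Fin d))) {ε : ℝ≥0∞}
    (hε : ∀ t ∈ ball (0 : EuclideanSpace ℝ (Fin d)) φ.rOut,
      eLpNorm (fun x => f (x - t) - f x) 2 volume ≤ ε) :
    eLpNorm (convolution (φ.normed volume) f (ContinuousLinearMap.lsmul ℝ ℝ) volume - f) 2 volume
      ≤ ε := by
  set w : EuclideanSpace ℝ (Fin d) → ℝ := φ.normed volume with hw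
  have hwc : Continuous w := φ.continuous_normed
  have hws : HasCompactSupport w := φ.hasCompactSupport_normed
  have hw0 : ∀ x, 0 ≤ w x := φ.nonneg_normed
  have hw1 : ∫⁻ x, ‖w x‖ₑ = 1 := by
    have h := φ.integral_normed (μ := (volume : Measure (EuclideanSpace ℝ (Fin d))))
    rw [integral_eq_lintegral_of_nonneg_ae (.of_forall hw0) hwc.aestronglyMeasurable] at h
    have : ∀ x, ‖w x‖ₑ = ENNReal.ofReal (w x) := fun x => Real.enorm_of_nonneg (hw0 x)
    simp_rw [this]
    rwa [ENNReal.toReal_eq_one_iff] at h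
  have hloc : LocallyIntegrable f := hf.locallyIntegrable (by norm_num)
  have hpt : ∀ x, ‖(convolution w f (ContinuousLinearMap.lsmul ℝ ℝ) volume - f) x‖ₑ ≤
      ∫⁻ t, ‖w t‖ₑ * ‖f (x - t) - f x‖ₑ := by
    intro x
    have hce := hws.convolutionExists_left (ContinuousLinearMap.lsmul ℝ ℝ : ℝ →L[ℝ] F →L[ℝ] F)
      hwc hloc x
    have h1 : (convolution w f (ContinuousLinearMap.lsmul ℝ ℝ) volume - f) x =
        ∫ t, w t • (f (x - t) - f x) := by
      simp only [smul_sub]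
      rw [integral_sub]
      · rw [Pi.sub_apply, φ.integral_normed_smul]; rfl
      · exact hce
      · exact (φ.integrable_normed).smul_const _
    rw [h1]
    refine (enorm_integral_le_lintegral_enorm _).trans (le_of_eq ?_)
    simp [enorm_smul]
  have hjm : AEMeasurable (fun p : EuclideanSpace ℝ (Fin d) × EuclideanSpace ℝ (Fin d) =>
      ‖w p.2‖ₑ * ‖f (p.1 - p.2) - f p.1‖ₑ ^ 2) (volume.prod volume) := by
    have h1 : AEStronglyMeasurable (fun p : EuclideanSpace ℝ (Fin d) × EuclideanSpace ℝ (Fin d) =>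
        f (p.1 - p.2)) (volume.prod volume) :=
      hf.1.comp_quasiMeasurePreserving (quasiMeasurePreserving_sub_of_right_invariant volume volume)
    have h2 : AEStronglyMeasurable (fun p : EuclideanSpace ℝ (Fin d) × EuclideanSpace ℝ (Fin d) =>
        f p.1) (volume.prod volume) := hf.1.comp_fst
    exact ((hwc.comp continuous_snd).enorm.aemeasurable).mul ((h1.sub h2).enorm.pow_const 2)
  rw [← (ENNReal.pow_right_strictMono two_ne_zero).le_iff_le, eLpNorm_two_sq]
  calc ∫⁻ x, ‖(convolution w f (ContinuousLinearMap.lsmul ℝ ℝ) volume - f) x‖ₑ ^ 2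
      ≤ ∫⁻ x, ∫⁻ t, ‖w t‖ₑ * ‖f (x - t) - f x‖ₑ ^ 2 := by
        refine lintegral_mono fun x => ?_
        refine (pow_le_pow_left' (hpt x) 2).trans ?_
        refine sq_lintegral_mul_le hwc.enorm.measurable hw1 ?_
        have : AEStronglyMeasurable (fun t => f (x - t)) volume :=
          hf.1.comp_measurePreserving (Measure.measurePreserving_sub_left volume x)
        exact (this.sub aestronglyMeasurable_const).enorm
    _ = ∫⁻ t, ∫⁻ x, ‖w t‖ₑ * ‖f (x - t) - f x‖ₑ ^ 2 := lintegral_lintegral_swap hjm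
    _ ≤ ∫⁻ t, ‖w t‖ₑ * ε ^ 2 := by
        refine lintegral_mono fun t => ?_
        by_cases ht : t ∈ ball (0 : EuclideanSpace ℝ (Fin d)) φ.rOut
        · rw [lintegral_const_mul' _ _ enorm_ne_top]
          gcongr
          rw [← eLpNorm_two_sq (fun x => f (x - t) - f x)]
          exact pow_le_pow_left' (hε t ht) 2
        · have : w t = 0 := by
            rw [← Function.notMem_support, hw, φ.support_normed_eq]; exact ht
          simp [this]
    _ = ε ^ 2 := by
        rw [lintegral_mul_const _ hwc.enorm.measurable, hw1, one_mul]

end Euclidean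

/-! ### Weak gradients: smooth approximation and the chain rule -/

variable {d : ℕ}

/-- `g` is the distributional gradient of `u` on the open set `O`. -/
def HasWeakGradOn (O : Set (EuclideanSpace ℝ (Fin d))) (u : EuclideanSpace ℝ (Fin d) → ℝ)
    (g : EuclideanSpace ℝ (Fin d) → EuclideanSpace ℝ (Fin d)) : Prop :=
  ∀ φ : EuclideanSpace ℝ (Fin d) → ℝ, ContDiff ℝ ∞ φ → HasCompactSupport φ →
    tsupport φ ⊆ O → ∀ i : Fin d,
      ∫ y, u y * fderiv ℝ φ y (EuclideanSpace.single i 1) = - ∫ y, g y i * φ y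

/-- Square integrability on the compact subsets of `O`. -/
def LocL2On {F : Type*} [NormedAddCommGroup F] (O : Set (EuclideanSpace ℝ (Fin d)))
    (u : EuclideanSpace ℝ (Fin d) → F) : Prop :=
  ∀ K ⊆ O, IsCompact K → MemLp u 2 (volume.restrict K)

lemma gradient_apply_eq_fderiv {v : EuclideanSpace ℝ (Fin d) → ℝ} {x : EuclideanSpace ℝ (Fin d)}
    (i : Fin d) : gradient v x i = fderiv ℝ v x (EuclideanSpace.single i 1) := by
  rw [← inner_gradient_left, EuclideanSpace.inner_single_right]
  simp

/-- When the closed ball of radius `φ.rOut` about `x` lies in `K`, the function `y ↦ w (x - y)` is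
an admissible test function, and the weak derivative passes from the kernel to `g`. Cutting off by
the indicator of `K` makes the convolutions globally defined without changing them at such `x`. -/
lemma HasWeakGradOn.gradient_convolution {O : Set (EuclideanSpace ℝ (Fin d))}
    {u : EuclideanSpace ℝ (Fin d) → ℝ} {g : EuclideanSpace ℝ (Fin d) → EuclideanSpace ℝ (Fin d)}
    (h : HasWeakGradOn O u g) {K : Set (EuclideanSpace ℝ (Fin d))} (hKm : MeasurableSet K)
    (hKO : K ⊆ O)
    (hu : MemLp u 2 (volume.restrict K)) (hg : MemLp g 2 (volume.restrict K))
    (φ : ContDiffBump (0 : EuclideanSpace ℝ (Fin d))) {x : EuclideanSpace ℝ (Fin d)}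
    (hx : closedBall x φ.rOut ⊆ K) :
    gradient (convolution (φ.normed volume) (K.indicator u) (ContinuousLinearMap.lsmul ℝ ℝ) volume)
      x = convolution (φ.normed volume) (K.indicator g) (ContinuousLinearMap.lsmul ℝ ℝ) volume x := by
  set w : EuclideanSpace ℝ (Fin d) → ℝ := φ.normed volume with hw
  have hwc : Continuous w := φ.continuous_normed
  have hws : HasCompactSupport w := φ.hasCompactSupport_normed
  have hwd : ContDiff ℝ ∞ w := φ.contDiff_normed
  have hf : LocallyIntegrable (K.indicator u) volume :=
    ((memLp_indicator_iff_restrict hKm).2 hu).locallyIntegrable (by norm_num)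
  have hG : LocallyIntegrable (K.indicator g) volume :=
    ((memLp_indicator_iff_restrict hKm).2 hg).locallyIntegrable (by norm_num)
  have hts : tsupport w = closedBall 0 φ.rOut := φ.tsupport_normed_eq
  ext i
  rw [gradient_apply_eq_fderiv]
  have hd := (hws.hasFDerivAt_convolution_left (ContinuousLinearMap.lsmul ℝ ℝ : ℝ →L[ℝ] ℝ →L[ℝ] ℝ)
    (hwd.of_le (by norm_cast)) hf x).fderiv
  rw [hd]
  have hce : ConvolutionExistsAt (fderiv ℝ w) (K.indicator u) x
      (ContinuousLinearMap.precompL (EuclideanSpace ℝ (Fin d))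
        (ContinuousLinearMap.lsmul ℝ ℝ : ℝ →L[ℝ] ℝ →L[ℝ] ℝ)) volume :=
    (hws.fderiv ℝ).convolutionExists_left _ (hwd.continuous_fderiv (by norm_num)) hf x
  have hce2 : ConvolutionExistsAt w (K.indicator g) x
      (ContinuousLinearMap.lsmul ℝ ℝ : ℝ →L[ℝ] EuclideanSpace ℝ (Fin d) →L[ℝ] _) volume :=
    hws.convolutionExists_left _ hwc hG x
  set ψ : EuclideanSpace ℝ (Fin d) → ℝ := fun y => w (x - y) with hψ
  have hψd : ContDiff ℝ ∞ ψ := hwd.comp (contDiff_const.sub contDiff_id)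
  have hψt : tsupport ψ ⊆ closedBall x φ.rOut := by
    refine closure_minimal ?_ isClosed_closedBall
    intro y hy
    have : x - y ∈ tsupport w := subset_tsupport _ hy
    rw [hts, mem_closedBall_zero_iff] at this
    rwa [mem_closedBall, dist_comm, dist_eq_norm]
  have hψs : HasCompactSupport ψ :=
    HasCompactSupport.of_support_subset_isCompact (isCompact_closedBall x φ.rOut)
      ((subset_tsupport _).trans hψt)
  have hψf : ∀ y, fderiv ℝ ψ y (EuclideanSpace.single i 1) =
      - fderiv ℝ w (x - y) (EuclideanSpace.single i 1) := by
    intro y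
    have h1 : HasFDerivAt ψ ((fderiv ℝ w (x - y)).comp
        (-ContinuousLinearMap.id ℝ (EuclideanSpace ℝ (Fin d)))) y := by
      refine HasFDerivAt.comp y ((hwd.differentiable (by norm_num)) (x - y)).hasFDerivAt ?_
      simpa using (hasFDerivAt_id y).const_sub x
    rw [h1.fderiv]; simp
  have key := h ψ hψd hψs (hψt.trans (hx.trans hKO)) i
  calc (convolution (fderiv ℝ w) (K.indicator u) (ContinuousLinearMap.precompL _
        (ContinuousLinearMap.lsmul ℝ ℝ)) volume x) (EuclideanSpace.single i 1)
      = ∫ t, fderiv ℝ w t (EuclideanSpace.single i 1) * K.indicator u (x - t) := by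
        rw [convolution_def, ContinuousLinearMap.integral_apply hce]; rfl
    _ = ∫ y, fderiv ℝ w (x - y) (EuclideanSpace.single i 1) * K.indicator u y := by
        rw [← integral_sub_left_eq_self _ volume x]; simp
    _ = - ∫ y, u y * fderiv ℝ ψ y (EuclideanSpace.single i 1) := by
        rw [← integral_neg]
        refine integral_congr_ae (.of_forall fun y => ?_)
        dsimp only
        rw [hψf]
        by_cases hy : y ∈ K
        · rw [indicator_of_mem hy]; ring
        · have h0 : fderiv ℝ ψ y = 0 := by
            rw [← Function.notMem_support]
            exact fun hc => hy (hx (hψt (support_fderiv_subset ℝ hc)))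
          have := hψf y
          rw [h0] at this
          rw [indicator_of_notMem hy, ← this]; simp
    _ = ∫ y, g y i * ψ y := by rw [key, neg_neg]
    _ = ∫ y, w (x - y) * (K.indicator g y) i := by
        refine integral_congr_ae (.of_forall fun y => ?_)
        dsimp only
        by_cases hy : y ∈ K
        · rw [indicator_of_mem hy, hψ]; ring
        · have h0 : ψ y = 0 := by
            rw [← Function.notMem_support]
            exact fun hc => hy (hx (hψt (subset_tsupport _ hc)))
          rw [indicator_of_notMem hy, h0]; simp
    _ = ∫ t, w t * (K.indicator g (x - t)) i := by
        rw [← integral_sub_left_eq_self _ volume x]; simp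
    _ = (convolution w (K.indicator g) (ContinuousLinearMap.lsmul ℝ ℝ) volume x) i := by
        rw [convolution_def]
        have := (EuclideanSpace.proj i : EuclideanSpace ℝ (Fin d) →L[ℝ] ℝ).integral_comp_comm hce2
        simpa using this

/-- Local approximation of Sobolev functions by smooth ones. -/
lemma HasWeakGradOn.exists_smooth_approx {O : Set (EuclideanSpace ℝ (Fin d))}
    {u : EuclideanSpace ℝ (Fin d) → ℝ} {g : EuclideanSpace ℝ (Fin d) → EuclideanSpace ℝ (Fin d)}
    (hO : IsOpen O) (h : HasWeakGradOn O u g) (hu : LocL2On O u) (hg : LocL2On O g)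
    {K : Set (EuclideanSpace ℝ (Fin d))} (hK : IsCompact K) (hKO : K ⊆ O) {ε : ℝ≥0∞} (hε : 0 < ε) :
    ∃ v : EuclideanSpace ℝ (Fin d) → ℝ, ContDiff ℝ ∞ v ∧ HasCompactSupport v ∧
      eLpNorm (fun x => v x - u x) 2 (volume.restrict K) ≤ ε ∧
      eLpNorm (fun x => gradient v x - g x) 2 (volume.restrict K) ≤ ε := by
  obtain ⟨r, hr, hrO⟩ := hK.exists_cthickening_subset_open hO hKO
  set K' := cthickening r K with hK'
  have hK'c : IsCompact K' := hK.cthickening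
  have hK'm : MeasurableSet K' := hK'c.measurableSet
  have hf : MemLp (K'.indicator u) 2 volume :=
    (memLp_indicator_iff_restrict hK'm).2 (hu K' hrO hK'c)
  have hG : MemLp (K'.indicator g) 2 volume :=
    (memLp_indicator_iff_restrict hK'm).2 (hg K' hrO hK'c)
  have h1 := (tendsto_eLpNorm_translate hf).eventually (ge_mem_nhds hε)
  have h2 := (tendsto_eLpNorm_translate hG).eventually (ge_mem_nhds hε)
  obtain ⟨s, hs, hsb⟩ := Metric.eventually_nhds_iff_ball.1 (h1.and h2)
  let φ : ContDiffBump (0 : EuclideanSpace ℝ (Fin d)) :=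
    ⟨min r s / 2, min r s, by positivity, half_lt_self (by positivity)⟩
  have hφ : φ.rOut = min r s := rfl
  have hfa := eLpNorm_two_convolution_sub_le hf φ (ε := ε) fun t ht =>
    (hsb t (ball_subset_ball (min_le_right _ _) ht)).1
  have hGa := eLpNorm_two_convolution_sub_le hG φ (ε := ε) fun t ht =>
    (hsb t (ball_subset_ball (min_le_right _ _) ht)).2
  have hKK' : K ⊆ K' := self_subset_cthickening K
  refine ⟨convolution (φ.normed volume) (K'.indicator u) (ContinuousLinearMap.lsmul ℝ ℝ) volume,
    φ.hasCompactSupport_normed.contDiff_convolution_left _ φ.contDiff_normed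
      (hf.locallyIntegrable (by norm_num)), ?_, ?_, ?_⟩
  · refine HasCompactSupport.convolution _ φ.hasCompactSupport_normed ?_
    exact HasCompactSupport.of_support_subset_isCompact hK'c support_indicator_subset
  · refine le_trans (le_of_eq ?_) ((eLpNorm_restrict_le _ 2 volume K).trans hfa)
    refine eLpNorm_congr_ae ?_
    filter_upwards [ae_restrict_mem hK.measurableSet] with x hx
    rw [Pi.sub_apply, indicator_of_mem (hKK' hx)]
  · refine le_trans (le_of_eq ?_) ((eLpNorm_restrict_le _ 2 volume K).trans hGa)
    refine eLpNorm_congr_ae ?_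
    filter_upwards [ae_restrict_mem hK.measurableSet] with x hx
    rw [Pi.sub_apply, indicator_of_mem (hKK' hx)]
    rw [h.gradient_convolution hK'm hrO (hu K' hrO hK'c) (hg K' hrO hK'c)]
    refine (closedBall_subset_cthickening hx _).trans (cthickening_mono (min_le_left _ _) K)

lemma lintegral_comp_le {f : EuclideanSpace ℝ (Fin d) → EuclideanSpace ℝ (Fin d)} {K : ℝ≥0}
    (hf : AntilipschitzWith K f) (hm : Measurable f) {s t : Set (EuclideanSpace ℝ (Fin d))}
    (hst : MapsTo f s t) {h : EuclideanSpace ℝ (Fin d) → ℝ≥0∞}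
    (hh : AEMeasurable h (volume.restrict t)) :
    ∫⁻ x in s, h (f x) ≤ (K ^ d : ℝ≥0) * ∫⁻ x in t, h x := by
  have hle := map_restrict_le hf hm hst
  have hac : (volume.restrict s).map f ≪ volume.restrict t :=
    (Measure.absolutelyContinuous_of_le hle).trans (Measure.smul_absolutelyContinuous)
  rw [← lintegral_map' (hh.mono_ac hac) hm.aemeasurable]
  refine (lintegral_mono' hle le_rfl).trans ?_
  rw [lintegral_smul_measure, ENNReal.smul_def, smul_eq_mul]

lemma memLp_comp {F : Type*} [NormedAddCommGroup F]
    {f : EuclideanSpace ℝ (Fin d) → EuclideanSpace ℝ (Fin d)} {K : ℝ≥0}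
    (hf : AntilipschitzWith K f) (hm : Measurable f) {s t : Set (EuclideanSpace ℝ (Fin d))}
    (hst : MapsTo f s t) {h : EuclideanSpace ℝ (Fin d) → F}
    (hh : MemLp h 2 (volume.restrict t)) : MemLp (fun x => h (f x)) 2 (volume.restrict s) := by
  have hle := map_restrict_le hf hm hst
  have h1 : MemLp h 2 ((volume.restrict s).map f) :=
    hh.of_measure_le_smul (c := ((K ^ d : ℝ≥0) : ℝ≥0∞)) ENNReal.coe_ne_top hle
  exact (memLp_map_measure_iff h1.1 hm.aemeasurable).1 h1

lemma eLpNorm_comp_le {F : Type*} [NormedAddCommGroup F]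
    {f : EuclideanSpace ℝ (Fin d) → EuclideanSpace ℝ (Fin d)} {K : ℝ≥0}
    (hf : AntilipschitzWith K f) (hm : Measurable f) {s t : Set (EuclideanSpace ℝ (Fin d))}
    (hst : MapsTo f s t) {h : EuclideanSpace ℝ (Fin d) → F}
    (hh : AEStronglyMeasurable h (volume.restrict t)) :
    eLpNorm (fun x => h (f x)) 2 (volume.restrict s) ≤
      ((K + 1) ^ d : ℝ≥0) * eLpNorm h 2 (volume.restrict t) := by
  rw [eLpNorm_two_le_iff]
  refine (lintegral_comp_le hf hm hst (hh.enorm.pow_const 2)).trans ?_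
  gcongr
  rw [← ENNReal.coe_pow, ENNReal.coe_le_coe, ← pow_mul, mul_comm d, pow_mul]
  refine pow_le_pow_left' ?_ d
  nlinarith [zero_le (a := K)]

lemma tendsto_integral_mul {α ι : Type*} [MeasurableSpace α] {μ : Measure α} {l : Filter ι}
    {f : ι → α → ℝ} {f₀ ψ : α → ℝ} (hf : ∀ n, MemLp (f n) 2 μ) (hf₀ : MemLp f₀ 2 μ)
    (hψ : MemLp ψ 2 μ) (h : Tendsto (fun n => eLpNorm (fun x => f n x - f₀ x) 2 μ) l (𝓝 0)) :
    Tendsto (fun n => ∫ x, f n x * ψ x ∂μ) l (𝓝 (∫ x, f₀ x * ψ x ∂μ)) := by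
  refine tendsto_integral_of_L1 _ (hf₀.integrable_mul hψ).1
    (.of_forall fun n => (hf n).integrable_mul hψ) ?_
  have h2 : Tendsto (fun n => eLpNorm (fun x => f n x - f₀ x) 2 μ * eLpNorm ψ 2 μ) l (𝓝 0) := by
    simpa using ENNReal.Tendsto.mul_const h (Or.inr hψ.eLpNorm_ne_top)
  refine tendsto_of_tendsto_of_tendsto_of_le_of_le tendsto_const_nhds h2 (fun _ => zero_le)
    fun n => ?_
  have := eLpNorm_smul_le_mul_eLpNorm (p := 2) (q := 2) (r := 1) hψ.1 ((hf n).sub hf₀).1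
  rw [eLpNorm_one_eq_lintegral_enorm] at this
  refine le_trans (le_of_eq ?_) this
  refine lintegral_congr fun x => ?_
  simp [sub_mul]

lemma memLp_two_of_continuous {F : Type*} [NormedAddCommGroup F]
    {f : EuclideanSpace ℝ (Fin d) → F} (hf : Continuous f) {K : Set (EuclideanSpace ℝ (Fin d))}
    (hK : IsCompact K) : MemLp f 2 (volume.restrict K) := by
  obtain ⟨C, hC⟩ := hK.exists_bound_of_continuousOn hf.continuousOn
  have : IsFiniteMeasure (volume.restrict K) := ⟨by simpa using hK.measure_lt_top⟩
  exact MemLp.of_bound hf.aestronglyMeasurable C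
    ((ae_restrict_mem hK.measurableSet).mono hC)

lemma lineDeriv_comp_eq {v : EuclideanSpace ℝ (Fin d) → ℝ} (hv : Differentiable ℝ v)
    {f : EuclideanSpace ℝ (Fin d) → EuclideanSpace ℝ (Fin d)} {x : EuclideanSpace ℝ (Fin d)}
    (hf : DifferentiableAt ℝ f x) (i : Fin d) :
    lineDeriv ℝ (fun y => v (f y)) x (EuclideanSpace.single i 1) =
      (ContinuousLinearMap.adjoint (fderiv ℝ f x) (gradient v (f x))) i := by
  have h1 : DifferentiableAt ℝ (fun y => v (f y)) x := (hv (f x)).comp x hf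
  rw [h1.lineDeriv_eq_fderiv, show fderiv ℝ (fun y => v (f y)) x = _ from fderiv_comp x (hv (f x)) hf]
  have h2 : ∀ z : EuclideanSpace ℝ (Fin d), z i = inner ℝ z (EuclideanSpace.single i 1) := by
    intro z; simp [EuclideanSpace.inner_single_right]
  rw [h2, ContinuousLinearMap.adjoint_inner_left, inner_gradient_left]
  rfl

lemma norm_adjoint_fderiv_le {f : EuclideanSpace ℝ (Fin d) → EuclideanSpace ℝ (Fin d)} {L : ℝ≥0}
    (hL : LipschitzWith L f) (x : EuclideanSpace ℝ (Fin d)) :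
    ‖ContinuousLinearMap.adjoint (fderiv ℝ f x)‖ ≤ L := by
  rw [LinearIsometryEquiv.norm_map]
  exact norm_fderiv_le_of_lipschitz ℝ hL

lemma measurable_adjoint_fderiv (f : EuclideanSpace ℝ (Fin d) → EuclideanSpace ℝ (Fin d)) :
    Measurable (fun x => ContinuousLinearMap.adjoint (fderiv ℝ f x)) :=
  (ContinuousLinearMap.adjoint (𝕜 := ℝ) (E := EuclideanSpace ℝ (Fin d))
    (F := EuclideanSpace ℝ (Fin d))).continuous.measurable.comp (measurable_fderiv ℝ f)

lemma aestronglyMeasurable_adjoint_fderiv_apply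
    (f : EuclideanSpace ℝ (Fin d) → EuclideanSpace ℝ (Fin d))
    {μ : Measure (EuclideanSpace ℝ (Fin d))} {w : EuclideanSpace ℝ (Fin d) → EuclideanSpace ℝ (Fin d)}
    (hw : AEStronglyMeasurable w μ) :
    AEStronglyMeasurable (fun x => ContinuousLinearMap.adjoint (fderiv ℝ f x) (w x)) μ := by
  have h1 : AEStronglyMeasurable (fun x => ContinuousLinearMap.adjoint (fderiv ℝ f x)) μ :=
    (measurable_adjoint_fderiv f).aestronglyMeasurable
  exact (isBoundedBilinearMap_apply (𝕜 := ℝ) (E := EuclideanSpace ℝ (Fin d))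
    (F := EuclideanSpace ℝ (Fin d))).continuous.comp_aestronglyMeasurable (h1.prodMk hw)

lemma memLp_adjoint_fderiv_apply
    {f : EuclideanSpace ℝ (Fin d) → EuclideanSpace ℝ (Fin d)} {L : ℝ≥0} (hL : LipschitzWith L f)
    {μ : Measure (EuclideanSpace ℝ (Fin d))} {w : EuclideanSpace ℝ (Fin d) → EuclideanSpace ℝ (Fin d)}
    (hw : MemLp w 2 μ) :
    MemLp (fun x => ContinuousLinearMap.adjoint (fderiv ℝ f x) (w x)) 2 μ :=
  MemLp.of_le_mul (c := L) hw (aestronglyMeasurable_adjoint_fderiv_apply f hw.1)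
    (.of_forall fun x => (ContinuousLinearMap.le_opNorm _ _).trans
      (by gcongr; exact norm_adjoint_fderiv_le hL x))

lemma memLp_apply {μ : Measure (EuclideanSpace ℝ (Fin d))}
    {w : EuclideanSpace ℝ (Fin d) → EuclideanSpace ℝ (Fin d)} (hw : MemLp w 2 μ) (i : Fin d) :
    MemLp (fun x => w x i) 2 μ :=
  (EuclideanSpace.proj i : EuclideanSpace ℝ (Fin d) →L[ℝ] ℝ).comp_memLp' hw

/-- Chain rule for the composition of a Sobolev function with a bi-Lipschitz homeomorphism. -/
theorem HasWeakGradOn.comp {O : Set (EuclideanSpace ℝ (Fin d))}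
    {u : EuclideanSpace ℝ (Fin d) → ℝ} {g : EuclideanSpace ℝ (Fin d) → EuclideanSpace ℝ (Fin d)}
    (hO : IsOpen O) (h : HasWeakGradOn O u g) (hu : LocL2On O u) (hg : LocL2On O g)
    (f : EuclideanSpace ℝ (Fin d) ≃ₜ EuclideanSpace ℝ (Fin d)) {L K : ℝ≥0}
    (hL : LipschitzWith L f) (hK : AntilipschitzWith K f) :
    HasWeakGradOn (f ⁻¹' O) (fun x => u (f x))
      (fun x => ContinuousLinearMap.adjoint (fderiv ℝ f x) (g (f x))) := by
  intro φ hφ hφs hφO i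
  set S := tsupport φ with hS
  have hSc : IsCompact S := hφs
  set T := f '' S with hT
  have hTc : IsCompact T := hSc.image f.continuous
  have hTO : T ⊆ O := by rintro _ ⟨x, hx, rfl⟩; exact hφO hx
  have hST : MapsTo f S T := mapsTo_image f S
  have hfm : Measurable f := f.continuous.measurable
  set e : EuclideanSpace ℝ (Fin d) := EuclideanSpace.single i 1 with he
  have hε : ∀ n : ℕ, (0 : ℝ≥0∞) < ((n : ℝ≥0∞) + 1)⁻¹ := fun n => by simp
  -- Approximation is needed only on the compact image of the support of `φ`. Each `v n ∘ f` is
  -- Lipschitz, so integration by parts holds for it through Rademacher's theorem; the resulting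
  -- identity is linear and passes to the `L²` limit.
  choose v hv hvs hvu hvg using fun n : ℕ => h.exists_smooth_approx hO hu hg hTc hTO (hε n)
  have hlim : Tendsto (fun n : ℕ => ((n : ℝ≥0∞) + 1)⁻¹) atTop (𝓝 0) := by
    have := (tendsto_add_atTop_iff_nat 1).2 ENNReal.tendsto_inv_nat_nhds_zero
    simpa using this
  have hvgc : ∀ n, Continuous (gradient (v n)) := fun n =>
    (InnerProductSpace.toDual ℝ _).symm.continuous.comp ((hv n).continuous_fderiv (by norm_num))
  have hpull : ∀ w : EuclideanSpace ℝ (Fin d) → EuclideanSpace ℝ (Fin d),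
      MemLp w 2 (volume.restrict T) →
      MemLp (fun x => (ContinuousLinearMap.adjoint (fderiv ℝ f x) (w (f x))) i) 2
        (volume.restrict S) := fun w hw =>
    memLp_apply (memLp_adjoint_fderiv_apply hL (memLp_comp hK hfm hST hw)) i
  have huT := hu T hTO hTc
  have hgT := hg T hTO hTc
  have hψ1 : MemLp (fun y => fderiv ℝ φ y e) 2 (volume.restrict S) :=
    memLp_two_of_continuous ((hφ.continuous_fderiv (by norm_num)).clm_apply continuous_const) hSc
  have hψ2 : MemLp φ 2 (volume.restrict S) := memLp_two_of_continuous hφ.continuous hSc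
  have hlim1 : Tendsto (fun n => ∫ y in S, v n (f y) * fderiv ℝ φ y e) atTop
      (𝓝 (∫ y in S, u (f y) * fderiv ℝ φ y e)) := by
    refine tendsto_integral_mul
      (fun n => memLp_comp hK hfm hST (memLp_two_of_continuous (hv n).continuous hTc))
      (memLp_comp hK hfm hST huT) hψ1 ?_
    have h2 : Tendsto (fun n : ℕ => (((K + 1) ^ d : ℝ≥0) : ℝ≥0∞) * ((n : ℝ≥0∞) + 1)⁻¹) atTop (𝓝 0) := by
      simpa using ENNReal.Tendsto.const_mul (a := (((K + 1) ^ d : ℝ≥0) : ℝ≥0∞)) hlim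
        (Or.inr ENNReal.coe_ne_top)
    refine tendsto_of_tendsto_of_tendsto_of_le_of_le tendsto_const_nhds h2 (fun _ => zero_le)
      fun n => ?_
    refine (eLpNorm_comp_le hK hfm hST
      ((hv n).continuous.aestronglyMeasurable.sub huT.1)).trans ?_
    gcongr
    exact hvu n
  have hlim2 : Tendsto (fun n => ∫ y in S,
      (ContinuousLinearMap.adjoint (fderiv ℝ f y) (gradient (v n) (f y))) i * φ y) atTop
      (𝓝 (∫ y in S, (ContinuousLinearMap.adjoint (fderiv ℝ f y) (g (f y))) i * φ y)) := by
    refine tendsto_integral_mul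
      (fun n => hpull _ (memLp_two_of_continuous (hvgc n) hTc)) (hpull _ hgT) hψ2 ?_
    have h2 : Tendsto (fun n : ℕ => (L : ℝ≥0∞) * ((((K + 1) ^ d : ℝ≥0) : ℝ≥0∞) * ((n : ℝ≥0∞) + 1)⁻¹))
        atTop (𝓝 0) := by
      have := ENNReal.Tendsto.const_mul (a := (((K + 1) ^ d : ℝ≥0) : ℝ≥0∞)) hlim
        (Or.inr ENNReal.coe_ne_top)
      have := ENNReal.Tendsto.const_mul (a := (L : ℝ≥0∞)) this (Or.inr ENNReal.coe_ne_top)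
      simpa using this
    refine tendsto_of_tendsto_of_tendsto_of_le_of_le tendsto_const_nhds h2 (fun _ => zero_le)
      fun n => ?_
    have h3 : eLpNorm (fun x => gradient (v n) (f x) - g (f x)) 2 (volume.restrict S) ≤
        (((K + 1) ^ d : ℝ≥0) : ℝ≥0∞) * ((n : ℝ≥0∞) + 1)⁻¹ := by
      refine (eLpNorm_comp_le (h := fun y => gradient (v n) y - g y) hK hfm hST
        ((hvgc n).aestronglyMeasurable.sub hgT.1)).trans ?_
      gcongr
      exact hvg n
    refine le_trans ?_ (mul_le_mul_right h3 (L : ℝ≥0∞))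
    refine eLpNorm_le_nnreal_smul_eLpNorm_of_ae_le_mul (.of_forall fun x => ?_) 2
    rw [← NNReal.coe_le_coe]
    push_cast
    rw [← PiLp.sub_apply, ← map_sub]
    exact (PiLp.norm_apply_le _ i).trans
      ((ContinuousLinearMap.le_opNorm _ _).trans (by gcongr; exact norm_adjoint_fderiv_le hL x))
  have hzero1 : ∀ w : EuclideanSpace ℝ (Fin d) → ℝ,
      ∫ y in S, w y * fderiv ℝ φ y e = ∫ y, w y * fderiv ℝ φ y e := fun w =>
    setIntegral_eq_integral_of_forall_compl_eq_zero fun x hx => by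
      have : fderiv ℝ φ x = 0 := by
        rw [← Function.notMem_support]; exact fun hc => hx (support_fderiv_subset ℝ hc)
      simp [this]
  have hzero2 : ∀ w : EuclideanSpace ℝ (Fin d) → ℝ,
      ∫ y in S, w y * φ y = ∫ y, w y * φ y := fun w =>
    setIntegral_eq_integral_of_forall_compl_eq_zero fun x hx => by
      rw [image_eq_zero_of_notMem_tsupport hx, mul_zero]
  have heq : ∀ n, ∫ y in S, v n (f y) * fderiv ℝ φ y e = - ∫ y in S,
      (ContinuousLinearMap.adjoint (fderiv ℝ f y) (gradient (v n) (f y))) i * φ y := by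
    intro n
    rw [hzero1, hzero2]
    obtain ⟨C, hC⟩ := ((hv n).of_le (m := 1) (by norm_cast)).lipschitzWith_of_hasCompactSupport
      (hvs n) one_ne_zero
    obtain ⟨D, hD⟩ := (hφ.of_le (m := 1) (by norm_cast)).lipschitzWith_of_hasCompactSupport
      hφs one_ne_zero
    have := LipschitzWith.integral_lineDeriv_mul_eq (μ := volume) (hC.comp hL) hD hφs e
    have h1 : ∫ y, (ContinuousLinearMap.adjoint (fderiv ℝ f y) (gradient (v n) (f y))) i * φ y =
        ∫ y, lineDeriv ℝ (v n ∘ f) y e * φ y := by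
      refine integral_congr_ae ?_
      filter_upwards [hL.ae_differentiableAt (μ := volume)] with x hx
      rw [← lineDeriv_comp_eq ((hv n).differentiable (by norm_num)) hx]
      rfl
    rw [h1, this, ← integral_neg]
    refine integral_congr_ae (.of_forall fun x => ?_)
    have hφd : DifferentiableAt ℝ φ x := hφ.differentiable (by norm_num) x
    simp only [hφd.lineDeriv_eq_fderiv, map_neg, Function.comp]
    ring
  have := tendsto_nhds_unique hlim1 ((hlim2.neg).congr fun n => (heq n).symm)
  rw [hzero1, hzero2] at this
  exact this

/-! ### Poincaré's inequality on balls -/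

lemma enorm_add_sq_le (a b : ℝ≥0∞) : (a + b) ^ 2 ≤ 4 * (a ^ 2 + b ^ 2) := by
  have h : a + b ≤ 2 * max a b := by
    rw [two_mul]; exact add_le_add (le_max_left _ _) (le_max_right _ _)
  have h2 : max a b ^ 2 ≤ a ^ 2 + b ^ 2 := by
    rcases le_total a b with hab | hab
    · rw [max_eq_right hab]; exact le_add_self
    · rw [max_eq_left hab]; exact le_self_add
  calc (a + b) ^ 2 ≤ (2 * max a b) ^ 2 := pow_le_pow_left' h 2
    _ = 4 * max a b ^ 2 := by rw [mul_pow]; norm_num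
    _ ≤ _ := by gcongr

lemma continuous_gradient {v : EuclideanSpace ℝ (Fin d) → ℝ} (hv : ContDiff ℝ 1 v) :
    Continuous (gradient v) :=
  (InnerProductSpace.toDual ℝ _).symm.continuous.comp (hv.continuous_fderiv one_ne_zero)

lemma enorm_sub_le_lintegral_gradient {v : EuclideanSpace ℝ (Fin d) → ℝ} (hv : ContDiff ℝ 1 v)
    (x z : EuclideanSpace ℝ (Fin d)) :
    ‖v (x + z) - v x‖ₑ ≤ ‖z‖ₑ * ∫⁻ t in Ioc (0 : ℝ) 1, ‖gradient v (x + t • z)‖ₑ := by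
  have hc : Continuous fun t : ℝ => fderiv ℝ v (x + t • z) z :=
    ((hv.continuous_fderiv one_ne_zero).comp (by fun_prop)).clm_apply continuous_const
  have h1 : ∫ t in (0 : ℝ)..1, fderiv ℝ v (x + t • z) z = v (x + z) - v x := by
    have := intervalIntegral.integral_eq_sub_of_hasDerivAt (a := (0 : ℝ)) (b := 1)
      (f := fun t : ℝ => v (x + t • z)) (f' := fun t => fderiv ℝ v (x + t • z) z)
      (fun t _ => by
        have h2 : HasDerivAt (fun t : ℝ => x + t • z) z t := by
          simpa using ((hasDerivAt_id t).smul_const z).const_add x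
        exact ((hv.differentiable one_ne_zero) _).hasFDerivAt.comp_hasDerivAt t h2)
      (hc.intervalIntegrable _ _)
    simpa using this
  rw [← h1, intervalIntegral.integral_of_le zero_le_one]
  refine (enorm_integral_le_lintegral_enorm _).trans ?_
  rw [← lintegral_const_mul' _ _ enorm_ne_top]
  refine lintegral_mono fun t => ?_
  rw [← inner_gradient_left, mul_comm]
  rw [enorm_eq_nnnorm, enorm_eq_nnnorm, enorm_eq_nnnorm]
  exact ENNReal.coe_le_coe.2 (nnnorm_inner_le_nnnorm (𝕜 := ℝ) _ _)

/-- The increment is the integral of the gradient along the segment from `x` to `x + Z x`;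
Cauchy–Schwarz in `t` and Tonelli follow. The hypothesis `hC` says that no intermediate map `x ↦ x +
t Z x` concentrates volume by more than `C`. It is used for constant `Z` on balls and for `Z = b X`
near the inclusion. -/
lemma lintegral_sub_comp_le {v : EuclideanSpace ℝ (Fin d) → ℝ} (hv : ContDiff ℝ 1 v)
    {S S' : Set (EuclideanSpace ℝ (Fin d))} (hS : MeasurableSet S)
    {Z : EuclideanSpace ℝ (Fin d) → EuclideanSpace ℝ (Fin d)}
    (hZm : Measurable Z) {R : ℝ≥0} (hZ : ∀ x ∈ S, ‖Z x‖ ≤ R) {C : ℝ≥0∞}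
    (hC : ∀ t ∈ Icc (0 : ℝ) 1, ∀ h : EuclideanSpace ℝ (Fin d) → ℝ≥0∞, Measurable h →
      ∫⁻ x in S, h (x + t • Z x) ≤ C * ∫⁻ x in S', h x) :
    ∫⁻ x in S, ‖v (x + Z x) - v x‖ₑ ^ 2 ≤ R ^ 2 * (C * ∫⁻ x in S', ‖gradient v x‖ₑ ^ 2) := by
  have hg := continuous_gradient hv
  have hjm : Measurable (fun p : EuclideanSpace ℝ (Fin d) × ℝ =>
      ‖gradient v (p.1 + p.2 • Z p.1)‖ₑ ^ 2) := by
    refine (hg.measurable.comp ?_).enorm.pow_const 2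
    exact measurable_fst.add (measurable_snd.smul (hZm.comp measurable_fst))
  calc ∫⁻ x in S, ‖v (x + Z x) - v x‖ₑ ^ 2
      ≤ ∫⁻ x in S, R ^ 2 * ∫⁻ t in Ioc (0 : ℝ) 1, ‖gradient v (x + t • Z x)‖ₑ ^ 2 := by
        refine setLIntegral_mono' hS fun x hx => ?_
        refine (pow_le_pow_left' (enorm_sub_le_lintegral_gradient hv x (Z x)) 2).trans ?_
        rw [mul_pow]
        gcongr
        · rw [enorm_eq_nnnorm, ENNReal.coe_le_coe]; exact hZ x hx
        · refine (sq_lintegral_le ?_).trans (le_of_eq ?_)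
          · exact (hg.measurable.comp (by fun_prop)).enorm.aemeasurable
          · simp
    _ = R ^ 2 * ∫⁻ t in Ioc (0 : ℝ) 1, ∫⁻ x in S, ‖gradient v (x + t • Z x)‖ₑ ^ 2 := by
        rw [lintegral_const_mul' _ _ (by simp), lintegral_lintegral_swap hjm.aemeasurable]
    _ ≤ R ^ 2 * ∫⁻ t in Ioc (0 : ℝ) 1, C * ∫⁻ x in S', ‖gradient v x‖ₑ ^ 2 := by
        refine mul_le_mul_right ?_ _
        refine setLIntegral_mono' measurableSet_Ioc fun t ht => ?_
        have hta : t ∈ Icc (0 : ℝ) 1 := ⟨ht.1.le, ht.2⟩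
        exact hC t hta (fun y => ‖gradient v y‖ₑ ^ 2) (hg.measurable.enorm.pow_const 2)
    _ = R ^ 2 * (C * ∫⁻ x in S', ‖gradient v x‖ₑ ^ 2) := by simp

/-- Substitute `y = x + z` and integrate over `x` first: for fixed `z` with `‖z‖ < 2r`, convexity
keeps the segment from `x` to `x + z` in the ball. -/
lemma lintegral_ball_lintegral_ball_le {v : EuclideanSpace ℝ (Fin d) → ℝ} (hv : ContDiff ℝ 1 v)
    (c : EuclideanSpace ℝ (Fin d)) (r : ℝ≥0) :
    ∫⁻ x in ball c r, ∫⁻ y in ball c r, ‖v x - v y‖ₑ ^ 2 ≤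
      volume (ball (0 : EuclideanSpace ℝ (Fin d)) (2 * r)) *
        ((2 * r : ℝ≥0) ^ 2 * ∫⁻ x in ball c r, ‖gradient v x‖ₑ ^ 2) := by
  set B : Set (EuclideanSpace ℝ (Fin d)) := ball c r with hB
  have hBm : MeasurableSet B := measurableSet_ball
  have hvm : Measurable v := hv.continuous.measurable
  have hjm : Measurable (fun p : EuclideanSpace ℝ (Fin d) × EuclideanSpace ℝ (Fin d) =>
      B.indicator (1 : EuclideanSpace ℝ (Fin d) → ℝ≥0∞) p.1 *
        (B.indicator 1 (p.1 + p.2) * ‖v (p.1 + p.2) - v p.1‖ₑ ^ 2)) := by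
    have h1 : Measurable (B.indicator (1 : EuclideanSpace ℝ (Fin d) → ℝ≥0∞)) :=
      measurable_one.indicator hBm
    refine (h1.comp measurable_fst).mul ((h1.comp (by fun_prop)).mul ?_)
    exact ((hvm.comp (by fun_prop)).sub (hvm.comp measurable_fst)).enorm.pow_const 2
  have hind : ∀ (h : EuclideanSpace ℝ (Fin d) → ℝ≥0∞), ∫⁻ x in B, h x =
      ∫⁻ x, B.indicator 1 x * h x := by
    intro h
    rw [← lintegral_indicator hBm]
    refine lintegral_congr fun x => ?_
    by_cases hx : x ∈ B <;> simp [hx]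
  calc ∫⁻ x in B, ∫⁻ y in B, ‖v x - v y‖ₑ ^ 2
      = ∫⁻ x, ∫⁻ z, B.indicator 1 x * (B.indicator 1 (x + z) * ‖v (x + z) - v x‖ₑ ^ 2) := by
        rw [hind]
        refine lintegral_congr fun x => ?_
        rw [hind, ← lintegral_add_left_eq_self _ x, lintegral_const_mul']
        · simp_rw [enorm_sub_rev (v x)]
        · by_cases hx : x ∈ B <;> simp [hx]
    _ = ∫⁻ z, ∫⁻ x, B.indicator 1 x * (B.indicator 1 (x + z) * ‖v (x + z) - v x‖ₑ ^ 2) :=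
        lintegral_lintegral_swap hjm.aemeasurable
    _ ≤ ∫⁻ z, (ball (0 : EuclideanSpace ℝ (Fin d)) (2 * r)).indicator 1 z *
        ((2 * r : ℝ≥0) ^ 2 * ∫⁻ x in B, ‖gradient v x‖ₑ ^ 2) := by
        refine lintegral_mono fun z => ?_
        by_cases hz : z ∈ ball (0 : EuclideanSpace ℝ (Fin d)) (2 * r)
        · rw [indicator_of_mem hz, Pi.one_apply, one_mul]
          set S : Set (EuclideanSpace ℝ (Fin d)) := {x | x ∈ B ∧ x + z ∈ B} with hS
          have hSm : MeasurableSet S :=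
            hBm.inter ((measurable_id.add_const z) hBm)
          have h1 := lintegral_sub_comp_le (S' := B) hv hSm (Z := fun _ => z) measurable_const
            (R := 2 * r)
            (fun x _ => by rw [mem_ball_zero_iff] at hz; push_cast; exact hz.le) (C := 1)
            (fun t ht h hh => by
              rw [one_mul, ← lintegral_indicator hSm, ← lintegral_indicator hBm,
                ← lintegral_add_right_eq_self (B.indicator h) (t • z)]
              refine lintegral_mono fun x => ?_
              by_cases hx : x ∈ S
              · have : x + t • z ∈ B := by
                  have := (convex_ball c (r : ℝ)).add_smul_sub_mem hx.1 hx.2 ht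
                  simpa only [add_sub_cancel_left] using this
                rw [indicator_of_mem hx, indicator_of_mem this]
              · rw [indicator_of_notMem hx]; exact zero_le)
          rw [one_mul] at h1
          refine le_trans (le_of_eq ?_) h1
          rw [← lintegral_indicator hSm]
          refine lintegral_congr fun x => ?_
          by_cases hx : x ∈ B <;> by_cases hx' : x + z ∈ B <;> simp [hS, hx, hx']
        · refine le_trans (le_of_eq ?_) zero_le
          refine (lintegral_congr fun x => ?_).trans lintegral_zero
          by_cases hx : x ∈ B
          · have : x + z ∉ B := by
              intro hx'
              apply hz
              rw [mem_ball_zero_iff]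
              rw [hB, mem_ball, dist_eq_norm] at hx hx'
              calc ‖z‖ = ‖(x + z - c) - (x - c)‖ := by congr 1; abel
                _ ≤ ‖x + z - c‖ + ‖x - c‖ := norm_sub_le _ _
                _ < 2 * r := by linarith
            simp [this]
          · simp [hx]
    _ = _ := by
        rw [lintegral_mul_const _ (measurable_one.indicator measurableSet_ball),
          lintegral_indicator_one measurableSet_ball]

/-- Poincaré's inequality on a ball, for smooth functions. -/
lemma exists_poincare_ball (c : EuclideanSpace ℝ (Fin d)) {r : ℝ} (hr : 0 < r) :
    ∃ C : ℝ≥0, ∀ v : EuclideanSpace ℝ (Fin d) → ℝ, ContDiff ℝ 1 v →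
      ∫⁻ x in ball c r, ‖v x‖ₑ ^ 2 ≤
        C * (‖∫ x in ball c r, v x‖ₑ ^ 2 + ∫⁻ x in ball c r, ‖gradient v x‖ₑ ^ 2) := by
  lift r to ℝ≥0 using hr.le
  set B : Set (EuclideanSpace ℝ (Fin d)) := ball c r with hB
  set m := volume B with hm
  have hm0 : m ≠ 0 := (measure_ball_pos volume c hr).ne'
  have hmt : m ≠ ⊤ := measure_ball_lt_top.ne
  set D : ℝ≥0∞ := volume (ball (0 : EuclideanSpace ℝ (Fin d)) (2 * r)) * (2 * r : ℝ≥0) ^ 2 with hD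
  have hDt : D ≠ ⊤ := ENNReal.mul_ne_top measure_ball_lt_top.ne (by finiteness)
  refine ⟨(m⁻¹ * (4 * (1 + D))).toNNReal, fun v hv => ?_⟩
  rw [ENNReal.coe_toNNReal (ENNReal.mul_ne_top (by simpa using hm0) (by finiteness))]
  have hvm : Measurable v := hv.continuous.measurable
  have hint : IntegrableOn v B :=
    (hv.continuous.continuousOn.integrableOn_compact (isCompact_closedBall c r)).mono_set
      ball_subset_closedBall
  -- Write `m v(x)` as `∫ v` plus the integral over `y` of `v(x) - v(y)`, and square.
  have hpt : ∀ x, m ^ 2 * ‖v x‖ₑ ^ 2 ≤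
      4 * (‖∫ y in B, v y‖ₑ ^ 2 + m * ∫⁻ y in B, ‖v x - v y‖ₑ ^ 2) := by
    intro x
    have h1 : ∫ y in B, v x = (∫ y in B, v y) + ∫ y in B, (v x - v y) := by
      have hc : IntegrableOn (fun _ => v x) B := integrableOn_const hmt
      rw [integral_sub hc hint]; ring
    have h2 : m * ‖v x‖ₑ ≤ ‖∫ y in B, v y‖ₑ + ∫⁻ y in B, ‖v x - v y‖ₑ := by
      have : ‖∫ y in B, v x‖ₑ = m * ‖v x‖ₑ := by
        rw [setIntegral_const, enorm_smul, Real.enorm_of_nonneg measureReal_nonneg,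
          Measure.real, ENNReal.ofReal_toReal hmt]
      rw [← this, h1]
      refine (enorm_add_le _ _).trans ?_
      gcongr
      exact enorm_integral_le_lintegral_enorm _
    rw [← mul_pow]
    refine (pow_le_pow_left' h2 2).trans ?_
    refine (enorm_add_sq_le _ _).trans ?_
    gcongr
    refine (sq_lintegral_le (measurable_const.sub hvm).enorm.aemeasurable).trans (le_of_eq ?_)
    rw [Measure.restrict_apply_univ]; rfl
  have h3 : m ^ 2 * ∫⁻ x in B, ‖v x‖ₑ ^ 2 ≤
      m * (4 * (1 + D) * (‖∫ y in B, v y‖ₑ ^ 2 + ∫⁻ x in B, ‖gradient v x‖ₑ ^ 2)) := by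
    rw [← lintegral_const_mul' _ _ (by finiteness)]
    refine (lintegral_mono fun x => hpt x).trans ?_
    rw [lintegral_const_mul' _ _ (by simp), lintegral_add_left measurable_const, setLIntegral_const,
      lintegral_const_mul' _ _ hmt]
    have h4 := lintegral_ball_lintegral_ball_le hv c r
    rw [← hB, ← mul_assoc, ← hD] at h4
    calc 4 * (‖∫ y in B, v y‖ₑ ^ 2 * volume B + m * ∫⁻ x in B, ∫⁻ y in B, ‖v x - v y‖ₑ ^ 2)
        ≤ 4 * (‖∫ y in B, v y‖ₑ ^ 2 * m + m * (D * ∫⁻ x in B, ‖gradient v x‖ₑ ^ 2)) := by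
          gcongr
      -- The added terms serve only to make the sum factor through `1 + D`.
      _ ≤ 4 * (‖∫ y in B, v y‖ₑ ^ 2 * m + m * (D * ∫⁻ x in B, ‖gradient v x‖ₑ ^ 2)) +
          4 * m * (D * ‖∫ y in B, v y‖ₑ ^ 2 + ∫⁻ x in B, ‖gradient v x‖ₑ ^ 2) := le_self_add
      _ = _ := by ring
  have h5 : ∀ z : ℝ≥0∞, z = m⁻¹ * (m⁻¹ * (m ^ 2 * z)) := fun z => by
    rw [sq, mul_assoc, ← mul_assoc m⁻¹ m, ENNReal.inv_mul_cancel hm0 hmt, one_mul, ← mul_assoc,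
      ENNReal.inv_mul_cancel hm0 hmt, one_mul]
  rw [h5 (∫⁻ x in B, ‖v x‖ₑ ^ 2)]
  calc _ ≤ m⁻¹ * (m⁻¹ * (m * (4 * (1 + D) *
        (‖∫ y in B, v y‖ₑ ^ 2 + ∫⁻ x in B, ‖gradient v x‖ₑ ^ 2)))) := by gcongr
    _ = _ := by rw [← mul_assoc m⁻¹ m, ENNReal.inv_mul_cancel hm0 hmt, one_mul]; ring

/-! ### Normals, tubular neighborhoods and the normal field -/

section Geometry

variable {Ω : Set (EuclideanSpace ℝ (Fin d))} {a : ℝ}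

/-- A defining function `ρ` vanishes at `p`, and `ρ (p + t v)` has derivative `⟨∇ρ, v⟩ > 0` at zero,
so its sign is that of `t`. These two properties are all that is used of the normal from here on. -/
lemma IsC3Domain.outerNormal_spec (hΩ : IsC3Domain Ω) {p : EuclideanSpace ℝ (Fin d)}
    (hp : p ∈ frontier Ω) : ‖outerNormal Ω p‖ = 1 ∧
      ∀ v, 0 < inner ℝ (outerNormal Ω p) v → ∀ᶠ t in 𝓝[≠] (0 : ℝ), (p + t • v ∈ Ω ↔ t < 0) := by
  have H := hΩ.2 p hp
  set ρ := H.choose with hρ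
  obtain ⟨hρd, hρ0, hρe⟩ : IsLocalDefiningFunction Ω p ρ := H.choose_spec
  have hn : outerNormal Ω p = ‖gradient ρ p‖⁻¹ • gradient ρ p := by
    rw [outerNormal, dif_pos H]
  have hnorm : 0 < ‖gradient ρ p‖ := norm_pos_iff.2 hρ0
  refine ⟨by rw [hn, norm_smul, norm_inv, norm_norm, inv_mul_cancel₀ hnorm.ne'], fun v hv => ?_⟩
  have hv' : 0 < inner ℝ (gradient ρ p) v := by
    rw [hn, real_inner_smul_left] at hv
    exact pos_of_mul_pos_right hv (inv_pos.2 hnorm).le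
  have hpΩ : p ∉ Ω := by
    rw [hΩ.1.frontier_eq] at hp; exact hp.2
  have h0 : ρ p = 0 := by
    refine le_antisymm ?_ (not_lt.1 fun h => hpΩ (hρe.self_of_nhds.2 h))
    by_contra! hpos
    have h1 := (hρd.continuousAt.eventually (lt_mem_nhds hpos)).and hρe
    obtain ⟨y, hy, hyΩ⟩ := (mem_closure_iff_frequently.1 (frontier_subset_closure hp)).and_eventually
      h1 |>.exists
    exact lt_asymm hyΩ.1 (hyΩ.2.1 hy)
  have hcurve : HasDerivAt (fun t : ℝ => p + t • v) v 0 := by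
    simpa using ((hasDerivAt_id (0 : ℝ)).smul_const v).const_add p
  have hder : HasDerivAt (fun t : ℝ => ρ (p + t • v)) (inner ℝ (gradient ρ p) v) 0 := by
    rw [inner_gradient_left]
    have h2 : HasFDerivAt ρ (fderiv ℝ ρ p) (p + (0 : ℝ) • v) := by
      simpa using (hρd.differentiableAt (by norm_num)).hasFDerivAt
    exact h2.comp_hasDerivAt 0 hcurve
  have hs := (hasDerivAt_iff_tendsto_slope.1 hder).eventually (lt_mem_nhds hv')
  have ht : Tendsto (fun t : ℝ => p + t • v) (𝓝[≠] 0) (𝓝 p) := by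
    have := hcurve.continuousAt.tendsto
    simp only [zero_smul, add_zero] at this
    exact this.mono_left nhdsWithin_le_nhds
  filter_upwards [hs, ht.eventually hρe, self_mem_nhdsWithin] with t ht1 ht2 ht3
  rw [ht2]
  rw [slope_def_field] at ht1
  simp only [zero_smul, add_zero, h0, sub_zero] at ht1
  rcases div_pos_iff.1 ht1 with h | h
  · exact ⟨fun h' => absurd h' h.1.not_gt, fun h' => absurd h' h.2.not_gt⟩
  · exact ⟨fun _ => h.2, fun _ => h.1⟩

/-- A ball is connected, and off the frontier it is covered by the disjoint open sets `interior Ω`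
and `(closure Ω)ᶜ`. -/
lemma ball_subset_of_disjoint_frontier {x : EuclideanSpace ℝ (Fin d)} {r : ℝ}
    (h : Disjoint (ball x r) (frontier Ω)) : (x ∈ Ω → ball x r ⊆ Ω) ∧
      (x ∉ Ω → Disjoint (ball x r) Ω) := by
  by_cases hr : 0 < r
  · have hc : IsPreconnected (ball x r) := (convex_ball x r).isPreconnected
    have hx : x ∈ ball x r := mem_ball_self hr
    have key : ∀ y ∈ ball x r, ∀ z ∈ ball x r, y ∈ Ω → z ∈ Ω := by
      intro y hy z hz hyΩ
      by_contra hzΩ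
      have hcov : ∀ w ∈ ball x r, w ∈ interior Ω ∨ w ∈ (closure Ω)ᶜ := by
        intro w hw
        by_contra! hcon
        exact h.le_bot ⟨hw, not_not.1 hcon.2, hcon.1⟩
      obtain ⟨w, -, hw1, hw2⟩ := hc (interior Ω) (closure Ω)ᶜ isOpen_interior
        isClosed_closure.isOpen_compl hcov
        ⟨y, hy, (hcov y hy).resolve_right fun h' => h' (subset_closure hyΩ)⟩
        ⟨z, hz, (hcov z hz).resolve_left fun h' => hzΩ (interior_subset h')⟩
      exact hw2 (subset_closure (interior_subset hw1))
    exact ⟨fun hxΩ y hy => key x hx y hy hxΩ,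
      fun hxΩ => Set.disjoint_left.2 fun y hy hyΩ => hxΩ (key y hy x hx hyΩ)⟩
  · rw [ball_eq_empty.2 (not_lt.1 hr)]
    exact ⟨fun _ => empty_subset _, fun _ => disjoint_bot_left⟩

/-- Let `e` be the unit vector from `p` to `x`. If `x ∉ Ω` and `n ≠ e`, the direction `e - n` enters
the touching ball, since `⟨e - n, e⟩ > 0`, and also enters `Ω`, since `⟨n, e - n⟩ < 0`; but that
ball misses `Ω`. If `x ∈ Ω` and `-n ≠ e`, the direction `e + n` enters the ball and leaves `Ω`. -/
lemma IsC3Domain.eq_add_smul_outerNormal (hΩ : IsC3Domain Ω) {p x : EuclideanSpace ℝ (Fin d)}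
    (hp : p ∈ frontier Ω) (hxp : 0 < dist x p)
    (h : Disjoint (ball x (dist x p)) (frontier Ω)) :
    (x ∉ Ω → x = p + dist x p • outerNormal Ω p) ∧
      (x ∈ Ω → x = p + (-dist x p) • outerNormal Ω p) := by
  obtain ⟨hn1, hn2⟩ := hΩ.outerNormal_spec hp
  set n := outerNormal Ω p with hn
  set r := dist x p with hr
  set e : EuclideanSpace ℝ (Fin d) := r⁻¹ • (x - p) with he
  have hre : x - p = r • e := by rw [he, smul_smul, mul_inv_cancel₀ hxp.ne', one_smul]
  have he1 : ‖e‖ = 1 := by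
    rw [he, norm_smul, ← dist_eq_norm, ← hr, norm_inv, Real.norm_of_nonneg hxp.le,
      inv_mul_cancel₀ hxp.ne']
  have hee : inner ℝ e e = (1 : ℝ) := by rw [real_inner_self_eq_norm_sq, he1]; norm_num
  have hnn : inner ℝ n n = (1 : ℝ) := by rw [real_inner_self_eq_norm_sq, hn1]; norm_num
  have hlt : ∀ m : EuclideanSpace ℝ (Fin d), ‖m‖ = 1 → m ≠ e → inner ℝ m e < (1 : ℝ) := fun m hm hme => by
    refine lt_of_le_of_ne ?_ ?_
    · simpa [hm, he1] using real_inner_le_norm m e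
    · intro h1
      exact hme ((inner_eq_one_iff_of_norm_eq_one hm he1).1 h1)
  -- moving from `p` in a direction with positive component along `e` enters the ball
  have hball : ∀ v : EuclideanSpace ℝ (Fin d), 0 < inner ℝ v e →
      ∀ᶠ t in 𝓝[>] (0 : ℝ), p + t • v ∈ ball x r := by
    intro v hv
    have hlim : Tendsto (fun t : ℝ => t * ‖v‖ ^ 2) (𝓝[>] 0) (𝓝 0) := by
      have : Continuous fun t : ℝ => t * ‖v‖ ^ 2 := by fun_prop
      have := this.tendsto 0
      rw [zero_mul] at this
      exact this.mono_left nhdsWithin_le_nhds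
    filter_upwards [hlim.eventually (gt_mem_nhds (show 0 < 2 * r * inner ℝ v e by positivity)),
      self_mem_nhdsWithin] with t ht ht0
    have ht0 : 0 < t := ht0
    rw [mem_ball, dist_eq_norm]
    refine lt_of_pow_lt_pow_left₀ 2 hxp.le ?_
    have h1 : p + t • v - x = t • v - r • e := by rw [← hre]; abel
    rw [h1, norm_sub_sq_real, norm_smul, norm_smul, real_inner_smul_left, real_inner_smul_right,
      he1, Real.norm_of_nonneg ht0.le, Real.norm_of_nonneg hxp.le]
    nlinarith
  obtain ⟨hin, hout⟩ := ball_subset_of_disjoint_frontier h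
  constructor
  · intro hx
    suffices n = e by rw [this, ← hre]; abel
    by_contra hne
    have h1 := hlt n hn1 hne
    have h2 : 0 < inner ℝ (e - n) e := by rw [inner_sub_left, hee]; linarith
    have h3 : 0 < inner ℝ n (n - e) := by rw [inner_sub_right, hnn]; linarith
    have h4 := hn2 _ h3
    have h5 : Tendsto (fun t : ℝ => -t) (𝓝[>] 0) (𝓝[≠] 0) := by
      refine tendsto_nhdsWithin_iff.2 ⟨?_, ?_⟩
      · have := (continuous_neg (G := ℝ)).tendsto 0
        rw [neg_zero] at this
        exact this.mono_left nhdsWithin_le_nhds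
      · filter_upwards [self_mem_nhdsWithin] with t ht
        exact neg_ne_zero.2 (ne_of_gt ht)
    obtain ⟨t, ht1, ht2, ht3⟩ := ((h5.eventually h4).and ((hball _ h2).and self_mem_nhdsWithin)).exists
    have ht3 : 0 < t := ht3
    have h6 := ht1.2 (by linarith)
    refine (hout hx).le_bot ⟨ht2, ?_⟩
    convert h6 using 2
    rw [neg_smul, ← smul_neg, neg_sub]
  · intro hx
    suffices -n = e by
      rw [neg_smul, ← smul_neg, this, ← hre]; abel
    by_contra hne
    have h1 := hlt (-n) (by rw [norm_neg, hn1]) hne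
    rw [inner_neg_left] at h1
    have h2 : 0 < inner ℝ (e + n) e := by rw [inner_add_left, hee]; linarith
    have h3 : 0 < inner ℝ n (e + n) := by rw [inner_add_right, hnn]; linarith
    have h4 := hn2 _ h3
    have h5 : Tendsto (fun t : ℝ => t) (𝓝[>] 0) (𝓝[≠] 0) :=
      tendsto_id.mono_left (nhdsWithin_mono _ fun t ht => ne_of_gt ht)
    obtain ⟨t, ht1, ht2, ht3⟩ := ((h5.eventually h4).and ((hball _ h2).and self_mem_nhdsWithin)).exists
    exact lt_asymm (ht1.1 (hin hx ht2)) ht3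

/-- Every point lies on the normal through its nearest boundary point. -/
lemma IsC3Domain.exists_eq_normalMap (hΩ : IsC3Domain Ω) (hne : (frontier Ω).Nonempty)
    (x : EuclideanSpace ℝ (Fin d)) : ∃ p ∈ frontier Ω, ∃ r : ℝ, |r| = infDist x (frontier Ω) ∧
      x = normalMap Ω (p, r) ∧ (r < 0 ↔ x ∈ Ω) := by
  obtain ⟨p, hp, hpd⟩ := isClosed_frontier.exists_infDist_eq_dist hne x
  have hdisj : Disjoint (ball x (dist x p)) (frontier Ω) := by
    rw [← hpd]; exact disjoint_ball_infDist
  rcases (dist_nonneg (x := x) (y := p)).eq_or_lt with h0 | hpos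
  · refine ⟨p, hp, 0, by rw [hpd, ← h0, abs_zero], ?_, ?_⟩
    · rw [eq_comm, dist_eq_zero] at h0
      simp [normalMap, h0]
    · rw [eq_comm, dist_eq_zero] at h0
      rw [hΩ.1.frontier_eq] at hp
      simp [h0, hp.2]
  · obtain ⟨h1, h2⟩ := hΩ.eq_add_smul_outerNormal hp hpos hdisj
    by_cases hx : x ∈ Ω
    · exact ⟨p, hp, -dist x p, by rw [abs_neg, abs_of_pos hpos, hpd], h2 hx, by simp [hx, hpos]⟩
    · exact ⟨p, hp, dist x p, by rw [abs_of_pos hpos, hpd], h1 hx, by simp [hx, hpos.le]⟩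

lemma IsC3Domain.norm_normalMap_sub (hΩ : IsC3Domain Ω) {p : EuclideanSpace ℝ (Fin d)}
    (hp : p ∈ frontier Ω) (r : ℝ) : dist (normalMap Ω (p, r)) p = |r| := by
  simp [normalMap, dist_eq_norm, norm_smul, (hΩ.outerNormal_spec hp).1]

/-- Inside the tubular neighborhood the tubular coordinate is the signed distance. -/
lemma IsTubularRadius.infDist_normalMap (ha : IsTubularRadius Ω a) (hΩ : IsC3Domain Ω)
    {p : EuclideanSpace ℝ (Fin d)} (hp : p ∈ frontier Ω) {r : ℝ} (hr : |r| < a) :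
    infDist (normalMap Ω (p, r)) (frontier Ω) = |r| ∧ (r < 0 ↔ normalMap Ω (p, r) ∈ Ω) := by
  obtain ⟨p', hp', r', hr', heq, hs⟩ := hΩ.exists_eq_normalMap ⟨p, hp⟩ (normalMap Ω (p, r))
  have hle : |r'| ≤ |r| := by
    rw [hr', ← hΩ.norm_normalMap_sub hp r]; exact infDist_le_dist_of_mem hp
  have h1 : (p, r) = (p', r') :=
    ha.2 ⟨hp, abs_lt.1 hr⟩ ⟨hp', abs_lt.1 (hle.trans_lt hr)⟩ heq
  rw [Prod.mk.injEq] at h1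
  rw [← h1.2] at hr' hs
  exact ⟨hr'.symm, hs⟩

lemma normalMap_apply (p : EuclideanSpace ℝ (Fin d)) (r : ℝ) :
    normalMap Ω (p, r) = p + r • outerNormal Ω p := rfl

/-- The balls of radius `s` centered at `p ± s n(p)` contain no boundary point. Expanding `‖p ± s
n(p) - q‖² ≥ s²` gives the two signs: the boundary deviates from its tangent plane at most
quadratically. -/
lemma IsTubularRadius.abs_inner_le (ha : IsTubularRadius Ω a) (hΩ : IsC3Domain Ω)
    {p q : EuclideanSpace ℝ (Fin d)} (hp : p ∈ frontier Ω) (hq : q ∈ frontier Ω) {s : ℝ}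
    (hs : 0 < s) (hsa : s < a) :
    2 * s * |inner ℝ (outerNormal Ω p) (p - q)| ≤ ‖p - q‖ ^ 2 := by
  have hn := (hΩ.outerNormal_spec hp).1
  have key : ∀ t : ℝ, |t| = s → 0 ≤ ‖p - q‖ ^ 2 + 2 * t * inner ℝ (outerNormal Ω p) (p - q) := by
    intro t ht
    have h1 := (ha.infDist_normalMap hΩ hp (ht.trans_lt hsa)).1
    have h2 : |t| ≤ dist (normalMap Ω (p, t)) q := by rw [← h1]; exact infDist_le_dist_of_mem hq
    have h3 : |t| ^ 2 ≤ dist (normalMap Ω (p, t)) q ^ 2 := pow_le_pow_left₀ (abs_nonneg t) h2 2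
    rw [dist_eq_norm, normalMap_apply, add_sub_right_comm, norm_add_sq_real, norm_smul, hn,
      real_inner_smul_right, Real.norm_eq_abs, real_inner_comm] at h3
    linarith
  have h1 := key s (abs_of_pos hs)
  have h2 := key (-s) (by rw [abs_neg, abs_of_pos hs])
  have : |2 * s * inner ℝ (outerNormal Ω p) (p - q)| ≤ ‖p - q‖ ^ 2 := abs_le.2 ⟨by linarith, by linarith⟩
  rwa [abs_mul, abs_of_pos (by positivity : 0 < 2 * s)] at this

/-- The exterior ball of radius `s` at `p` and the interior ball of radius `s` at `q` are disjoint,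
so `‖p - q + s (n(p) + n(q))‖ ≥ 2s`; the same holds with `p` and `q` exchanged. Adding the squares
cancels the mixed terms, and the parallelogram law turns `n(p) + n(q)` into `n(p) - n(q)`. -/
lemma IsTubularRadius.norm_outerNormal_sub_le (ha : IsTubularRadius Ω a) (hΩ : IsC3Domain Ω)
    {p q : EuclideanSpace ℝ (Fin d)} (hp : p ∈ frontier Ω) (hq : q ∈ frontier Ω) {s : ℝ}
    (hs : 0 < s) (hsa : s < a) :
    s * ‖outerNormal Ω p - outerNormal Ω q‖ ≤ ‖p - q‖ := by
  have key : ∀ p' ∈ frontier Ω, ∀ q' ∈ frontier Ω, (2 * s) ^ 2 ≤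
      ‖p' - q' + s • (outerNormal Ω p' + outerNormal Ω q')‖ ^ 2 := by
    intro p' hp' q' hq'
    have hab : |s| = s := abs_of_pos hs
    have hab' : |-s| = s := by rw [abs_neg, hab]
    have h1 := ha.infDist_normalMap hΩ hp' (r := s) (by rwa [hab])
    have h2 := ha.infDist_normalMap hΩ hq' (r := -s) (by rwa [hab'])
    have hd1 : Disjoint (ball (normalMap Ω (p', s)) s) (frontier Ω) := by
      have := disjoint_ball_infDist (x := normalMap Ω (p', s)) (s := frontier Ω)
      rwa [h1.1, hab] at this
    have hd2 : Disjoint (ball (normalMap Ω (q', -s)) s) (frontier Ω) := by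
      have := disjoint_ball_infDist (x := normalMap Ω (q', -s)) (s := frontier Ω)
      rwa [h2.1, hab'] at this
    have h3 := (ball_subset_of_disjoint_frontier hd1).2 fun h => by
      have := h1.2.2 h; linarith
    have h4 := (ball_subset_of_disjoint_frontier hd2).1 (h2.2.1 (by linarith))
    have h5 := (disjoint_ball_ball_iff hs hs).1 (h3.mono_right h4)
    rw [dist_eq_norm, normalMap_apply, normalMap_apply] at h5
    have h6 : p' + s • outerNormal Ω p' - (q' + -s • outerNormal Ω q') =
        p' - q' + s • (outerNormal Ω p' + outerNormal Ω q') := by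
      rw [neg_smul, smul_add]; abel
    rw [h6] at h5
    exact pow_le_pow_left₀ (by positivity) (by linarith) 2
  have h1 := key p hp q hq
  have h2 := key q hq p hp
  rw [← neg_sub p q, add_comm (outerNormal Ω q)] at h2
  set δ := p - q
  set m := outerNormal Ω p
  set n := outerNormal Ω q
  have hm : ‖m‖ = 1 := (hΩ.outerNormal_spec hp).1
  have hn : ‖n‖ = 1 := (hΩ.outerNormal_spec hq).1
  have hpar := parallelogram_law_with_norm ℝ m n
  rw [hm, hn] at hpar
  rw [norm_add_sq_real, norm_smul, Real.norm_of_nonneg hs.le] at h1 h2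
  rw [inner_neg_left, norm_neg] at h2
  refine (pow_le_pow_iff_left₀ (by positivity) (norm_nonneg _) two_ne_zero).1 ?_
  have h3 : s ^ 2 * (‖m + n‖ ^ 2 + ‖m - n‖ ^ 2) = s ^ 2 * 4 := by
    rw [hpar]; norm_num
  linarith

/-- The normal field of `∂Ω`, extended constantly along normals and cut off at distance `a/2`. -/
def normalField (Ω : Set (EuclideanSpace ℝ (Fin d))) (a : ℝ) (x : EuclideanSpace ℝ (Fin d)) :
    EuclideanSpace ℝ (Fin d) :=
  open Classical in
  if H : ∃ q ∈ frontier Ω ×ˢ Ioo (-(a / 2)) (a / 2), normalMap Ω q = x then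
    (1 - 2 * |H.choose.2| / a) • outerNormal Ω H.choose.1
  else 0

lemma IsTubularRadius.normalField_normalMap (ha : IsTubularRadius Ω a)
    {p : EuclideanSpace ℝ (Fin d)} (hp : p ∈ frontier Ω) {r : ℝ} (hr : |r| < a / 2) :
    normalField Ω a (normalMap Ω (p, r)) = (1 - 2 * |r| / a) • outerNormal Ω p := by
  have ha0 := ha.1
  have H : ∃ q ∈ frontier Ω ×ˢ Ioo (-(a / 2)) (a / 2), normalMap Ω q = normalMap Ω (p, r) :=
    ⟨(p, r), ⟨hp, abs_lt.1 hr⟩, rfl⟩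
  have h1 : H.choose = (p, r) := by
    obtain ⟨⟨h2, h3, h4⟩, h5⟩ := H.choose_spec
    refine ha.2 ⟨h2, by linarith, by linarith⟩ ⟨hp, abs_lt.1 (by linarith)⟩ h5
  rw [normalField, dif_pos H, h1]

lemma normalField_eq_zero {x : EuclideanSpace ℝ (Fin d)}
    (h : ∀ p ∈ frontier Ω, ∀ r, |r| < a / 2 → normalMap Ω (p, r) ≠ x) :
    normalField Ω a x = 0 := by
  rw [normalField, dif_neg]
  rintro ⟨⟨p, r⟩, ⟨hp, hr⟩, hq⟩
  exact h p hp r (abs_lt.2 hr) hq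

/-- The constant is `2/a + 4/a`. The taper has slope `2/a`, because `|r|` is the distance to the
boundary and so is 1-Lipschitz. The normal is `4/(3a)`-Lipschitz along the boundary (take `s =
3a/4`), and foot points are at most three times as far apart as the points themselves. If only one
point lies in the inner tube, the taper alone counts. -/
lemma IsTubularRadius.norm_normalField_sub_le (ha : IsTubularRadius Ω a) (hΩ : IsC3Domain Ω)
    (x y : EuclideanSpace ℝ (Fin d)) :
    ‖normalField Ω a x - normalField Ω a y‖ ≤ 6 / a * ‖x - y‖ := by
  have ha0 := ha.1
  have habs : ∀ r : ℝ, |r| < a / 2 → |1 - 2 * |r| / a| ≤ 1 ∧ 0 ≤ 1 - 2 * |r| / a := by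
    intro r hr
    have h1 : 2 * |r| / a ≤ 1 := by rw [div_le_one ha0]; linarith
    have h2 : 0 ≤ 2 * |r| / a := by positivity
    exact ⟨abs_le.2 ⟨by linarith, by linarith⟩, by linarith⟩
  -- one point in the tube, the other one outside
  have mixed : ∀ p ∈ frontier Ω, ∀ r : ℝ, |r| < a / 2 → ∀ y : EuclideanSpace ℝ (Fin d),
      (∀ p ∈ frontier Ω, ∀ r, |r| < a / 2 → normalMap Ω (p, r) ≠ y) →
      ‖normalField Ω a (normalMap Ω (p, r)) - normalField Ω a y‖ ≤
        6 / a * ‖normalMap Ω (p, r) - y‖ := by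
    intro p hp r hr y hy
    rw [normalField_eq_zero hy, sub_zero, ha.normalField_normalMap hp hr, norm_smul,
      (hΩ.outerNormal_spec hp).1, mul_one, Real.norm_of_nonneg (habs r hr).2]
    obtain ⟨p', hp', r', hr', rfl, -⟩ := hΩ.exists_eq_normalMap ⟨p, hp⟩ y
    have h1 : a / 2 ≤ |r'| := by
      by_contra! h; exact hy p' hp' r' h rfl
    have h2 := infDist_le_infDist_add_dist (s := frontier Ω) (x := normalMap Ω (p', r'))
      (y := normalMap Ω (p, r))
    rw [← hr', (ha.infDist_normalMap hΩ hp (r := r) (by linarith)).1, dist_comm, dist_eq_norm] at h2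
    have h3 : a / 2 - |r| ≤ ‖normalMap Ω (p, r) - normalMap Ω (p', r')‖ := by linarith
    calc 1 - 2 * |r| / a = 2 / a * (a / 2 - |r|) := by field_simp
      _ ≤ 2 / a * ‖normalMap Ω (p, r) - normalMap Ω (p', r')‖ := by gcongr
      _ ≤ _ := by gcongr; norm_num
  by_cases hx : ∀ p ∈ frontier Ω, ∀ r, |r| < a / 2 → normalMap Ω (p, r) ≠ x
  · by_cases hy : ∀ p ∈ frontier Ω, ∀ r, |r| < a / 2 → normalMap Ω (p, r) ≠ y
    · rw [normalField_eq_zero hx, normalField_eq_zero hy, sub_zero, norm_zero]; positivity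
    · push Not at hy
      obtain ⟨q, hq, s, hs, rfl⟩ := hy
      rw [norm_sub_rev, norm_sub_rev x]
      exact mixed q hq s hs x hx
  · push Not at hx
    obtain ⟨p, hp, r, hr, rfl⟩ := hx
    by_cases hy : ∀ p ∈ frontier Ω, ∀ r, |r| < a / 2 → normalMap Ω (p, r) ≠ y
    · exact mixed p hp r hr y hy
    push Not at hy
    obtain ⟨q, hq, s, hs, rfl⟩ := hy
    rw [ha.normalField_normalMap hp hr, ha.normalField_normalMap hq hs]
    set D := ‖normalMap Ω (p, r) - normalMap Ω (q, s)‖ with hD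
    have hrs : |(|r| - |s|)| ≤ D := by
      have h1 := infDist_le_infDist_add_dist (s := frontier Ω) (x := normalMap Ω (p, r))
        (y := normalMap Ω (q, s))
      have h2 := infDist_le_infDist_add_dist (s := frontier Ω) (x := normalMap Ω (q, s))
        (y := normalMap Ω (p, r))
      rw [(ha.infDist_normalMap hΩ hp (r := r) (by linarith)).1,
        (ha.infDist_normalMap hΩ hq (r := s) (by linarith)).1] at h1 h2
      rw [dist_comm, dist_eq_norm, ← hD] at h2
      rw [dist_eq_norm, ← hD] at h1
      exact abs_le.2 ⟨by linarith, by linarith⟩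
    -- Pair the difference of the two points with `p - q`. Since `|r|, |s| < a/2`, each normal term
    -- is at most `(a/2) · (2/(3a)) ‖p - q‖²`, a third of `‖p - q‖²`; one third is left.
    have hpq : ‖p - q‖ ≤ 3 * D := by
      have h1 := ha.abs_inner_le hΩ hp hq (s := 3 * a / 4) (by positivity) (by linarith)
      have h2 := ha.abs_inner_le hΩ hq hp (s := 3 * a / 4) (by positivity) (by linarith)
      rw [norm_sub_rev, ← neg_sub p q, inner_neg_right, abs_neg] at h2
      have h3 : inner ℝ (normalMap Ω (p, r) - normalMap Ω (q, s)) (p - q) =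
          ‖p - q‖ ^ 2 + r * inner ℝ (outerNormal Ω p) (p - q) -
            s * inner ℝ (outerNormal Ω q) (p - q) := by
        rw [normalMap_apply, normalMap_apply,
          show p + r • outerNormal Ω p - (q + s • outerNormal Ω q) =
            (p - q) + r • outerNormal Ω p - s • outerNormal Ω q by abel,
          inner_sub_left, inner_add_left, real_inner_smul_left, real_inner_smul_left,
          real_inner_self_eq_norm_sq]
      have h4 := real_inner_le_norm (normalMap Ω (p, r) - normalMap Ω (q, s)) (p - q)
      rw [h3, ← hD] at h4
      have h5 : -(a / 2 * |inner ℝ (outerNormal Ω p) (p - q)|) ≤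
          r * inner ℝ (outerNormal Ω p) (p - q) := by
        rw [neg_le]
        refine (neg_le_abs _).trans ?_
        rw [abs_mul]; gcongr
      have h6 : s * inner ℝ (outerNormal Ω q) (p - q) ≤
          a / 2 * |inner ℝ (outerNormal Ω q) (p - q)| := by
        refine (le_abs_self _).trans ?_
        rw [abs_mul]; gcongr
      have h7 : ‖p - q‖ ^ 2 ≤ 3 * (D * ‖p - q‖) := by linarith
      rcases (norm_nonneg (p - q)).eq_or_lt with h0 | hpos
      · rw [← h0]; positivity
      · nlinarith
    have hn := ha.norm_outerNormal_sub_le hΩ hp hq (s := 3 * a / 4) (by positivity) (by linarith)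
    have hn' : ‖outerNormal Ω p - outerNormal Ω q‖ ≤ 4 / a * D := by
      rw [div_mul_eq_mul_div, le_div_iff₀ ha0]; linarith
    have hsplit : (1 - 2 * |r| / a) • outerNormal Ω p - (1 - 2 * |s| / a) • outerNormal Ω q =
        (-(2 / a) * (|r| - |s|)) • outerNormal Ω p +
          (1 - 2 * |s| / a) • (outerNormal Ω p - outerNormal Ω q) := by
      module
    rw [hsplit]
    refine (norm_add_le _ _).trans ?_
    rw [norm_smul, norm_smul, (hΩ.outerNormal_spec hp).1, Real.norm_eq_abs, Real.norm_eq_abs,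
      abs_mul, abs_neg, abs_of_pos (by positivity : 0 < 2 / a)]
    calc 2 / a * |(|r| - |s|)| * 1 + |1 - 2 * |s| / a| * ‖outerNormal Ω p - outerNormal Ω q‖
        ≤ 2 / a * D * 1 + 1 * (4 / a * D) := by
          gcongr
          exact (habs s hs).1
      _ = 6 / a * D := by ring

lemma IsTubularRadius.norm_normalField_le (ha : IsTubularRadius Ω a) (hΩ : IsC3Domain Ω)
    (x : EuclideanSpace ℝ (Fin d)) : ‖normalField Ω a x‖ ≤ 1 := by
  have ha0 := ha.1
  by_cases hx : ∀ p ∈ frontier Ω, ∀ r, |r| < a / 2 → normalMap Ω (p, r) ≠ x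
  · simp [normalField_eq_zero hx]
  · push Not at hx
    obtain ⟨p, hp, r, hr, rfl⟩ := hx
    rw [ha.normalField_normalMap hp hr, norm_smul, (hΩ.outerNormal_spec hp).1, mul_one,
      Real.norm_eq_abs]
    have h1 : 2 * |r| / a ≤ 1 := by rw [div_le_one ha0]; linarith
    have h2 : 0 ≤ 2 * |r| / a := by positivity
    exact abs_le.2 ⟨by linarith, by linarith⟩

lemma IsTubularRadius.normalMap_mem_shifted_iff (ha : IsTubularRadius Ω a)
    {p : EuclideanSpace ℝ (Fin d)} (hp : p ∈ frontier Ω) {r h : ℝ} (hr : |r| < a) (hh : h ≤ a) :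
    normalMap Ω (p, r) ∈ shifted Ω a h ↔ r < h := by
  constructor
  · rintro (⟨-, h1⟩ | ⟨⟨p', r'⟩, ⟨hp', hr'⟩, heq⟩)
    · exact absurd ⟨(p, r), ⟨hp, abs_lt.1 hr⟩, rfl⟩ h1
    · have := ha.2 (show (p', r') ∈ frontier Ω ×ˢ Ioo (-a) a from ⟨hp', hr'.1, hr'.2.trans_le hh⟩) ⟨hp, abs_lt.1 hr⟩ heq
      rw [Prod.mk.injEq] at this
      rw [← this.2]; exact hr'.2
  · intro h1
    exact Or.inr ⟨(p, r), ⟨hp, (abs_lt.1 hr).1, h1⟩, rfl⟩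

lemma mem_shifted_iff_of_notMem_tubularNhd {x : EuclideanSpace ℝ (Fin d)} {h : ℝ} (hh : h ≤ a)
    (hx : x ∉ tubularNhd Ω a) : x ∈ shifted Ω a h ↔ x ∈ Ω := by
  constructor
  · rintro (h1 | ⟨⟨p', r'⟩, ⟨hp', hr'⟩, heq⟩)
    · exact h1.1
    · exact absurd ⟨(p', r'), ⟨hp', hr'.1, hr'.2.trans_le hh⟩, heq⟩ hx
  · exact fun h1 => Or.inl ⟨h1, hx⟩

/-- The field is parallel to the normal, so only the coordinate `r` changes. It stays in the inner
tube because `|r| + (a/8)(1 - 2|r|/a) = a/8 + 3|r|/4`. -/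
lemma IsTubularRadius.exists_shift_normalMap (ha : IsTubularRadius Ω a)
    {p : EuclideanSpace ℝ (Fin d)} (hp : p ∈ frontier Ω) {r : ℝ} (hr : |r| < a / 2) {h : ℝ}
    (hh : |h| ≤ a / 8) : normalMap Ω (p, r) + h • normalField Ω a (normalMap Ω (p, r)) =
      normalMap Ω (p, r + h * (1 - 2 * |r| / a)) ∧ |r + h * (1 - 2 * |r| / a)| < a / 2 := by
  have ha0 := ha.1
  constructor
  · rw [ha.normalField_normalMap hp hr, normalMap_apply, normalMap_apply, add_smul, smul_smul,
      add_assoc]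
  · have h1 : 2 * |r| / a ≤ 1 := by rw [div_le_one ha0]; linarith
    calc |r + h * (1 - 2 * |r| / a)| ≤ |r| + |h| * (1 - 2 * |r| / a) := by
          refine (abs_add_le _ _).trans ?_
          rw [abs_mul, abs_of_nonneg (by linarith : 0 ≤ 1 - 2 * |r| / a)]
      _ ≤ |r| + a / 8 * (1 - 2 * |r| / a) := by gcongr
      _ = a / 8 + 3 / 4 * |r| := by field_simp; ring
      _ < a / 2 := by linarith

/-- In the inner tube, `r + h (1 - 2|r|/a) < h` means `r < (2h/a) |r|`, which the sign of `r`
decides because `|2h/a| ≤ 1/4`. Elsewhere the field vanishes, and in the outer tube `|r| ≥ a/2 >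
|h|`, so `r < h` and `r < 0` agree. -/
lemma IsTubularRadius.shift_mem_shifted_iff (ha : IsTubularRadius Ω a) (hΩ : IsC3Domain Ω)
    {h : ℝ} (hh : |h| ≤ a / 8) (x : EuclideanSpace ℝ (Fin d)) :
    x + h • normalField Ω a x ∈ shifted Ω a h ↔ x ∈ Ω := by
  have ha0 := ha.1
  have hha : h ≤ a := (le_abs_self h).trans (by linarith)
  by_cases hx : ∀ p ∈ frontier Ω, ∀ r, |r| < a / 2 → normalMap Ω (p, r) ≠ x
  · rw [normalField_eq_zero hx, smul_zero, add_zero]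
    by_cases hxU : x ∈ tubularNhd Ω a
    · obtain ⟨⟨p, r⟩, ⟨hp, hr⟩, rfl⟩ := hxU
      have hra : a / 2 ≤ |r| := by
        by_contra! hlt; exact hx p hp r hlt rfl
      rw [ha.normalMap_mem_shifted_iff hp (abs_lt.2 hr) hha,
        ← (ha.infDist_normalMap hΩ hp (abs_lt.2 hr)).2]
      have h1 := abs_le.1 hh
      rcases abs_cases r with h2 | h2
      · constructor <;> intro h3 <;> linarith
      · constructor <;> intro h3 <;> linarith
    · exact mem_shifted_iff_of_notMem_tubularNhd hha hxU
  · push Not at hx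
    obtain ⟨p, hp, r, hr, rfl⟩ := hx
    obtain ⟨h1, h2⟩ := ha.exists_shift_normalMap hp hr hh
    rw [h1, ha.normalMap_mem_shifted_iff hp (by linarith) hha,
      ← (ha.infDist_normalMap hΩ hp (r := r) (by linarith)).2]
    have h4 : |2 * h / a| ≤ 1 / 4 := by
      rw [abs_div, abs_mul, abs_of_pos ha0, div_le_iff₀ ha0]
      norm_num; linarith
    have h5 : r + h * (1 - 2 * |r| / a) = h + (r - 2 * h / a * |r|) := by ring
    rw [h5]
    have h6 := abs_le.1 h4
    rcases abs_cases r with h7 | h7 <;> rw [h7.1]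
    · constructor <;> intro h3 <;> nlinarith
    · constructor <;> intro h3 <;> nlinarith

/-- Moving outward does not decrease `r`. This keeps the paths `x + s X(x)` of the Poincaré argument
outside the inclusion. -/
lemma IsTubularRadius.shift_notMem_shifted (ha : IsTubularRadius Ω a)
    {s t : ℝ} (hs : 0 ≤ s) (hs' : s ≤ a / 8) (ht : t ≤ a) {x : EuclideanSpace ℝ (Fin d)}
    (hx : x ∉ shifted Ω a t) : x + s • normalField Ω a x ∉ shifted Ω a t := by
  have ha0 := ha.1
  by_cases hx' : ∀ p ∈ frontier Ω, ∀ r, |r| < a / 2 → normalMap Ω (p, r) ≠ x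
  · rwa [normalField_eq_zero hx', smul_zero, add_zero]
  · push Not at hx'
    obtain ⟨p, hp, r, hr, rfl⟩ := hx'
    obtain ⟨h1, h2⟩ := ha.exists_shift_normalMap hp hr (h := s) (by rwa [abs_of_nonneg hs])
    rw [h1, ha.normalMap_mem_shifted_iff hp (by linarith) ht]
    rw [ha.normalMap_mem_shifted_iff hp (by linarith) ht] at hx
    have h3 : 2 * |r| / a ≤ 1 := by rw [div_le_one ha0]; linarith
    have : 0 ≤ s * (1 - 2 * |r| / a) := mul_nonneg hs (by linarith)
    linarith

lemma IsTubularRadius.closure_subset_shifted (ha : IsTubularRadius Ω a) (hΩ : IsC3Domain Ω)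
    {t : ℝ} (ht : 0 < t) (hta : t ≤ a) : closure Ω ⊆ shifted Ω a t := by
  intro x hx
  rw [closure_eq_self_union_frontier] at hx
  by_cases hxU : x ∈ tubularNhd Ω a
  · obtain ⟨⟨p, r⟩, ⟨hp, hr⟩, rfl⟩ := hxU
    rw [ha.normalMap_mem_shifted_iff hp (abs_lt.2 hr) hta]
    have h1 := ha.infDist_normalMap hΩ hp (abs_lt.2 hr)
    rcases hx with hx | hx
    · exact (h1.2.2 hx).trans ht
    · rw [infDist_zero_of_mem hx, eq_comm, abs_eq_zero] at h1
      rwa [h1.1]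
  · rw [mem_shifted_iff_of_notMem_tubularNhd hta hxU]
    refine hx.resolve_right fun h => hxU ⟨(x, 0), ⟨h, ?_⟩, by simp [normalMap]⟩
    exact ⟨by linarith [ha.1], ha.1⟩

lemma IsTubularRadius.exists_notMem_shifted (ha : IsTubularRadius Ω a) (hΩ : IsC3Domain Ω)
    {x : EuclideanSpace ℝ (Fin d)} (hx : x ∉ closure Ω) :
    ∃ t > 0, ∀ s ≤ t, x ∉ shifted Ω a s := by
  have ha0 := ha.1
  have hxΩ : x ∉ Ω := fun h => hx (subset_closure h)
  by_cases hxU : x ∈ tubularNhd Ω a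
  · obtain ⟨⟨p, r⟩, ⟨hp, hr⟩, rfl⟩ := hxU
    have h1 := (ha.infDist_normalMap hΩ hp (abs_lt.2 hr)).2
    have hr0 : 0 < r := by
      rcases lt_trichotomy r 0 with h2 | h2 | h2
      · exact absurd (h1.1 h2) hxΩ
      · subst h2
        exact absurd (frontier_subset_closure (by simpa [normalMap] using hp)) hx
      · exact h2
    refine ⟨r, hr0, fun s hs => ?_⟩
    rw [ha.normalMap_mem_shifted_iff hp (abs_lt.2 hr) (hs.trans hr.2.le)]
    exact hs.not_gt
  · exact ⟨a, ha0, fun s hs => by rwa [mem_shifted_iff_of_notMem_tubularNhd hs hxU]⟩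

end Geometry

/-! ### Lattice cells and periodic extension -/

/-- The integer vector `k` with `x ∈ k + [0,1)^d`. -/
def cellIndex (x : EuclideanSpace ℝ (Fin d)) : Fin d → ℤ := fun i => ⌊x i⌋

/-- The representative in `[0,1)^d` of a point modulo the lattice. -/
def cellRep (x : EuclideanSpace ℝ (Fin d)) : EuclideanSpace ℝ (Fin d) :=
  x - latticePoint (cellIndex x)

@[simp] lemma latticePoint_apply (k : Fin d → ℤ) (i : Fin d) :
    latticePoint k i = (k i : ℝ) := rfl

@[simp] lemma cellRep_apply (x : EuclideanSpace ℝ (Fin d)) (i : Fin d) :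
    cellRep x i = Int.fract (x i) := rfl

lemma latticePoint_zero : latticePoint (0 : Fin d → ℤ) = 0 := by
  ext i; simp

lemma latticePoint_neg (k : Fin d → ℤ) : latticePoint (-k) = -latticePoint k := by
  ext i; simp

lemma cellRep_add_latticePoint (x : EuclideanSpace ℝ (Fin d)) (k : Fin d → ℤ) :
    cellRep (x + latticePoint k) = cellRep x := by
  ext i; simp

lemma cellRep_add_cellIndex (x : EuclideanSpace ℝ (Fin d)) :
    cellRep x + latticePoint (cellIndex x) = x := by
  rw [cellRep]; abel

lemma cellIndex_eq_of_sub_mem {x : EuclideanSpace ℝ (Fin d)} {k : Fin d → ℤ}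
    (h : x - latticePoint k ∈ unitCell d) : cellIndex x = k := by
  funext i
  have := h i
  simp only [PiLp.sub_apply, latticePoint_apply, mem_Ioo] at this
  exact Int.floor_eq_iff.2 ⟨by linarith, by linarith⟩

lemma cellRep_eq_self {x : EuclideanSpace ℝ (Fin d)} (h : x ∈ unitCell d) : cellRep x = x := by
  have : cellIndex x = 0 := cellIndex_eq_of_sub_mem (by simpa [latticePoint_zero] using h)
  rw [cellRep, this, latticePoint_zero, sub_zero]

lemma isOpen_unitCell : IsOpen (unitCell d) := by
  have : unitCell d = ⋂ i : Fin d, (fun y : EuclideanSpace ℝ (Fin d) => y i) ⁻¹' Ioo 0 1 := by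
    ext; simp [unitCell]
  rw [this]
  exact isOpen_iInter_of_finite fun i => isOpen_Ioo.preimage (by fun_prop)

/-- The closed unit cell. -/
def closedCell (d : ℕ) : Set (EuclideanSpace ℝ (Fin d)) :=
  {y | ∀ i, y i ∈ Icc (0 : ℝ) 1}

lemma unitCell_subset_closedCell : unitCell d ⊆ closedCell d :=
  fun _ hx i => Ioo_subset_Icc_self (hx i)

lemma isCompact_closedCell : IsCompact (closedCell d) := by
  have h : IsCompact ((EuclideanSpace.equiv (Fin d) ℝ).symm ''
      (Set.pi univ fun _ : Fin d => Icc (0 : ℝ) 1)) :=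
    (isCompact_univ_pi fun _ => isCompact_Icc).image (EuclideanSpace.equiv (Fin d) ℝ).symm.continuous
  convert h using 1
  ext x
  constructor
  · intro hx
    exact ⟨EuclideanSpace.equiv (Fin d) ℝ x, fun i _ => hx i, by simp⟩
  · rintro ⟨y, hy, rfl⟩ i
    exact hy i (mem_univ i)

lemma eq_zero_of_add_mem_unitCell {x : EuclideanSpace ℝ (Fin d)} (hx : x ∈ closedCell d)
    {k : Fin d → ℤ} (h : x + latticePoint k ∈ unitCell d) : k = 0 := by
  funext i
  have h1 := h i
  have h2 := hx i
  simp only [PiLp.add_apply, latticePoint_apply, mem_Ioo, mem_Icc] at h1 h2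
  have h3 : (-1 : ℝ) < k i := by linarith
  have h4 : (k i : ℝ) < 1 := by linarith
  have h5 : -1 < k i := by exact_mod_cast h3
  have h6 : k i < 1 := by exact_mod_cast h4
  simp only [Pi.zero_apply]
  omega

/-- The periodic extension of a Lipschitz field vanishing outside the unit cell is Lipschitz. -/
lemma lipschitzWith_comp_cellRep {X : EuclideanSpace ℝ (Fin d) → EuclideanSpace ℝ (Fin d)}
    {L : ℝ≥0} (hX : LipschitzWith L X) (h0 : ∀ x ∉ unitCell d, X x = 0)
    (hne : (unitCell d)ᶜ.Nonempty) : LipschitzWith L (fun x => X (cellRep x)) := by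
  set δ : EuclideanSpace ℝ (Fin d) → ℝ := fun x => infDist (cellRep x) (unitCell d)ᶜ with hδ
  -- Compare with the nearest point outside the open cell, where `X` vanishes.
  have hXδ : ∀ x, ‖X (cellRep x)‖ ≤ L * δ x := by
    intro x
    obtain ⟨z, hz, hzd⟩ := (isOpen_unitCell (d := d)).isClosed_compl.exists_infDist_eq_dist hne
      (cellRep x)
    have := hX.dist_le_mul (cellRep x) z
    rw [h0 z hz, dist_zero_right, ← hzd] at this
    exact this
  have hball : ∀ x, ball x (δ x) ⊆ {z | z - latticePoint (cellIndex x) ∈ unitCell d} := by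
    intro x z hz
    by_contra hcon
    have h1 := infDist_le_dist_of_mem (x := cellRep x) (show z - latticePoint (cellIndex x) ∈ (unitCell d)ᶜ from hcon)
    rw [cellRep, dist_sub_right, dist_comm] at h1
    exact absurd (mem_ball.1 hz) (not_lt.2 h1)
  have hside : ∀ x y, cellIndex x ≠ cellIndex y → δ x = 0 → δ x + δ y ≤ dist x y := by
    intro x y hxy hx
    rw [hx, zero_add]
    have h1 : x - latticePoint (cellIndex y) ∈ (unitCell d)ᶜ := fun h =>
      hxy (cellIndex_eq_of_sub_mem h)
    have := infDist_le_dist_of_mem (x := cellRep y) h1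
    rwa [cellRep, dist_sub_right, dist_comm] at this
  -- The balls of radii `δ x` and `δ y` lie in different open cells and are therefore disjoint. A
  -- zero radius gives an empty ball and is treated by `hside`.
  have hsum : ∀ x y, cellIndex x ≠ cellIndex y → δ x + δ y ≤ dist x y := by
    intro x y hxy
    rcases (infDist_nonneg : 0 ≤ δ x).eq_or_lt with hx | hx
    · exact hside x y hxy hx.symm
    rcases (infDist_nonneg : 0 ≤ δ y).eq_or_lt with hy | hy
    · rw [add_comm, dist_comm]; exact hside y x hxy.symm hy.symm
    refine (disjoint_ball_ball_iff hx hy).1 (Set.disjoint_left.2 fun z hz hz' => hxy ?_)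
    rw [← cellIndex_eq_of_sub_mem (hball x hz), cellIndex_eq_of_sub_mem (hball y hz')]
  refine LipschitzWith.of_dist_le_mul fun x y => ?_
  by_cases hxy : cellIndex x = cellIndex y
  · have := hX.dist_le_mul (cellRep x) (cellRep y)
    simp only [cellRep, hxy, dist_sub_right] at this ⊢
    exact this
  · calc dist (X (cellRep x)) (X (cellRep y)) ≤ ‖X (cellRep x)‖ + ‖X (cellRep y)‖ := dist_le_norm_add_norm _ _
      _ ≤ L * δ x + L * δ y := add_le_add (hXδ x) (hXδ y)
      _ = L * (δ x + δ y) := by ring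
      _ ≤ L * dist x y := by gcongr; exact hsum x y hxy

/-- What is used of the geometry: a periodic Lipschitz field `X` such that the maps `id + h X`
deform the reference inclusion `P 0` into `P h` for `|h| ≤ b`. -/
structure DeformationField (P : ℝ → Set (EuclideanSpace ℝ (Fin d))) (b : ℝ)
    (X : EuclideanSpace ℝ (Fin d) → EuclideanSpace ℝ (Fin d)) (L : ℝ≥0) : Prop where
  pos : 0 < b
  lipschitz : LipschitzWith L X
  small : b * L ≤ 3 / 4
  periodic : IsCellPeriodic X
  bounded : ∀ x, ‖X x‖ ≤ 1
  mem_cell_iff : ∀ h, |h| ≤ b → ∀ x, x + h • X x ∈ unitCell d ↔ x ∈ unitCell d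
  mem_iff : ∀ h, |h| ≤ b → ∀ x, x + h • X x ∈ P h ↔ x ∈ P 0
  mem_closedCell : ∀ h, |h| ≤ b → ∀ x ∈ closedCell d, x + h • X x ∈ closedCell d
  notMem : ∀ s, 0 ≤ s → s ≤ b → ∀ t, |t| ≤ b → ∀ x, x ∉ P t → x + s • X x ∉ P t
  isOpen_zero : IsOpen (P 0)
  subset_cell : ∀ t, |t| ≤ b → P t ⊆ unitCell d
  closure_zero_subset_cell : closure (P 0) ⊆ unitCell d
  closure_zero_subset : ∀ t, 0 < t → t ≤ b → closure (P 0) ⊆ P t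
  exists_notMem : ∀ x ∉ closure (P 0), ∃ t > 0, ∀ s ≤ t, x ∉ P s
  disjoint_image : ∀ s t, |s| ≤ b → |t| ≤ b → s ≠ t →
    Disjoint ((fun x => x + s • X x) '' frontier (P 0)) ((fun x => x + t • X x) '' frontier (P 0))

/-- All properties are read off from the tubular coordinate. Periodization is harmless because the
field lives in a tube contained in the open cell, and the images of the boundary are disjoint
because they are parallel surfaces at different heights. -/
theorem IsTubularRadius.deformationField {Ω : Set (EuclideanSpace ℝ (Fin d))} {a : ℝ}
    (ha : IsTubularRadius Ω a) (hΩ : IsC3Domain Ω) (hd : 0 < d) (hcl : closure Ω ⊆ unitCell d)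
    (hU : tubularNhd Ω a ⊆ unitCell d) :
    DeformationField (shifted Ω a) (a / 8) (fun x => normalField Ω a (cellRep x))
      (6 / a).toNNReal := by
  have ha0 := ha.1
  set N := normalField Ω a with hN
  have hcoe : (((6 / a).toNNReal : ℝ≥0) : ℝ) = 6 / a := Real.coe_toNNReal _ (by positivity)
  have hlip : LipschitzWith (6 / a).toNNReal N := by
    refine LipschitzWith.of_dist_le_mul fun x y => ?_
    rw [hcoe, dist_eq_norm, dist_eq_norm]
    exact ha.norm_normalField_sub_le hΩ x y
  have h0 : ∀ x ∉ unitCell d, N x = 0 := by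
    intro x hx
    refine normalField_eq_zero fun p hp r hr heq => hx (hU ⟨(p, r), ⟨hp, abs_lt.1 ?_⟩, heq⟩)
    linarith
  have hne : (unitCell d)ᶜ.Nonempty :=
    ⟨0, fun h => by simpa using (h ⟨0, hd⟩)⟩
  have hzero : ∀ (h : ℝ) x, cellRep x ∉ unitCell d → x + h • N (cellRep x) = x := by
    intro h x hx; rw [h0 _ hx, smul_zero, add_zero]
  -- the deformation preserves the cell
  have hcell : ∀ h, |h| ≤ a / 8 → ∀ x ∈ unitCell d, x + h • N x ∈ unitCell d := by
    intro h hh x hx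
    by_cases hx' : ∀ p ∈ frontier Ω, ∀ r, |r| < a / 2 → normalMap Ω (p, r) ≠ x
    · rwa [hN, normalField_eq_zero hx', smul_zero, add_zero]
    · push Not at hx'
      obtain ⟨p, hp, r, hr, rfl⟩ := hx'
      obtain ⟨h1, h2⟩ := ha.exists_shift_normalMap hp hr hh
      rw [hN, h1]
      exact hU ⟨_, ⟨hp, abs_lt.1 (by linarith)⟩, rfl⟩
  have hcellrep : ∀ h, |h| ≤ a / 8 → ∀ x, x + h • N (cellRep x) ∈ unitCell d ↔ x ∈ unitCell d := by
    intro h hh x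
    constructor
    · intro hx
      by_cases hr : cellRep x ∈ unitCell d
      · have h1 := hcell h hh _ hr
        have h2 : x + h • N (cellRep x) - latticePoint (cellIndex x) ∈ unitCell d := by
          rw [add_sub_right_comm]; exact h1
        have h3 : cellIndex (x + h • N (cellRep x)) = 0 :=
          cellIndex_eq_of_sub_mem (by simpa [latticePoint_zero] using hx)
        have h4 := cellIndex_eq_of_sub_mem h2
        rw [h3] at h4
        rwa [cellRep, ← h4, latticePoint_zero, sub_zero] at hr
      · rwa [hzero h x hr] at hx
    · intro hx
      rw [cellRep_eq_self hx]
      exact hcell h hh x hx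
  have hsub : ∀ t, |t| ≤ a / 8 → shifted Ω a t ⊆ unitCell d := by
    rintro t ht x (hx | ⟨⟨p, r⟩, ⟨hp, hr⟩, rfl⟩)
    · exact hcl (subset_closure hx.1)
    · exact hU ⟨(p, r), ⟨hp, hr.1, hr.2.trans_le ((le_abs_self t).trans (by linarith))⟩, rfl⟩
  have hzeroΩ : shifted Ω a 0 = Ω := by
    ext x
    have := ha.shift_mem_shifted_iff hΩ (h := 0) (by rw [abs_zero]; positivity) x
    rwa [zero_smul, add_zero] at this
  constructor
  · positivity
  · exact lipschitzWith_comp_cellRep hlip h0 hne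
  -- The bound is attained: `(a/8) · (6/a) = 3/4`.
  · rw [hcoe]; apply le_of_eq; field_simp; norm_num
  · intro k x; simp only [cellRep_add_latticePoint]
  · exact fun x => ha.norm_normalField_le hΩ _
  · exact hcellrep
  · intro h hh x
    rw [hzeroΩ]
    by_cases hx : x ∈ unitCell d
    · rw [cellRep_eq_self hx]; exact ha.shift_mem_shifted_iff hΩ hh x
    · exact ⟨fun h1 => absurd ((hcellrep h hh x).1 (hsub h hh h1)) hx,
        fun h1 => absurd (hcl (subset_closure h1)) hx⟩
  · intro h hh x hx
    by_cases hx' : x ∈ unitCell d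
    · exact unitCell_subset_closedCell ((hcellrep h hh x).2 hx')
    · rw [hzero h x]
      · exact hx
      · intro hr
        refine hx' ?_
        have h1 : x + latticePoint (-cellIndex x) ∈ unitCell d := by
          rwa [latticePoint_neg, ← sub_eq_add_neg]
        have h2 := eq_zero_of_add_mem_unitCell hx h1
        rwa [h2, latticePoint_zero, add_zero] at h1
  · intro s hs hsb t ht x hx
    by_cases hx' : x ∈ unitCell d
    · rw [cellRep_eq_self hx']
      exact ha.shift_notMem_shifted hs hsb ((le_abs_self t).trans (by linarith)) hx
    · exact fun h1 => hx' ((hcellrep s (by rwa [abs_of_nonneg hs]) x).1 (hsub t ht h1))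
  · rw [hzeroΩ]; exact hΩ.1
  · exact hsub
  · rw [hzeroΩ]; exact hcl
  · intro t ht htb
    rw [hzeroΩ]
    exact ha.closure_subset_shifted hΩ ht (by linarith)
  · intro x hx
    rw [hzeroΩ] at hx
    exact ha.exists_notMem_shifted hΩ hx
  · intro s t hs ht hst
    rw [hzeroΩ, Set.disjoint_left]
    have key : ∀ s, |s| ≤ a / 8 → ∀ x ∈ frontier Ω, x + s • N (cellRep x) = normalMap Ω (x, s) := by
      intro s hs x hx
      have h1 := ha.normalField_normalMap hx (r := 0) (by rw [abs_zero]; positivity)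
      rw [cellRep_eq_self (hcl (frontier_subset_closure hx)), normalMap_apply]
      rw [normalMap_apply] at h1
      simp only [zero_smul, add_zero, abs_zero, mul_zero, zero_div, sub_zero, one_smul] at h1
      rw [hN, h1]
    rintro z ⟨x, hx, rfl⟩ ⟨y, hy, hxy⟩
    dsimp only at hxy
    rw [key t ht y hy, key s hs x hx] at hxy
    have := ha.2 ⟨hy, abs_lt.1 (ht.trans_lt (by linarith))⟩ ⟨hx, abs_lt.1 (hs.trans_lt (by linarith))⟩ hxy
    rw [Prod.mk.injEq] at this
    exact hst this.2.symm

/-! Lattice translations and measures. -/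

lemma volume_coord_eq (i : Fin d) (c : ℝ) :
    volume {x : EuclideanSpace ℝ (Fin d) | x i = c} = 0 := by
  have h := (PiLp.volume_preserving_ofLp (Fin d)).measure_preimage
    (s := {x : Fin d → ℝ | x i = c})
    (measurableSet_eq_fun (measurable_pi_apply i) measurable_const).nullMeasurableSet
  have h2 : volume {x : Fin d → ℝ | x i = c} = 0 :=
    Measure.pi_hyperplane (fun _ => (volume : Measure ℝ)) i c
  rw [h2] at h
  exact h

lemma ae_cellRep_mem_unitCell :
    ∀ᵐ x : EuclideanSpace ℝ (Fin d), cellRep x ∈ unitCell d := by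
  have h : ∀ᵐ x : EuclideanSpace ℝ (Fin d), ∀ i : Fin d, ∀ n : ℤ, x i ≠ n := by
    rw [ae_all_iff]; intro i
    rw [ae_all_iff]; intro n
    rw [ae_iff]
    simpa using volume_coord_eq i (n : ℝ)
  filter_upwards [h] with x hx i
  rw [cellRep_apply]
  refine ⟨lt_of_le_of_ne (Int.fract_nonneg _) fun h0 => hx i ⌊x i⌋ ?_, Int.fract_lt_one _⟩
  have := Int.self_sub_floor (x i)
  linarith

lemma finite_setOf_add_mem_closedCell {S : Set (EuclideanSpace ℝ (Fin d))}
    (hS : Bornology.IsBounded S) :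
    {k : Fin d → ℤ | ∃ y ∈ S, y + latticePoint k ∈ closedCell d}.Finite := by
  obtain ⟨R, hR⟩ := hS.exists_norm_le
  refine (Set.finite_Icc (fun _ : Fin d => -⌈R⌉ - 1) (fun _ => ⌈R⌉ + 1)).subset ?_
  rintro k ⟨y, hy, hk⟩
  have hb : ∀ i, |y i| ≤ R := fun i => (PiLp.norm_apply_le y i).trans (hR y hy)
  have hc := Int.le_ceil R
  constructor <;> intro i
  · have h1 := (hk i).1
    have h2 := abs_le.1 (hb i)
    simp only [PiLp.add_apply, latticePoint_apply] at h1
    have h3 : ((-⌈R⌉ - 1 : ℤ) : ℝ) ≤ k i := by push_cast; linarith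
    exact_mod_cast h3
  · have h1 := (hk i).2
    have h2 := abs_le.1 (hb i)
    simp only [PiLp.add_apply, latticePoint_apply] at h1
    have h3 : (k i : ℝ) ≤ ((⌈R⌉ + 1 : ℤ) : ℝ) := by push_cast; linarith
    exact_mod_cast h3

/-- A bounded set meets only finitely many translates of the closed cell, so the removed closed sets
form a locally finite family. -/
lemma isOpen_perforatedSpace {P : Set (EuclideanSpace ℝ (Fin d))} (hP : P ⊆ unitCell d) :
    IsOpen (perforatedSpace P) := by
  have h : perforatedSpace P = (⋃ k : Fin d → ℤ, (fun y => y + latticePoint k) ⁻¹' closure P)ᶜ := by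
    ext y; simp [perforatedSpace]
  have hcl : closure P ⊆ closedCell d :=
    closure_minimal (hP.trans unitCell_subset_closedCell) isCompact_closedCell.isClosed
  rw [h, isOpen_compl_iff]
  refine LocallyFinite.isClosed_iUnion (fun x => ⟨ball x 1, ball_mem_nhds x one_pos, ?_⟩)
    fun k => isClosed_closure.preimage (by fun_prop)
  refine (finite_setOf_add_mem_closedCell (isBounded_ball (x := x) (r := 1))).subset ?_
  rintro k ⟨y, hy, hyb⟩
  exact ⟨y, hyb, hcl hy⟩

/-- Almost every point of `S` has its representative in the open cell outside `P`, and boundedness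
leaves finitely many lattice vectors. Square integrability and null sets thereby pass from one cell
to bounded parts of the perforated space. -/
lemma exists_restrict_le_sum {P S : Set (EuclideanSpace ℝ (Fin d))}
    (hS : Bornology.IsBounded S) (hSP : S ⊆ perforatedSpace P) :
    ∃ T : Finset (Fin d → ℤ), volume.restrict S ≤
      ∑ k ∈ T, (volume.restrict (unitCell d \ P)).map (fun x => x + latticePoint k) := by
  have hfin := (finite_setOf_add_mem_closedCell hS).image (fun k => -k)
  refine ⟨hfin.toFinset, Measure.le_iff.2 fun A hA => ?_⟩
  rw [Measure.restrict_apply hA, Measure.finsetSum_apply]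
  have hmeas : ∀ k : Fin d → ℤ, Measurable (fun x : EuclideanSpace ℝ (Fin d) => x + latticePoint k) :=
    fun k => by fun_prop
  simp_rw [fun k => Measure.map_apply (μ := volume.restrict (unitCell d \ P)) (hmeas k) hA,
    fun k => Measure.restrict_apply (μ := volume) (s := unitCell d \ P) (hmeas k hA)]
  have hcov : (A ∩ S : Set (EuclideanSpace ℝ (Fin d))) ≤ᵐ[volume] ⋃ k ∈ hfin.toFinset,
      (fun x => x + latticePoint (-k)) ⁻¹'
        ((fun x => x + latticePoint k) ⁻¹' A ∩ (unitCell d \ P)) := by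
    filter_upwards [ae_cellRep_mem_unitCell (d := d)] with x hx hxA
    change x ∈ A ∩ S at hxA
    change x ∈ ⋃ k ∈ hfin.toFinset, _
    have hrep : x + latticePoint (-cellIndex x) = cellRep x := by
      rw [latticePoint_neg, ← sub_eq_add_neg]; rfl
    simp only [mem_iUnion]
    refine ⟨cellIndex x, ?_, ?_⟩
    · rw [Set.Finite.mem_toFinset]
      exact ⟨-cellIndex x, ⟨x, hxA.2, by rw [hrep]; exact unitCell_subset_closedCell hx⟩, neg_neg _⟩
    · simp only [mem_preimage, hrep]
      refine ⟨by rw [mem_preimage, cellRep_add_cellIndex]; exact hxA.1, hx, fun hP => ?_⟩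
      exact hSP hxA.2 (-cellIndex x) (by rw [hrep]; exact subset_closure hP)
  refine (measure_mono_ae hcov).trans ((measure_biUnion_finset_le _ _).trans ?_)
  refine Finset.sum_le_sum fun k _ => ?_
  rw [measure_preimage_add_right]

lemma exists_lintegral_le_of_periodic {P S : Set (EuclideanSpace ℝ (Fin d))}
    (hS : Bornology.IsBounded S) (hSP : S ⊆ perforatedSpace P) :
    ∃ N : ℝ≥0, ∀ h : EuclideanSpace ℝ (Fin d) → ℝ≥0∞, IsCellPeriodic h →
      ∫⁻ x in S, h x ≤ N * ∫⁻ x in unitCell d \ P, h x := by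
  obtain ⟨T, hT⟩ := exists_restrict_le_sum hS hSP
  refine ⟨T.card, fun h hh => (lintegral_mono' hT le_rfl).trans (le_of_eq ?_)⟩
  rw [lintegral_finsetSum_measure]
  have : ∀ k ∈ T, ∫⁻ x, h x ∂(volume.restrict (unitCell d \ P)).map (fun x => x + latticePoint k) =
      ∫⁻ x in unitCell d \ P, h x := by
    intro k _
    have := (Homeomorph.addRight (latticePoint k)).toMeasurableEquiv
    rw [show (fun x : EuclideanSpace ℝ (Fin d) => x + latticePoint k) =
      (Homeomorph.addRight (latticePoint k)).toMeasurableEquiv from rfl, lintegral_map_equiv]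
    refine lintegral_congr fun x => hh k x
  rw [Finset.sum_congr rfl this]
  simp

lemma memLp_of_periodic {F : Type*} [NormedAddCommGroup F]
    {P S : Set (EuclideanSpace ℝ (Fin d))}
    (hS : Bornology.IsBounded S) (hSP : S ⊆ perforatedSpace P)
    {f : EuclideanSpace ℝ (Fin d) → F} (hf : IsCellPeriodic f)
    (hm : MemLp f 2 (volume.restrict (unitCell d \ P))) : MemLp f 2 (volume.restrict S) := by
  refine ⟨?_, ?_⟩
  · obtain ⟨T, hT⟩ := exists_restrict_le_sum hS hSP
    refine AEStronglyMeasurable.mono_measure ?_ hT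
    clear hT
    have key : ∀ k : Fin d → ℤ, AEStronglyMeasurable f
        ((volume.restrict (unitCell d \ P)).map (fun x => x + latticePoint k)) := by
      intro k
      rw [show (fun x : EuclideanSpace ℝ (Fin d) => x + latticePoint k) =
        (Homeomorph.addRight (latticePoint k)).toMeasurableEquiv from rfl,
        (MeasurableEquiv.measurableEmbedding _).aestronglyMeasurable_map_iff]
      convert hm.1 using 1
      ext x
      exact hf k x
    induction T using Finset.cons_induction with
    | empty => simp
    | cons k T hk ih =>
      rw [Finset.sum_cons, aestronglyMeasurable_add_measure_iff]
      exact ⟨key k, ih⟩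
  · obtain ⟨N, hN⟩ := exists_lintegral_le_of_periodic hS hSP
    have h1 := hN (fun x => ‖f x‖ₑ ^ 2) fun k x => by simp only [hf k x]
    rw [← eLpNorm_two_sq, ← eLpNorm_two_sq] at h1
    have h2 : eLpNorm f 2 (volume.restrict S) ^ 2 < ⊤ :=
      h1.trans_lt (ENNReal.mul_lt_top ENNReal.coe_lt_top (ENNReal.pow_lt_top hm.2))
    exact ((ENNReal.pow_lt_top_iff).1 h2).resolve_right two_ne_zero

lemma locL2On_of_periodic {F : Type*} [NormedAddCommGroup F]
    {P : Set (EuclideanSpace ℝ (Fin d))} {f : EuclideanSpace ℝ (Fin d) → F} (hf : IsCellPeriodic f)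
    (hm : MemLp f 2 (volume.restrict (unitCell d \ P))) : LocL2On (perforatedSpace P) f :=
  fun _ hKP hK => memLp_of_periodic hK.isBounded hKP hf hm

/-! Homeomorphisms deforming one perforated cell into another one. -/

/-- `f` is a periodic bi-Lipschitz homeomorphism preserving the cell and mapping `P` to `Q`. -/
structure IsCellDeformation (P Q : Set (EuclideanSpace ℝ (Fin d)))
    (f : EuclideanSpace ℝ (Fin d) ≃ₜ EuclideanSpace ℝ (Fin d)) (L : ℝ≥0) : Prop where
  lipschitz : LipschitzWith L f
  lipschitz_symm : LipschitzWith L f.symm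
  map_add : ∀ (k : Fin d → ℤ) x, f (x + latticePoint k) = f x + latticePoint k
  mem_cell_iff : ∀ x, f x ∈ unitCell d ↔ x ∈ unitCell d
  mem_iff : ∀ x, f x ∈ Q ↔ x ∈ P

namespace IsCellDeformation

variable {P Q : Set (EuclideanSpace ℝ (Fin d))}
  {f : EuclideanSpace ℝ (Fin d) ≃ₜ EuclideanSpace ℝ (Fin d)} {L : ℝ≥0}

lemma symm (h : IsCellDeformation P Q f L) : IsCellDeformation Q P f.symm L where
  lipschitz := h.lipschitz_symm
  lipschitz_symm := h.lipschitz
  map_add k x := by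
    rw [f.symm_apply_eq, h.map_add, f.apply_symm_apply]
  mem_cell_iff x := by rw [← h.mem_cell_iff, f.apply_symm_apply]
  mem_iff x := by rw [← h.mem_iff, f.apply_symm_apply]

lemma antilipschitz (h : IsCellDeformation P Q f L) : AntilipschitzWith L f := by
  intro x y
  have := h.lipschitz_symm (f x) (f y)
  rwa [f.symm_apply_apply, f.symm_apply_apply] at this

lemma mapsTo (h : IsCellDeformation P Q f L) :
    MapsTo f (unitCell d \ P) (unitCell d \ Q) :=
  fun x hx => ⟨(h.mem_cell_iff x).2 hx.1, fun h' => hx.2 ((h.mem_iff x).1 h')⟩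

lemma mem_perforatedSpace_iff (h : IsCellDeformation P Q f L) (x : EuclideanSpace ℝ (Fin d)) :
    f x ∈ perforatedSpace Q ↔ x ∈ perforatedSpace P := by
  have hcl : ∀ y, f y ∈ closure Q ↔ y ∈ closure P := by
    intro y
    have hpre : f ⁻¹' Q = P := by ext z; exact h.mem_iff z
    rw [← hpre, ← f.preimage_closure]; rfl
  refine forall_congr' fun k => not_congr ?_
  rw [← h.map_add, hcl]

lemma fderiv_add (h : IsCellDeformation P Q f L) (k : Fin d → ℤ) (x : EuclideanSpace ℝ (Fin d)) :
    fderiv ℝ f (x + latticePoint k) = fderiv ℝ f x := by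
  rw [← fderiv_comp_add_right]
  have : (fun y => f (y + latticePoint k)) = fun y => f y + latticePoint k := by
    ext1 y; exact h.map_add k y
  rw [this, fderiv_add_const]

/-- The gradient field of `u ∘ f`, where `g` is the gradient field of `u`. -/
def _root_.CellProblem.pullbackGrad (f : EuclideanSpace ℝ (Fin d) → EuclideanSpace ℝ (Fin d))
    (g : EuclideanSpace ℝ (Fin d) → EuclideanSpace ℝ (Fin d)) (x : EuclideanSpace ℝ (Fin d)) :
    EuclideanSpace ℝ (Fin d) :=
  ContinuousLinearMap.adjoint (fderiv ℝ f x) (g (f x))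

lemma memLp_comp {F : Type*} [NormedAddCommGroup F] (h : IsCellDeformation P Q f L)
    {u : EuclideanSpace ℝ (Fin d) → F} (hu : MemLp u 2 (volume.restrict (unitCell d \ Q))) :
    MemLp (fun x => u (f x)) 2 (volume.restrict (unitCell d \ P)) :=
  CellProblem.memLp_comp h.antilipschitz f.continuous.measurable h.mapsTo hu

lemma memLp_pullbackGrad (h : IsCellDeformation P Q f L)
    {g : EuclideanSpace ℝ (Fin d) → EuclideanSpace ℝ (Fin d)}
    (hg : MemLp g 2 (volume.restrict (unitCell d \ Q))) :
    MemLp (pullbackGrad f g) 2 (volume.restrict (unitCell d \ P)) :=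
  memLp_adjoint_fderiv_apply h.lipschitz (h.memLp_comp hg)

/-- Periodic Sobolev functions are pulled back to periodic Sobolev functions. -/
theorem isPeriodicSobolev_comp (h : IsCellDeformation P Q f L) (hQ : Q ⊆ unitCell d)
    {u : EuclideanSpace ℝ (Fin d) → ℝ} {g : EuclideanSpace ℝ (Fin d) → EuclideanSpace ℝ (Fin d)}
    (hu : IsPeriodicSobolev Q u g) :
    IsPeriodicSobolev P (fun x => u (f x)) (pullbackGrad f g) where
  periodic k x := by simp only [h.map_add]; exact hu.periodic k _
  periodic_grad k x := by
    simp only [pullbackGrad, h.map_add, h.fderiv_add]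
    rw [hu.periodic_grad k]
  memLp := h.memLp_comp hu.memLp
  memLp_grad := h.memLp_pullbackGrad hu.memLp_grad
  weak_grad := by
    have h1 : HasWeakGradOn (perforatedSpace Q) u g := hu.weak_grad
    have h2 := h1.comp (isOpen_perforatedSpace hQ) (locL2On_of_periodic hu.periodic hu.memLp)
      (locL2On_of_periodic hu.periodic_grad hu.memLp_grad) f h.lipschitz h.antilipschitz
    have h3 : f ⁻¹' perforatedSpace Q = perforatedSpace P := by
      ext x; exact h.mem_perforatedSpace_iff x
    rw [h3] at h2
    exact h2

end IsCellDeformation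

/-! ### The deformations `id + h X`, and the null boundary of the inclusion -/

namespace DeformationField

variable {P : ℝ → Set (EuclideanSpace ℝ (Fin d))} {b : ℝ}
  {X : EuclideanSpace ℝ (Fin d) → EuclideanSpace ℝ (Fin d)} {L : ℝ≥0}

lemma norm_smul_sub_le (hX : DeformationField P b X L) {h : ℝ} (hh : |h| ≤ b)
    (x y : EuclideanSpace ℝ (Fin d)) : ‖h • X x - h • X y‖ ≤ 3 / 4 * ‖x - y‖ := by
  rw [← smul_sub, norm_smul, Real.norm_eq_abs]
  have h1 := hX.lipschitz.dist_le_mul x y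
  rw [dist_eq_norm, dist_eq_norm] at h1
  have h0 := hX.pos
  calc |h| * ‖X x - X y‖ ≤ b * (L * ‖x - y‖) := by gcongr
    _ = b * L * ‖x - y‖ := by ring
    _ ≤ _ := by gcongr; exact hX.small

/-- A perturbation of the identity with Lipschitz constant `3/4` is a homeomorphism whose inverse
has constant `1/(1 - 3/4) = 4`. The forward constant `7/4` is rounded up to the same value. -/
theorem exists_isCellDeformation (hX : DeformationField P b X L) {h : ℝ} (hh : |h| ≤ b) :
    ∃ f : EuclideanSpace ℝ (Fin d) ≃ₜ EuclideanSpace ℝ (Fin d), (∀ x, f x = x + h • X x) ∧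
      IsCellDeformation (P 0) (P h) f 4 := by
  have happ : ApproximatesLinearOn (fun x => x + h • X x)
      ((ContinuousLinearEquiv.refl ℝ (EuclideanSpace ℝ (Fin d)) :
        EuclideanSpace ℝ (Fin d) ≃L[ℝ] EuclideanSpace ℝ (Fin d)) :
          EuclideanSpace ℝ (Fin d) →L[ℝ] EuclideanSpace ℝ (Fin d)) univ (3 / 4 : ℝ≥0) := by
    rw [ApproximatesLinearOn.approximatesLinearOn_iff_lipschitzOnWith]
    refine (LipschitzWith.of_dist_le_mul fun x y => ?_).lipschitzOnWith
    have := hX.norm_smul_sub_le hh x y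
    simpa [dist_eq_norm] using this
  have hc : Subsingleton (EuclideanSpace ℝ (Fin d)) ∨ (3 / 4 : ℝ≥0) <
      ‖((ContinuousLinearEquiv.refl ℝ (EuclideanSpace ℝ (Fin d))).symm :
        EuclideanSpace ℝ (Fin d) →L[ℝ] EuclideanSpace ℝ (Fin d))‖₊⁻¹ := by
    rcases subsingleton_or_nontrivial (EuclideanSpace ℝ (Fin d)) with hs | hs
    · exact Or.inl hs
    · right
      have : ‖((ContinuousLinearEquiv.refl ℝ (EuclideanSpace ℝ (Fin d))).symm :
        EuclideanSpace ℝ (Fin d) →L[ℝ] EuclideanSpace ℝ (Fin d))‖₊ = 1 := by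
        ext; exact ContinuousLinearMap.norm_id
      rw [this, inv_one, div_lt_one (by norm_num)]
      norm_num
  set f := happ.toHomeomorph _ hc with hf
  have hfx : ∀ x, f x = x + h • X x := fun x => rfl
  have hanti : ∀ x y, ‖x - y‖ ≤ 4 * ‖f x - f y‖ := by
    intro x y
    have h1 := hX.norm_smul_sub_le hh x y
    have h2 : x - y = (f x - f y) - (h • X x - h • X y) := by rw [hfx, hfx]; abel
    have h3 : ‖x - y‖ ≤ ‖f x - f y‖ + ‖h • X x - h • X y‖ := by
      conv_lhs => rw [h2]
      exact norm_sub_le _ _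
    linarith
  refine ⟨f, hfx, ⟨?_, ?_, ?_, ?_, ?_⟩⟩
  · refine LipschitzWith.of_dist_le_mul fun x y => ?_
    rw [dist_eq_norm, dist_eq_norm, hfx, hfx]
    have h1 := hX.norm_smul_sub_le hh x y
    have h2 : x + h • X x - (y + h • X y) = (x - y) + (h • X x - h • X y) := by abel
    rw [h2]
    refine (norm_add_le _ _).trans ?_
    push_cast
    linarith [norm_nonneg (x - y)]
  · refine LipschitzWith.of_dist_le_mul fun x y => ?_
    rw [dist_eq_norm, dist_eq_norm]
    simpa using hanti (f.symm x) (f.symm y)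
  · intro k x
    rw [hfx, hfx, hX.periodic k x]; abel
  · exact fun x => hX.mem_cell_iff h hh x
  · exact fun x => hX.mem_iff h hh x

lemma isOpen (hX : DeformationField P b X L) {h : ℝ} (hh : |h| ≤ b) : IsOpen (P h) := by
  obtain ⟨f, -, hf⟩ := hX.exists_isCellDeformation hh
  have : f.symm ⁻¹' (P 0) = P h := by
    ext x; exact hf.symm.mem_iff x
  rw [← this]
  exact hX.isOpen_zero.preimage f.symm.continuous

/-- The images of the boundary under `id + (b/(n+1)) X` are pairwise disjoint, lie in the closed
cell, and each have at least `4⁻ᵈ` times the volume of the boundary. Infinitely many of them fit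
only if that volume is zero. -/
lemma volume_frontier (hX : DeformationField P b X L) : volume (frontier (P 0)) = 0 := by
  by_contra hne
  have hb := hX.pos
  let s : ℕ → ℝ := fun n => b / (n + 1)
  have hs : ∀ n, |s n| ≤ b := by
    intro n
    rw [abs_of_pos (by positivity)]
    exact div_le_self hb.le (by linarith [n.cast_nonneg (α := ℝ)])
  have hinj : Function.Injective s := by
    intro m n hmn
    have h1 : b / ((m : ℝ) + 1) = b / (n + 1) := hmn
    rw [div_eq_div_iff (by positivity) (by positivity)] at h1
    have h2 := mul_left_cancel₀ hb.ne' h1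
    have h3 : (n : ℝ) = m := by linarith
    exact_mod_cast h3.symm
  let A : ℕ → Set (EuclideanSpace ℝ (Fin d)) := fun n => (fun x => x + s n • X x) '' frontier (P 0)
  have hcell : frontier (P 0) ⊆ closedCell d :=
    frontier_subset_closure.trans (hX.closure_zero_subset_cell.trans unitCell_subset_closedCell)
  have hcomp : IsCompact (frontier (P 0)) :=
    isCompact_closedCell.of_isClosed_subset isClosed_frontier hcell
  have hXc : Continuous X := hX.lipschitz.continuous
  have hAm : ∀ n, MeasurableSet (A n) := fun n =>
    (hcomp.image (by fun_prop)).measurableSet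
  have hdisj : Pairwise (Function.onFun Disjoint A) := fun m n hmn =>
    hX.disjoint_image _ _ (hs m) (hs n) (hinj.ne hmn)
  have hle : ∀ n, ((4 : ℝ≥0∞) ^ d)⁻¹ * volume (frontier (P 0)) ≤ volume (A n) := by
    intro n
    obtain ⟨f, hf, hfd⟩ := hX.exists_isCellDeformation (hs n)
    have hA : A n = f '' frontier (P 0) := by
      refine image_congr fun x _ => (hf x).symm
    have h1 := volume_preimage_le hfd.antilipschitz (A n)
    rw [hA, f.injective.preimage_image] at h1
    rw [hA, mul_comm, ← div_eq_mul_inv]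
    refine ENNReal.div_le_of_le_mul ?_
    rw [mul_comm]
    exact_mod_cast h1
  have htop : volume (⋃ n, A n) = ⊤ := by
    rw [measure_iUnion hdisj hAm, ← top_le_iff]
    have hpos : ((4 : ℝ≥0∞) ^ d)⁻¹ * volume (frontier (P 0)) ≠ 0 :=
      mul_ne_zero (by simp) hne
    rw [← ENNReal.tsum_const_eq_top_of_ne_zero (α := ℕ) hpos]
    exact ENNReal.tsum_le_tsum hle
  have hsub : (⋃ n, A n) ⊆ closedCell d := by
    refine iUnion_subset fun n => ?_
    rintro _ ⟨x, hx, rfl⟩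
    exact hX.mem_closedCell _ (hs n) x (hcell hx)
  exact absurd htop ((measure_mono hsub).trans_lt isCompact_closedCell.measure_lt_top).ne

end DeformationField

lemma tendsto_lintegral_sq {α F : Type*} [MeasurableSpace α] [NormedAddCommGroup F]
    {μ : Measure α} {f : ℕ → α → F} {f₀ : α → F} {A K : Set α} (hAK : A ⊆ K)
    (hf : ∀ n, MemLp (f n) 2 (μ.restrict K)) (hf₀ : MemLp f₀ 2 (μ.restrict K))
    (h : Tendsto (fun n => eLpNorm (fun x => f n x - f₀ x) 2 (μ.restrict K)) atTop (𝓝 0)) :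
    Tendsto (fun n => ∫⁻ x in A, ‖f n x‖ₑ ^ 2 ∂μ) atTop (𝓝 (∫⁻ x in A, ‖f₀ x‖ₑ ^ 2 ∂μ)) := by
  have hle : μ.restrict A ≤ μ.restrict K := Measure.restrict_mono_set μ hAK
  have hfA := fun n => (hf n).mono_measure hle
  have hf₀A := hf₀.mono_measure hle
  have h1 : Tendsto (fun n => eLpNorm (f n - f₀) 2 (μ.restrict A)) atTop (𝓝 0) :=
    tendsto_of_tendsto_of_tendsto_of_le_of_le tendsto_const_nhds h (fun _ => zero_le)
      fun n => eLpNorm_mono_measure _ hle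
  have h2 := (Lp.tendsto_Lp_iff_tendsto_eLpNorm'' f hfA f₀ hf₀A).2 h1
  have h3 := (continuous_enorm.tendsto _).comp h2
  simp only [Function.comp_def, Lp.enorm_toLp] at h3
  have h4 := ((ENNReal.continuous_pow 2).tendsto _).comp h3
  simpa only [Function.comp_def, eLpNorm_two_sq] using h4

lemma tendsto_setIntegral_of_eLpNorm {α : Type*} [MeasurableSpace α]
    {μ : Measure α} {f : ℕ → α → ℝ} {f₀ : α → ℝ} {A K : Set α} (hAK : A ⊆ K) (hA : μ A ≠ ⊤)
    (hf : ∀ n, MemLp (f n) 2 (μ.restrict K)) (hf₀ : MemLp f₀ 2 (μ.restrict K))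
    (h : Tendsto (fun n => eLpNorm (fun x => f n x - f₀ x) 2 (μ.restrict K)) atTop (𝓝 0)) :
    Tendsto (fun n => ∫ x in A, f n x ∂μ) atTop (𝓝 (∫ x in A, f₀ x ∂μ)) := by
  have hle : μ.restrict A ≤ μ.restrict K := Measure.restrict_mono_set μ hAK
  have : IsFiniteMeasure (μ.restrict A) := ⟨by simpa using hA.lt_top⟩
  have h1 := tendsto_integral_mul (ψ := fun _ => (1 : ℝ)) (fun n => (hf n).mono_measure hle)
    (hf₀.mono_measure hle) (memLp_const 1)
    (tendsto_of_tendsto_of_tendsto_of_le_of_le tendsto_const_nhds h (fun _ => zero_le)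
      fun n => eLpNorm_mono_measure _ hle)
  simpa using h1

lemma closedCell_ae_le_unitCell : (closedCell d : Set (EuclideanSpace ℝ (Fin d))) ≤ᵐ[volume] unitCell d := by
  filter_upwards [ae_cellRep_mem_unitCell (d := d)] with x hx hxc i
  have h1 := hx i
  have h2 : x i ∈ Icc (0 : ℝ) 1 := hxc i
  rw [cellRep_apply] at h1
  refine ⟨lt_of_le_of_ne h2.1 fun h => ?_, lt_of_le_of_ne h2.2 fun h => ?_⟩
  · rw [← h] at h1; simp at h1
  · rw [h] at h1; simp at h1

/-! ### Poincaré's inequality on the perforated cell -/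

namespace DeformationField

variable {P : ℝ → Set (EuclideanSpace ℝ (Fin d))} {b : ℝ}
  {X : EuclideanSpace ℝ (Fin d) → EuclideanSpace ℝ (Fin d)} {L : ℝ≥0}

lemma isCompact_diff (hX : DeformationField P b X L) {t : ℝ} (ht : |t| ≤ b) :
    IsCompact (closedCell d \ P t) :=
  isCompact_closedCell.diff (hX.isOpen ht)

/-- For `t > 0` these compact sets stay away from the closed inclusion, so smooth approximation is
available on them; as `t → 0` they exhaust the perforated cell up to a null set. -/
lemma diff_subset_perforatedSpace (hX : DeformationField P b X L) {t : ℝ} (ht : 0 < t)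
    (htb : t ≤ b) : closedCell d \ P t ⊆ perforatedSpace (P 0) := by
  intro y hy k hk
  have h1 := eq_zero_of_add_mem_unitCell hy.1 (hX.closure_zero_subset_cell hk)
  rw [h1, latticePoint_zero, add_zero] at hk
  exact hy.2 (hX.closure_zero_subset t ht htb hk)

/-- The mass of a function near the inclusion is controlled by its mass away from it. -/
lemma lintegral_diff_le (hX : DeformationField P b X L) {t : ℝ} (ht : 0 < t) (htb : t ≤ b)
    {v : EuclideanSpace ℝ (Fin d) → ℝ} (hv : ContDiff ℝ 1 v) :
    ∫⁻ x in closedCell d \ P t, ‖v x‖ₑ ^ 2 ≤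
      4 * ((4 ^ d : ℝ≥0) * ∫⁻ x in closedCell d \ P b, ‖v x‖ₑ ^ 2) +
        4 * (b.toNNReal ^ 2 * ((4 ^ d : ℝ≥0) *
          ∫⁻ x in closedCell d \ P t, ‖gradient v x‖ₑ ^ 2)) := by
  have hb := hX.pos
  have hXc : Continuous X := hX.lipschitz.continuous
  have htabs : |t| ≤ b := by rwa [abs_of_pos ht]
  have hbabs : |b| ≤ b := by rw [abs_of_pos hb]
  set S := closedCell d \ P t with hS
  have hSm : MeasurableSet S := (hX.isCompact_diff htabs).measurableSet
  have hvm : Measurable v := hv.continuous.measurable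
  have hFm : Measurable (fun x => x + b • X x) := by fun_prop
  obtain ⟨f, hf, hfd⟩ := hX.exists_isCellDeformation hbabs
  -- The full deformation sends every point outside `P 0`, in particular every point of `S`, outside
  -- `P b`.
  have h1 : ∫⁻ x in S, ‖v (x + b • X x)‖ₑ ^ 2 ≤
      (4 ^ d : ℝ≥0) * ∫⁻ x in closedCell d \ P b, ‖v x‖ₑ ^ 2 := by
    have hmaps : MapsTo f S (closedCell d \ P b) := by
      intro x hx
      refine ⟨by rw [hf]; exact hX.mem_closedCell b hbabs x hx.1, fun h' => hx.2 ?_⟩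
      exact hX.closure_zero_subset t ht htb (subset_closure ((hfd.mem_iff x).1 h'))
    have := lintegral_comp_le hfd.antilipschitz f.continuous.measurable hmaps
      (h := fun x => ‖v x‖ₑ ^ 2) (hvm.enorm.pow_const 2).aemeasurable
    simpa only [hf] using this
  -- Every intermediate map `id + s b X` preserves `S`, so the gradient is integrated over `S` only
  -- and the constant does not depend on `t`.
  have h2 : ∫⁻ x in S, ‖v (x + b • X x) - v x‖ₑ ^ 2 ≤ b.toNNReal ^ 2 * ((4 ^ d : ℝ≥0) *
      ∫⁻ x in S, ‖gradient v x‖ₑ ^ 2) := by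
    refine lintegral_sub_comp_le hv hSm (Z := fun x => b • X x) (by fun_prop) (fun x _ => ?_) ?_
    · rw [norm_smul, Real.coe_toNNReal _ hb.le, Real.norm_of_nonneg hb.le]
      exact mul_le_of_le_one_right hb.le (hX.bounded x)
    · intro s hs h hh
      have hsb : |s * b| ≤ b := by
        rw [abs_of_nonneg (mul_nonneg hs.1 hb.le)]
        exact mul_le_of_le_one_left hb.le hs.2
      obtain ⟨f', hf', hfd'⟩ := hX.exists_isCellDeformation hsb
      have hmaps : MapsTo f' S S := by
        intro x hx
        rw [hf']
        exact ⟨hX.mem_closedCell _ hsb x hx.1, hX.notMem _ (mul_nonneg hs.1 hb.le)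
          ((le_abs_self _).trans hsb) t htabs x hx.2⟩
      have := lintegral_comp_le hfd'.antilipschitz f'.continuous.measurable hmaps
        (h := h) hh.aemeasurable
      simpa only [hf', smul_smul] using this
  calc ∫⁻ x in S, ‖v x‖ₑ ^ 2
      ≤ ∫⁻ x in S, (4 * ‖v (x + b • X x)‖ₑ ^ 2 + 4 * ‖v (x + b • X x) - v x‖ₑ ^ 2) := by
        refine lintegral_mono fun x => ?_
        have h3 : ‖v x‖ₑ ≤ ‖v (x + b • X x)‖ₑ + ‖v (x + b • X x) - v x‖ₑ := by
          conv_lhs => rw [← sub_sub_cancel (v (x + b • X x)) (v x)]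
          exact enorm_sub_le
        refine (pow_le_pow_left' h3 2).trans ((enorm_add_sq_le _ _).trans (le_of_eq ?_))
        ring
    _ = 4 * (∫⁻ x in S, ‖v (x + b • X x)‖ₑ ^ 2) +
          4 * (∫⁻ x in S, ‖v (x + b • X x) - v x‖ₑ ^ 2) := by
        rw [lintegral_add_left, lintegral_const_mul' _ _ (by simp),
          lintegral_const_mul' _ _ (by simp)]
        exact ((hvm.comp hFm).enorm.pow_const 2).const_mul 4
    _ ≤ _ := by gcongr

/-- Poincaré's inequality for periodic Sobolev functions, up to finitely many averages. -/
theorem exists_poincare (hX : DeformationField P b X L) :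
    ∃ (I : Finset (EuclideanSpace ℝ (Fin d) × ℝ)) (C : ℝ≥0),
      (∀ i ∈ I, closedBall i.1 i.2 ⊆ perforatedSpace (P 0)) ∧
      ∀ u g, IsPeriodicSobolev (P 0) u g → ∫⁻ x in unitCell d \ P 0, ‖u x‖ₑ ^ 2 ≤
        C * (∑ i ∈ I, ‖∫ x in ball i.1 i.2, u x‖ₑ ^ 2 + ∫⁻ x in unitCell d \ P 0, ‖g x‖ₑ ^ 2) := by
  have hb := hX.pos
  have hbabs : |b| ≤ b := by rw [abs_of_pos hb]
  have hO : IsOpen (perforatedSpace (P 0)) :=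
    isOpen_perforatedSpace (hX.subset_cell 0 (by rw [abs_zero]; exact hb.le))
  have hcov : ∀ x ∈ closedCell d \ P b, ∃ r : ℝ, 0 < r ∧ closedBall x r ⊆ perforatedSpace (P 0) :=
    fun x hx => Metric.nhds_basis_closedBall.mem_iff.1
      (hO.mem_nhds (hX.diff_subset_perforatedSpace hb le_rfl hx))
  choose! r hr hrO using hcov
  obtain ⟨T, hTS, hT⟩ := (hX.isCompact_diff hbabs).elim_nhds_subcover (fun x => ball x (r x))
    (fun x hx => ball_mem_nhds x (hr x hx))
  choose! c hc using fun x (hx : x ∈ closedCell d \ P b) =>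
    exists_poincare_ball x (hr x hx)
  choose! N hN using fun x (hx : x ∈ closedCell d \ P b) =>
    exists_lintegral_le_of_periodic (P := P 0) (S := ball x (r x)) isBounded_ball
      (ball_subset_closedBall.trans (hrO x hx))
  -- Ball inequalities cover the compact part outside `P b`, and `lintegral_diff_le` covers the
  -- rest. Independence of `t` is what permits `t → 0` at the end.
  set D : ℝ≥0 := 4 * 4 ^ d * ∑ x ∈ T, c x + 4 * (b.toNNReal ^ 2 * 4 ^ d) with hD
  -- the inequality for smooth functions
  have hsmooth : ∀ t, 0 < t → t ≤ b → ∀ v : EuclideanSpace ℝ (Fin d) → ℝ, ContDiff ℝ 1 v →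
      ∫⁻ x in closedCell d \ P t, ‖v x‖ₑ ^ 2 ≤ D * (∑ x ∈ T, ‖∫ y in ball x (r x), v y‖ₑ ^ 2 +
        ((∑ x ∈ T, ∫⁻ y in ball x (r x), ‖gradient v y‖ₑ ^ 2) +
          ∫⁻ x in closedCell d \ P t, ‖gradient v x‖ₑ ^ 2)) := by
    intro t ht htb v hv
    set A := ∑ x ∈ T, ‖∫ y in ball x (r x), v y‖ₑ ^ 2
    set B := ∑ x ∈ T, ∫⁻ y in ball x (r x), ‖gradient v y‖ₑ ^ 2
    set G := ∫⁻ x in closedCell d \ P t, ‖gradient v x‖ₑ ^ 2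
    have h1 : ∫⁻ x in closedCell d \ P b, ‖v x‖ₑ ^ 2 ≤ (∑ x ∈ T, c x : ℝ≥0) * (A + B) := by
      calc ∫⁻ x in closedCell d \ P b, ‖v x‖ₑ ^ 2
          ≤ ∫⁻ y in ⋃ x ∈ T, ball x (r x), ‖v y‖ₑ ^ 2 := lintegral_mono_set hT
        _ ≤ ∑ x ∈ T, ∫⁻ y in ball x (r x), ‖v y‖ₑ ^ 2 := by
            rw [← lintegral_finsetSum_measure]
            refine lintegral_mono' (Measure.le_iff.2 fun A hA => ?_) le_rfl
            rw [Measure.restrict_apply hA, Measure.finsetSum_apply, inter_iUnion₂]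
            refine (measure_biUnion_finset_le _ _).trans (le_of_eq ?_)
            exact Finset.sum_congr rfl fun x _ => (Measure.restrict_apply hA).symm
        _ ≤ ∑ x ∈ T, (c x : ℝ≥0∞) * (A + B) := by
            refine Finset.sum_le_sum fun x hx => (hc x (hTS x hx) v hv).trans ?_
            gcongr
            · exact Finset.single_le_sum (f := fun x => ‖∫ y in ball x (r x), v y‖ₑ ^ 2)
                (fun _ _ => zero_le) hx
            · exact Finset.single_le_sum
                (f := fun x => ∫⁻ y in ball x (r x), ‖gradient v y‖ₑ ^ 2)
                (fun _ _ => zero_le) hx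
        _ = _ := by rw [← Finset.sum_mul]; push_cast; rfl
    refine (hX.lintegral_diff_le ht htb hv).trans ?_
    calc _ ≤ 4 * ((4 ^ d : ℝ≥0) * ((∑ x ∈ T, c x : ℝ≥0) * (A + B))) +
          4 * (b.toNNReal ^ 2 * ((4 ^ d : ℝ≥0) * G)) := by gcongr
      _ = ((4 * 4 ^ d * ∑ x ∈ T, c x : ℝ≥0) : ℝ≥0∞) * (A + B) +
          ((4 * (b.toNNReal ^ 2 * 4 ^ d) : ℝ≥0) : ℝ≥0∞) * G := by push_cast; ring
      _ ≤ (D : ℝ≥0∞) * (A + B) + D * G := by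
          gcongr
          · exact le_self_add
          · exact le_add_self
      _ = _ := by ring
  refine ⟨T.image fun x => (x, r x), D * (1 + ∑ x ∈ T, N x + 1), ?_, fun u g hug => ?_⟩
  · intro i hi
    obtain ⟨x, hx, rfl⟩ := Finset.mem_image.1 hi
    exact hrO x (hTS x hx)
  rw [Finset.sum_image (fun x _ y _ h => (Prod.mk.injEq _ _ _ _ ▸ h).1)]
  set A := ∑ x ∈ T, ‖∫ y in ball x (r x), u y‖ₑ ^ 2 with hA
  set G := ∫⁻ x in unitCell d \ P 0, ‖g x‖ₑ ^ 2 with hG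
  have hlu := locL2On_of_periodic hug.periodic hug.memLp
  have hlg := locL2On_of_periodic hug.periodic_grad hug.memLp_grad
  have hw : HasWeakGradOn (perforatedSpace (P 0)) u g := hug.weak_grad
  have hgper : IsCellPeriodic fun x => ‖g x‖ₑ ^ 2 := fun k x => by
    simp only [hug.periodic_grad k x]
  -- passage to the limit from smooth functions
  have hlim : ∀ t, 0 < t → t ≤ b → ∫⁻ x in closedCell d \ P t, ‖u x‖ₑ ^ 2 ≤
      (D * (1 + ∑ x ∈ T, N x + 1) : ℝ≥0) * (A + G) := by
    intro t ht htb
    have htabs : |t| ≤ b := by rwa [abs_of_pos ht]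
    set K := (closedCell d \ P t) ∪ ⋃ x ∈ T, closedBall x (r x) with hK
    have hKc : IsCompact K := (hX.isCompact_diff htabs).union
      (T.isCompact_biUnion fun x _ => isCompact_closedBall x (r x))
    have hKO : K ⊆ perforatedSpace (P 0) :=
      union_subset (hX.diff_subset_perforatedSpace ht htb)
        (iUnion₂_subset fun x hx => hrO x (hTS x hx))
    have hBK : ∀ x ∈ T, ball x (r x) ⊆ K := fun x hx =>
      ball_subset_closedBall.trans ((subset_biUnion_of_mem (u := fun x => closedBall x (r x)) hx).trans
        subset_union_right)
    have hε : ∀ n : ℕ, (0 : ℝ≥0∞) < ((n : ℝ≥0∞) + 1)⁻¹ := fun n => by simp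
    choose v hv hvs hvu hvg using fun n : ℕ => hw.exists_smooth_approx hO hlu hlg hKc hKO (hε n)
    have hv1 : ∀ n, ContDiff ℝ 1 (v n) := fun n => (hv n).of_le (by norm_cast)
    have hlim0 : Tendsto (fun n : ℕ => ((n : ℝ≥0∞) + 1)⁻¹) atTop (𝓝 0) := by
      have := (tendsto_add_atTop_iff_nat 1).2 ENNReal.tendsto_inv_nat_nhds_zero
      simpa using this
    have hlu0 := tendsto_of_tendsto_of_tendsto_of_le_of_le tendsto_const_nhds hlim0
      (fun _ => zero_le) hvu
    have hlg0 := tendsto_of_tendsto_of_tendsto_of_le_of_le tendsto_const_nhds hlim0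
      (fun _ => zero_le) hvg
    have hvL := fun n => memLp_two_of_continuous (hv n).continuous hKc
    have hvgL := fun n => memLp_two_of_continuous (continuous_gradient (hv1 n)) hKc
    have h1 := tendsto_lintegral_sq (A := closedCell d \ P t) subset_union_left hvL
      (hlu K hKO hKc) hlu0
    have h2 := tendsto_lintegral_sq (A := closedCell d \ P t) subset_union_left hvgL
      (hlg K hKO hKc) hlg0
    have h3 := tendsto_finsetSum T fun x hx =>
      tendsto_lintegral_sq (hBK x hx) hvgL (hlg K hKO hKc) hlg0
    have h4 := tendsto_finsetSum T fun x hx => ((ENNReal.continuous_pow 2).tendsto _).comp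
      ((continuous_enorm.tendsto _).comp
      (tendsto_setIntegral_of_eLpNorm (hBK x hx) measure_ball_lt_top.ne hvL (hlu K hKO hKc) hlu0))
    have h5 := ENNReal.Tendsto.const_mul (a := (D : ℝ≥0∞)) (h4.add (h3.add h2))
      (Or.inr ENNReal.coe_ne_top)
    refine (le_of_tendsto_of_tendsto' h1 h5 fun n => hsmooth t ht htb (v n) (hv1 n)).trans ?_
    have h6 : ∑ x ∈ T, ∫⁻ y in ball x (r x), ‖g y‖ₑ ^ 2 ≤ (∑ x ∈ T, N x : ℝ≥0) * G := by
      push_cast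
      rw [Finset.sum_mul]
      exact Finset.sum_le_sum fun x hx => hN x (hTS x hx) _ hgper
    have h7 : ∫⁻ x in closedCell d \ P t, ‖g x‖ₑ ^ 2 ≤ G := by
      refine lintegral_mono' (Measure.restrict_mono_ae ?_) le_rfl
      filter_upwards [closedCell_ae_le_unitCell (d := d)] with x hx hxt
      exact ⟨hx hxt.1, fun h0 => hxt.2 (hX.closure_zero_subset t ht htb (subset_closure h0))⟩
    calc _ ≤ (D : ℝ≥0∞) * (A + ((∑ x ∈ T, N x : ℝ≥0) * G + G)) := by gcongr
      _ ≤ (D : ℝ≥0∞) * ((1 + (∑ x ∈ T, N x : ℝ≥0) + 1) * (A + G)) := by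
          gcongr
          calc A + ((∑ x ∈ T, N x : ℝ≥0) * G + G)
              ≤ A + ((∑ x ∈ T, N x : ℝ≥0) * G + G) +
                ((∑ x ∈ T, N x : ℝ≥0) * A + A + G) := le_self_add
            _ = _ := by ring
      _ = _ := by push_cast; ring
  -- exhaustion of the perforated cell
  let s : ℕ → ℝ := fun n => b / (n + 1)
  have hs0 : ∀ n, 0 < s n := fun n => by positivity
  have hsb : ∀ n, s n ≤ b := fun n => div_le_self hb.le (by linarith [n.cast_nonneg (α := ℝ)])
  have hstend : Tendsto s atTop (𝓝 0) := by
    have := (tendsto_one_div_add_atTop_nhds_zero_nat (𝕜 := ℝ)).const_mul b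
    simpa [s, div_eq_mul_inv] using this
  have hSm : ∀ n, MeasurableSet (closedCell d \ P (s n)) := fun n =>
    (hX.isCompact_diff (by rw [abs_of_pos (hs0 n)]; exact hsb n)).measurableSet
  set μ := volume.restrict (unitCell d \ P 0) with hμ
  have hum : AEMeasurable (fun x => ‖u x‖ₑ ^ 2) μ := hug.memLp.1.enorm.pow_const 2
  -- As the boundary is null, almost every point of the cell lies outside `closure (P 0)` and thus
  -- belongs to all but finitely many of the exhausting sets. Fatou's lemma then passes to the
  -- limit.
  have hae : ∀ᵐ x ∂μ, ‖u x‖ₑ ^ 2 ≤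
      liminf (fun n => (closedCell d \ P (s n)).indicator (fun x => ‖u x‖ₑ ^ 2) x) atTop := by
    have hm : MeasurableSet (unitCell d \ P 0) :=
      isOpen_unitCell.measurableSet.diff hX.isOpen_zero.measurableSet
    have hfr : ∀ᵐ x ∂μ, x ∉ frontier (P 0) :=
      ae_restrict_of_ae (measure_eq_zero_iff_ae_notMem.1 hX.volume_frontier)
    filter_upwards [ae_restrict_mem hm, hfr] with x hx hxf
    have hxc : x ∉ closure (P 0) := by
      rw [closure_eq_self_union_frontier]
      exact fun h => h.elim hx.2 hxf
    obtain ⟨t, ht, hxt⟩ := hX.exists_notMem x hxc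
    refine le_liminf_of_le (by isBoundedDefault) ?_
    filter_upwards [hstend.eventually (ge_mem_nhds ht)] with n hn
    rw [indicator_of_mem]
    exact ⟨unitCell_subset_closedCell hx.1, hxt _ hn⟩
  calc ∫⁻ x, ‖u x‖ₑ ^ 2 ∂μ
      ≤ ∫⁻ x, liminf (fun n => (closedCell d \ P (s n)).indicator (fun x => ‖u x‖ₑ ^ 2) x) atTop ∂μ :=
        lintegral_mono_ae hae
    _ ≤ liminf (fun n => ∫⁻ x, (closedCell d \ P (s n)).indicator (fun x => ‖u x‖ₑ ^ 2) x ∂μ) atTop :=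
        lintegral_liminf_le' fun n => hum.indicator (hSm n)
    _ ≤ _ := by
        refine liminf_le_of_le (by isBoundedDefault) fun y hy => ?_
        obtain ⟨n, hn⟩ := hy.exists
        refine hn.trans ?_
        rw [lintegral_indicator (hSm n)]
        refine le_trans ?_ (hlim (s n) (hs0 n) (hsb n))
        rw [hμ, Measure.restrict_restrict (hSm n)]
        exact lintegral_mono_set inter_subset_left

end DeformationField

/-! ### Closedness of the space of gradients -/

/-- A bounded linear map that is bounded below up to a map of finite rank has closed range. -/
lemma isClosed_range_of_norm_le {V W Z : Type*} [NormedAddCommGroup V] [NormedSpace ℝ V]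
    [CompleteSpace V] [NormedAddCommGroup W] [NormedSpace ℝ W] [NormedAddCommGroup Z]
    [NormedSpace ℝ Z] [FiniteDimensional ℝ Z] (A : V →L[ℝ] W) (B : V →L[ℝ] Z) {c : ℝ≥0}
    (h : ∀ x, ‖x‖ ≤ c * (‖A x‖ + ‖B x‖)) : IsClosed (range A) := by
  have hanti : AntilipschitzWith (2 * c) (A.prod B) := by
    refine AddMonoidHomClass.antilipschitz_of_bound _ fun x => (h x).trans ?_
    have h1 : ‖A x‖ ≤ ‖(A.prod B) x‖ := le_max_left _ _
    have h2 : ‖B x‖ ≤ ‖(A.prod B) x‖ := le_max_right _ _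
    calc c * (‖A x‖ + ‖B x‖) ≤ c * (‖(A.prod B) x‖ + ‖(A.prod B) x‖) := by gcongr
      _ = _ := by push_cast; ring
  have hcl : IsClosed ((LinearMap.range (A.prod B).toLinearMap : Submodule ℝ (W × Z)) : Set (W × Z)) :=
    hanti.isClosed_range (A.prod B).uniformContinuous
  -- Adding the finite-dimensional factor `0 × Z` keeps the range of `(A, B)` closed and makes the
  -- second component arbitrary, so the slice at second component zero is the range of `A`.
  have hsup := Submodule.isClosed_sup_finiteDimensional _
    (LinearMap.range (LinearMap.inr ℝ W Z)) hcl
  have : range A = (fun w : W => (w, (0 : Z))) ⁻¹'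
      ((LinearMap.range (A.prod B).toLinearMap ⊔ LinearMap.range (LinearMap.inr ℝ W Z) :
        Submodule ℝ (W × Z)) : Set (W × Z)) := by
    ext w
    simp only [mem_range, mem_preimage, SetLike.mem_coe, Submodule.mem_sup, LinearMap.mem_range]
    constructor
    · rintro ⟨x, rfl⟩
      exact ⟨_, ⟨x, rfl⟩, _, ⟨-B x, rfl⟩, by simp⟩
    · rintro ⟨_, ⟨x, rfl⟩, _, ⟨z, rfl⟩, hxz⟩
      exact ⟨x, by simpa using congrArg Prod.fst hxz⟩
  rw [this]
  exact hsup.preimage (by fun_prop)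

/-- The measure on the perforated cell. -/
abbrev cellMeasure (P : Set (EuclideanSpace ℝ (Fin d))) : Measure (EuclideanSpace ℝ (Fin d)) :=
  volume.restrict (unitCell d \ P)

lemma ae_of_ae_cellMeasure {P : Set (EuclideanSpace ℝ (Fin d))}
    {p : EuclideanSpace ℝ (Fin d) → Prop} (hp : IsCellPeriodic p)
    (h : ∀ᵐ x ∂(cellMeasure P), p x) : ∀ᵐ x, x ∈ perforatedSpace P → p x := by
  have h1 : ∀ n : ℕ, ∀ᵐ x ∂(volume.restrict (perforatedSpace P ∩ ball 0 n)), p x := by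
    intro n
    obtain ⟨T, hT⟩ := exists_restrict_le_sum (P := P) (S := perforatedSpace P ∩ ball 0 n)
      (isBounded_ball.subset inter_subset_right) inter_subset_left
    rw [ae_iff]
    refine le_antisymm ((hT _).trans ?_) zero_le
    rw [Measure.finsetSum_apply]
    refine le_of_eq (Finset.sum_eq_zero fun k _ => ?_)
    rw [show (fun x : EuclideanSpace ℝ (Fin d) => x + latticePoint k) =
      (Homeomorph.addRight (latticePoint k)).toMeasurableEquiv from rfl, MeasurableEquiv.map_apply]
    rw [ae_iff] at h
    convert h using 2
    ext x
    exact not_congr (iff_of_eq (hp k x))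
  have h2 := (ae_restrict_iUnion_iff (fun n : ℕ => perforatedSpace P ∩ ball 0 n) p).2 h1
  rw [← inter_iUnion, iUnion_ball_nat, inter_univ] at h2
  exact ae_imp_of_ae_restrict h2

lemma HasWeakGradOn.congr_ae {O : Set (EuclideanSpace ℝ (Fin d))}
    {u u' : EuclideanSpace ℝ (Fin d) → ℝ}
    {g g' : EuclideanSpace ℝ (Fin d) → EuclideanSpace ℝ (Fin d)}
    (h : HasWeakGradOn O u g) (hu : ∀ᵐ x, x ∈ O → u x = u' x) (hg : ∀ᵐ x, x ∈ O → g x = g' x) :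
    HasWeakGradOn O u' g' := by
  intro φ hφ hφs hφO i
  have h1 := h φ hφ hφs hφO i
  have h2 : ∫ y, u y * fderiv ℝ φ y (EuclideanSpace.single i 1) =
      ∫ y, u' y * fderiv ℝ φ y (EuclideanSpace.single i 1) := by
    refine integral_congr_ae ?_
    filter_upwards [hu] with x hx
    by_cases hxO : x ∈ O
    · simp only [hx hxO]
    · rw [image_eq_zero_of_notMem_tsupport
        (fun h => hxO (hφO (tsupport_fderiv_subset ℝ h)) : x ∉ tsupport (fderiv ℝ φ))]
      simp
  have h3 : ∫ y, g y i * φ y = ∫ y, g' y i * φ y := by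
    refine integral_congr_ae ?_
    filter_upwards [hg] with x hx
    by_cases hxO : x ∈ O
    · simp only [hx hxO]
    · rw [image_eq_zero_of_notMem_tsupport (fun h => hxO (hφO h) : x ∉ tsupport φ)]
      simp
  rw [← h2, ← h3, h1]

/-- The periodic extension of a function from the unit cell. -/
def cellExt {F : Type*} (f : EuclideanSpace ℝ (Fin d) → F) : EuclideanSpace ℝ (Fin d) → F :=
  fun x => f (cellRep x)

lemma isCellPeriodic_cellExt {F : Type*} (f : EuclideanSpace ℝ (Fin d) → F) :
    IsCellPeriodic (cellExt f) := fun k x => by rw [cellExt, cellRep_add_latticePoint, cellExt]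

lemma ae_mem_unitCell {P : Set (EuclideanSpace ℝ (Fin d))} (hP : IsOpen P) :
    ∀ᵐ x ∂(cellMeasure P), x ∈ unitCell d \ P :=
  ae_restrict_mem (isOpen_unitCell.measurableSet.diff hP.measurableSet)

lemma cellExt_ae_eq {F : Type*} {P : Set (EuclideanSpace ℝ (Fin d))} (hP : IsOpen P)
    (f : EuclideanSpace ℝ (Fin d) → F) : cellExt f =ᵐ[cellMeasure P] f := by
  filter_upwards [ae_mem_unitCell hP] with x hx
  rw [cellExt, cellRep_eq_self hx.1]

lemma cellExt_ae_eq_of_periodic {F : Type*} {P : Set (EuclideanSpace ℝ (Fin d))} (hP : IsOpen P)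
    {f g : EuclideanSpace ℝ (Fin d) → F} (hg : IsCellPeriodic g) (h : f =ᵐ[cellMeasure P] g) :
    ∀ᵐ x, x ∈ perforatedSpace P → cellExt f x = g x := by
  refine ae_of_ae_cellMeasure (fun k x => ?_) ((cellExt_ae_eq hP f).trans h)
  rw [isCellPeriodic_cellExt f k x, hg k x]

section

variable {F : Type*} [NormedAddCommGroup F]

lemma memLp_cellExt {P : Set (EuclideanSpace ℝ (Fin d))} (hP : IsOpen P)
    (f : Lp F 2 (cellMeasure P)) : MemLp (cellExt f) 2 (cellMeasure P) :=
  (Lp.memLp f).ae_eq (cellExt_ae_eq hP f).symm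

variable [InnerProductSpace ℝ F]

/-- Periodic extension to a bounded subset of the perforated space. -/
lemma exists_extension {P S : Set (EuclideanSpace ℝ (Fin d))} (hP : IsOpen P)
    (hS : Bornology.IsBounded S) (hSm : MeasurableSet S) (hSP : S ⊆ perforatedSpace P) :
    ∃ T : Lp F 2 (cellMeasure P) →L[ℝ] Lp F 2 (volume.restrict S),
      ∀ f, T f =ᵐ[volume.restrict S] cellExt f := by
  have hm : ∀ f : Lp F 2 (cellMeasure P), MemLp (cellExt f) 2 (volume.restrict S) := fun f =>
    memLp_of_periodic hS hSP (isCellPeriodic_cellExt f) (memLp_cellExt hP f)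
  obtain ⟨N, hN⟩ := exists_lintegral_le_of_periodic hS hSP
  have hres : ∀ {p : EuclideanSpace ℝ (Fin d) → Prop}, (∀ᵐ x, x ∈ perforatedSpace P → p x) →
      ∀ᵐ x ∂(volume.restrict S), p x := fun h => by
    rw [ae_restrict_iff' hSm]
    filter_upwards [h] with x hx hxS using hx (hSP hxS)
  let T : Lp F 2 (cellMeasure P) →ₗ[ℝ] Lp F 2 (volume.restrict S) :=
    { toFun := fun f => (hm f).toLp
      map_add' := fun f g => by
        rw [← MemLp.toLp_add]
        refine MemLp.toLp_congr _ _ (hres (cellExt_ae_eq_of_periodic hP ?_ ?_))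
        · intro k x
          simp only [Pi.add_apply, isCellPeriodic_cellExt _ k x]
        · exact (Lp.coeFn_add f g).trans
            ((cellExt_ae_eq hP f).symm.add (cellExt_ae_eq hP g).symm)
      map_smul' := fun c f => by
        rw [RingHom.id_apply, ← MemLp.toLp_const_smul]
        refine MemLp.toLp_congr _ _ (hres (cellExt_ae_eq_of_periodic hP ?_ ?_))
        · intro k x
          simp only [Pi.smul_apply, isCellPeriodic_cellExt _ k x]
        · exact (Lp.coeFn_smul c f).trans ((cellExt_ae_eq hP f).symm.const_smul c) }
  refine ⟨T.mkContinuous (NNReal.sqrt N) fun f => ?_, fun f => MemLp.coeFn_toLp (hm f)⟩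
  change ‖(hm f).toLp‖ ≤ _
  rw [Lp.norm_toLp, Lp.norm_def]
  have h1 := hN (fun x => ‖cellExt f x‖ₑ ^ 2) fun k x => by
    simp only [isCellPeriodic_cellExt _ k x]
  have h2 : eLpNorm (cellExt f) 2 (volume.restrict S) ≤
      (NNReal.sqrt N : ℝ≥0) * eLpNorm (cellExt f) 2 (cellMeasure P) := by
    rw [eLpNorm_two_le_iff]
    refine h1.trans (le_of_eq ?_)
    rw [← ENNReal.coe_pow, NNReal.sq_sqrt]
  rw [eLpNorm_congr_ae (cellExt_ae_eq hP f)] at h2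
  have h3 := ENNReal.toReal_mono (ENNReal.mul_ne_top ENNReal.coe_ne_top (Lp.memLp f).2.ne) h2
  rwa [ENNReal.toReal_mul, ENNReal.coe_toReal] at h3

/-- Integration of periodic extensions against a square integrable field is continuous. -/
lemma exists_pairing {P S : Set (EuclideanSpace ℝ (Fin d))} (hP : IsOpen P)
    (hS : Bornology.IsBounded S) (hSm : MeasurableSet S) (hSP : S ⊆ perforatedSpace P)
    {Ψ : EuclideanSpace ℝ (Fin d) → F} (hΨ : MemLp Ψ 2 (volume.restrict S)) :
    ∃ Λ : Lp F 2 (cellMeasure P) →L[ℝ] ℝ,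
      ∀ f, Λ f = ∫ x in S, inner ℝ (Ψ x) (cellExt f x) := by
  obtain ⟨T, hT⟩ := exists_extension (F := F) hP hS hSm hSP
  refine ⟨(innerSL ℝ (hΨ.toLp)).comp T, fun f => ?_⟩
  rw [ContinuousLinearMap.comp_apply, innerSL_apply_apply, L2.inner_def]
  refine integral_congr_ae ?_
  filter_upwards [hT f, hΨ.coeFn_toLp] with x h1 h2
  rw [h1, h2]

end

/-- Membership in the weak gradient relation, tested by a single function. -/
lemma exists_weakGrad_functional {P : Set (EuclideanSpace ℝ (Fin d))} (hP : IsOpen P)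
    {φ : EuclideanSpace ℝ (Fin d) → ℝ} (hφ : ContDiff ℝ ∞ φ) (hφs : HasCompactSupport φ)
    (hφP : tsupport φ ⊆ perforatedSpace P) (i : Fin d) :
    ∃ Λ : (Lp ℝ 2 (cellMeasure P) × Lp (EuclideanSpace ℝ (Fin d)) 2 (cellMeasure P)) →L[ℝ] ℝ,
      ∀ p, Λ p = 0 ↔ ∫ y, cellExt p.1 y * fderiv ℝ φ y (EuclideanSpace.single i 1) =
        - ∫ y, cellExt p.2 y i * φ y := by
  have hS : IsCompact (tsupport φ) := hφs
  have hcf : Continuous (fderiv ℝ φ) := hφ.continuous_fderiv (by norm_num)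
  obtain ⟨Λ₁, h₁⟩ := exists_pairing hP hS.isBounded hS.measurableSet hφP
    (Ψ := fun y => fderiv ℝ φ y (EuclideanSpace.single i 1))
    (memLp_two_of_continuous (by fun_prop) hS)
  obtain ⟨Λ₂, h₂⟩ := exists_pairing hP hS.isBounded hS.measurableSet hφP
    (Ψ := fun y => φ y • EuclideanSpace.single i (1 : ℝ))
    (memLp_two_of_continuous (hφ.continuous.smul continuous_const) hS)
  refine ⟨Λ₁.coprod Λ₂, fun p => ?_⟩
  rw [ContinuousLinearMap.coprod_apply, h₁, h₂, setIntegral_eq_integral_of_forall_compl_eq_zero,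
    setIntegral_eq_integral_of_forall_compl_eq_zero, add_eq_zero_iff_eq_neg]
  · refine Iff.of_eq (congrArg₂ _ (integral_congr_ae (.of_forall fun y => ?_))
      (congrArg _ (integral_congr_ae (.of_forall fun y => ?_))))
    · simp
    · simp [real_inner_smul_left, EuclideanSpace.inner_single_left, mul_comm]
  · intro x hx
    simp [image_eq_zero_of_notMem_tsupport hx]
  · intro x hx
    rw [image_eq_zero_of_notMem_tsupport
        (fun h => hx (tsupport_fderiv_subset ℝ h) : x ∉ tsupport (fderiv ℝ φ))]
    simp

/-- The closed space of pairs of a periodic Sobolev function and its gradient. -/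
def sobolevGraph {P : Set (EuclideanSpace ℝ (Fin d))} (hP : IsOpen P) :
    Submodule ℝ (Lp ℝ 2 (cellMeasure P) × Lp (EuclideanSpace ℝ (Fin d)) 2 (cellMeasure P)) where
  carrier := {p | HasWeakGradOn (perforatedSpace P) (cellExt p.1) (cellExt p.2)}
  zero_mem' φ hφ hφs hφP i := by
    obtain ⟨Λ, hΛ⟩ := exists_weakGrad_functional hP hφ hφs hφP i
    exact (hΛ 0).1 (map_zero Λ)
  add_mem' {p q} hp hq φ hφ hφs hφP i := by
    obtain ⟨Λ, hΛ⟩ := exists_weakGrad_functional hP hφ hφs hφP i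
    refine (hΛ _).1 ?_
    rw [map_add, (hΛ p).2 (hp φ hφ hφs hφP i), (hΛ q).2 (hq φ hφ hφs hφP i), add_zero]
  smul_mem' c p hp φ hφ hφs hφP i := by
    obtain ⟨Λ, hΛ⟩ := exists_weakGrad_functional hP hφ hφs hφP i
    refine (hΛ _).1 ?_
    rw [map_smul, (hΛ p).2 (hp φ hφ hφs hφP i), smul_zero]

lemma isClosed_sobolevGraph {P : Set (EuclideanSpace ℝ (Fin d))} (hP : IsOpen P) :
    IsClosed (sobolevGraph hP : Set (Lp ℝ 2 (cellMeasure P) × Lp (EuclideanSpace ℝ (Fin d)) 2 (cellMeasure P))) := by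
  have : (sobolevGraph hP : Set (Lp ℝ 2 (cellMeasure P) × Lp (EuclideanSpace ℝ (Fin d)) 2 (cellMeasure P))) =
      {p | HasWeakGradOn (perforatedSpace P) (cellExt p.1) (cellExt p.2)} := rfl
  rw [this]
  simp only [HasWeakGradOn, ofPred_forall]
  refine isClosed_iInter fun φ => isClosed_iInter fun hφ => isClosed_iInter fun hφs =>
    isClosed_iInter fun hφP => isClosed_iInter fun i => ?_
  obtain ⟨Λ, hΛ⟩ := exists_weakGrad_functional hP hφ hφs hφP i
  simp only [← hΛ]
  exact isClosed_eq Λ.continuous continuous_const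

/-- This links `L²` classes on one cell, where functional analysis takes place, with functions
periodic at every point, for which the weak gradient is defined. -/
lemma mem_sobolevGraph_iff {P : Set (EuclideanSpace ℝ (Fin d))} (hP : IsOpen P)
    (p : Lp ℝ 2 (cellMeasure P) × Lp (EuclideanSpace ℝ (Fin d)) 2 (cellMeasure P)) :
    p ∈ sobolevGraph hP ↔ ∃ u g, IsPeriodicSobolev P u g ∧ p.1 =ᵐ[cellMeasure P] u ∧
      p.2 =ᵐ[cellMeasure P] g := by
  constructor
  · intro h
    exact ⟨cellExt p.1, cellExt p.2, ⟨isCellPeriodic_cellExt _, isCellPeriodic_cellExt _,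
      memLp_cellExt hP _, memLp_cellExt hP _, h⟩, (cellExt_ae_eq hP _).symm,
      (cellExt_ae_eq hP _).symm⟩
  · rintro ⟨u, g, h, hu, hg⟩
    have h0 : HasWeakGradOn (perforatedSpace P) u g := h.weak_grad
    refine h0.congr_ae ?_ ?_
    · filter_upwards [cellExt_ae_eq_of_periodic hP h.periodic hu] with x hx hxP
      exact (hx hxP).symm
    · filter_upwards [cellExt_ae_eq_of_periodic hP h.periodic_grad hg] with x hx hxP
      exact (hx hxP).symm

/-- The space of gradients of periodic Sobolev functions. -/
def gradientSpace {P : Set (EuclideanSpace ℝ (Fin d))} (hP : IsOpen P) :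
    Submodule ℝ (Lp (EuclideanSpace ℝ (Fin d)) 2 (cellMeasure P)) :=
  (sobolevGraph hP).map (LinearMap.snd ℝ _ _)

lemma mem_gradientSpace_iff {P : Set (EuclideanSpace ℝ (Fin d))} (hP : IsOpen P)
    (G : Lp (EuclideanSpace ℝ (Fin d)) 2 (cellMeasure P)) :
    G ∈ gradientSpace hP ↔ ∃ u g, IsPeriodicSobolev P u g ∧ G =ᵐ[cellMeasure P] g := by
  rw [gradientSpace, Submodule.mem_map]
  constructor
  · rintro ⟨p, hp, rfl⟩
    obtain ⟨u, g, h, -, hg⟩ := (mem_sobolevGraph_iff hP p).1 hp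
    exact ⟨u, g, h, hg⟩
  · rintro ⟨u, g, h, hg⟩
    exact ⟨(h.memLp.toLp, G), (mem_sobolevGraph_iff hP _).2 ⟨u, g, h, h.memLp.coeFn_toLp, hg⟩, rfl⟩

/-- The gradient space is the projection of the closed graph to its second component. Poincaré's
inequality bounds the first component by the second and by finitely many averages, so
`isClosed_range_of_norm_le` applies. -/
lemma DeformationField.isClosed_gradientSpace {P : ℝ → Set (EuclideanSpace ℝ (Fin d))} {b : ℝ}
    {X : EuclideanSpace ℝ (Fin d) → EuclideanSpace ℝ (Fin d)} {L : ℝ≥0}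
    (hX : DeformationField P b X L) :
    IsClosed (gradientSpace hX.isOpen_zero : Set (Lp (EuclideanSpace ℝ (Fin d)) 2 (cellMeasure (P 0)))) := by
  obtain ⟨I, C, hI, hC⟩ := hX.exists_poincare
  have hpair : ∀ i : I, ∃ Λ : Lp ℝ 2 (cellMeasure (P 0)) →L[ℝ] ℝ,
      ∀ f, Λ f = ∫ x in ball i.1.1 i.1.2, cellExt f x := by
    intro i
    have : IsFiniteMeasure (volume.restrict (ball i.1.1 i.1.2)) :=
      ⟨by simpa using measure_ball_lt_top⟩
    obtain ⟨Λ, hΛ⟩ := exists_pairing hX.isOpen_zero (S := ball i.1.1 i.1.2) (Ψ := fun _ => (1 : ℝ))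
      isBounded_ball measurableSet_ball (ball_subset_closedBall.trans (hI i.1 i.2)) (memLp_const 1)
    exact ⟨Λ, fun f => by simpa using hΛ f⟩
  choose Λ hΛ using hpair
  have : CompleteSpace (sobolevGraph hX.isOpen_zero) :=
    (isClosed_sobolevGraph hX.isOpen_zero).completeSpace_coe
  let A : sobolevGraph hX.isOpen_zero →L[ℝ] Lp (EuclideanSpace ℝ (Fin d)) 2 (cellMeasure (P 0)) :=
    (ContinuousLinearMap.snd ℝ _ _).comp (sobolevGraph hX.isOpen_zero).subtypeL
  let B : sobolevGraph hX.isOpen_zero →L[ℝ] (I → ℝ) :=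
    (ContinuousLinearMap.pi Λ).comp
      ((ContinuousLinearMap.fst ℝ _ _).comp (sobolevGraph hX.isOpen_zero).subtypeL)
  have hA : (gradientSpace hX.isOpen_zero : Set (Lp (EuclideanSpace ℝ (Fin d)) 2 (cellMeasure (P 0)))) = range A := by
    ext G
    simp only [gradientSpace, Submodule.map_coe, mem_image, mem_range]
    exact ⟨fun ⟨p, hp, h⟩ => ⟨⟨p, hp⟩, h⟩, fun ⟨p, h⟩ => ⟨p.1, p.2, h⟩⟩
  rw [hA]
  set M : ℝ := C * (I.card + 1) with hM
  have hM0 : 0 ≤ M := by positivity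
  refine isClosed_range_of_norm_le A B (c := (√M + 1).toNNReal) fun p => ?_
  rw [Real.coe_toNNReal _ (by positivity)]
  have hnn : 0 ≤ ‖A p‖ + ‖B p‖ := by positivity
  obtain ⟨u, g, h, hu, hg⟩ := (mem_sobolevGraph_iff hX.isOpen_zero p.1).1 p.2
  have key : ‖p.1.1‖ ^ 2 ≤ M * (‖A p‖ + ‖B p‖) ^ 2 := by
    have h1 := hC _ _ (⟨isCellPeriodic_cellExt _, isCellPeriodic_cellExt _,
      memLp_cellExt hX.isOpen_zero _, memLp_cellExt hX.isOpen_zero _, p.2⟩ :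
      IsPeriodicSobolev (P 0) (cellExt p.1.1) (cellExt p.1.2))
    rw [← eLpNorm_two_sq, ← eLpNorm_two_sq, eLpNorm_congr_ae (cellExt_ae_eq hX.isOpen_zero _),
      eLpNorm_congr_ae (cellExt_ae_eq hX.isOpen_zero _), ← Lp.enorm_def, ← Lp.enorm_def,
      ← Finset.sum_coe_sort] at h1
    simp only [← hΛ, ← ofReal_norm] at h1
    simp only [← ENNReal.ofReal_pow (norm_nonneg _)] at h1
    rw [← ENNReal.ofReal_sum_of_nonneg (fun _ _ => by positivity),
      ← ENNReal.ofReal_add (Finset.sum_nonneg fun _ _ => by positivity) (by positivity),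
      ← ENNReal.ofReal_coe_nnreal, ← ENNReal.ofReal_mul (by positivity),
      ENNReal.ofReal_le_ofReal_iff (by positivity)] at h1
    refine h1.trans ?_
    have h2 : ∑ i : I, ‖Λ i p.1.1‖ ^ 2 ≤ I.card * ‖B p‖ ^ 2 := by
      calc ∑ i : I, ‖Λ i p.1.1‖ ^ 2 ≤ ∑ i : I, ‖B p‖ ^ 2 := by
            gcongr with i _
            exact norm_le_pi_norm (B p) i
        _ = _ := by simp
    have h3 : ‖p.1.2‖ = ‖A p‖ := rfl
    rw [h3, hM, mul_assoc]
    gcongr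
    have h4 : ‖B p‖ ^ 2 ≤ (‖A p‖ + ‖B p‖) ^ 2 := by gcongr; linarith [norm_nonneg (A p)]
    have h5 : ‖A p‖ ^ 2 ≤ (‖A p‖ + ‖B p‖) ^ 2 := by gcongr; linarith [norm_nonneg (B p)]
    have h6 : (I.card : ℝ) * ‖B p‖ ^ 2 ≤ I.card * (‖A p‖ + ‖B p‖) ^ 2 := by gcongr
    linarith
  have key2 : ‖p.1.1‖ ≤ √M * (‖A p‖ + ‖B p‖) := by
    refine le_of_sq_le_sq ?_ (by positivity)
    rw [mul_pow, Real.sq_sqrt hM0]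
    exact key
  have : ‖p‖ = max ‖p.1.1‖ ‖A p‖ := rfl
  rw [this]
  refine max_le ?_ ?_ <;> nlinarith [norm_nonneg (B p), Real.sqrt_nonneg M, mul_nonneg (Real.sqrt_nonneg M) hnn]

/-! ### `C^{1,1}` regularity and interpolation error from a uniform Taylor estimate -/

section Interpolation

variable {F : Type*} [NormedAddCommGroup F] [NormedSpace ℝ F]

/-- A second order Taylor estimate, uniform in the base point, implies `C^{1,1}` regularity. -/
lemma isC11On_of_taylor {K K' : ℝ → F} {s : Set ℝ} {C : ℝ}
    (h : ∀ x ∈ s, ∀ y ∈ s, ‖K x - K y - (x - y) • K' y‖ ≤ C * (x - y) ^ 2) : IsC11On K s := by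
  refine ⟨K', fun y hy => ?_, (2 * C).toNNReal, ?_⟩
  · rw [hasDerivWithinAt_iff_isLittleO]
    have h1 : (fun x => K x - K y - (x - y) • K' y) =O[𝓝[s] y] fun x => (x - y) ^ 2 := by
      refine Asymptotics.IsBigO.of_bound C ?_
      filter_upwards [self_mem_nhdsWithin] with x hx
      rw [Real.norm_of_nonneg (sq_nonneg _)]
      exact h x hx y hy
    refine h1.trans_isLittleO ?_
    have h2 : Tendsto (fun x : ℝ => x - y) (𝓝[s] y) (𝓝 0) := by
      have : Tendsto (fun x : ℝ => x - y) (𝓝 y) (𝓝 (y - y)) := by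
        exact (continuous_id.sub continuous_const).tendsto y
      rw [sub_self] at this
      exact this.mono_left nhdsWithin_le_nhds
    have h3 := (Asymptotics.isLittleO_pow_id (𝕜 := ℝ) one_lt_two).comp_tendsto h2
    exact h3
  · refine LipschitzOnWith.of_dist_le_mul fun x hx y hy => ?_
    rcases eq_or_ne x y with rfl | hxy
    · simp
    have h1 := h x hx y hy
    have h2 := h y hy x hx
    -- Adding the expansions about `y` and about `x` cancels the values of `K` and leaves the
    -- increment of `K'`.
    have h3 : (x - y) • (K' x - K' y) =
        (K x - K y - (x - y) • K' y) + (K y - K x - (y - x) • K' x) := by module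
    have h4 : |x - y| * ‖K' x - K' y‖ ≤ 2 * C * (x - y) ^ 2 := by
      rw [← Real.norm_eq_abs, ← norm_smul, h3]
      refine (norm_add_le _ _).trans ((add_le_add h1 h2).trans (le_of_eq ?_))
      ring
    have hpos : 0 < |x - y| := abs_pos.2 (sub_ne_zero.2 hxy)
    rw [dist_eq_norm, Real.dist_eq]
    refine le_trans ?_ (mul_le_mul_of_nonneg_right (Real.le_coe_toNNReal _) hpos.le)
    rw [← sq_abs, pow_two] at h4
    nlinarith

/-- The error of piecewise linear interpolation. -/
lemma norm_sub_piecewiseLinear_le {K K' : ℝ → F} {b C : ℝ} (hb : 0 < b)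
    (hK : ∀ x ∈ Icc (-b) b, ∀ y ∈ Icc (-b) b, ‖K x - K y - (x - y) • K' y‖ ≤ C * (x - y) ^ 2)
    {N : ℕ} (hN : 1 ≤ N) {h : ℝ} (hh : h ∈ Icc (-b) b) :
    ‖K h - piecewiseLinear K b N h‖ ≤ C * gridStep b N ^ 2 := by
  have hN0 : (0 : ℝ) < N := by exact_mod_cast hN
  have hC : 0 ≤ C := by
    have := (norm_nonneg _).trans (hK b ⟨by linarith, le_rfl⟩ (-b) ⟨le_rfl, by linarith⟩)
    by_contra hneg
    push Not at hneg
    nlinarith [sq_pos_of_pos (show 0 < b - -b by linarith)]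
  set Δ := gridStep b N with hΔ
  have hΔ0 : 0 < Δ := by rw [hΔ, gridStep]; positivity
  have hNΔ : N * Δ = 2 * b := by rw [hΔ, gridStep]; field_simp
  set i := ⌊(h + b) / Δ⌋₊ with hi
  have hq : 0 ≤ (h + b) / Δ := div_nonneg (by linarith [hh.1]) hΔ0.le
  have hi1 : (i : ℝ) * Δ ≤ h + b := by
    rw [← le_div_iff₀ hΔ0]; exact Nat.floor_le hq
  have hi2 : h + b < (i + 1) * Δ := by
    rw [← div_lt_iff₀ hΔ0]; exact Nat.lt_floor_add_one _
  have hnode : gridNode b N i = -b + i * Δ := rfl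
  have hnode' : gridNode b N (i + 1) = -b + (i + 1) * Δ := by
    rw [gridNode]; push_cast; rfl
  set p := gridNode b N i with hp
  set q := gridNode b N (i + 1) with hq'
  set t := (h - p) / Δ with ht
  have htΔ : t * Δ = h - p := div_mul_cancel₀ _ hΔ0.ne'
  have ht0 : 0 ≤ t := div_nonneg (by linarith) hΔ0.le
  have ht1 : t ≤ 1 := by rw [ht, div_le_one hΔ0]; linarith
  have hpw : piecewiseLinear K b N h = (1 - t) • K p + t • K q := rfl
  have hiN : i ≤ N := by
    have : (i : ℝ) * Δ ≤ N * Δ := by linarith [hh.2]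
    exact_mod_cast le_of_mul_le_mul_right this hΔ0
  have hps : p ∈ Icc (-b) b := by
    constructor
    · rw [hnode]; linarith [mul_nonneg (Nat.cast_nonneg (α := ℝ) i) hΔ0.le]
    · linarith [hh.2]
  rw [hpw]
  rcases hiN.eq_or_lt with hiN | hiN
  -- The index `N` occurs only at the right end point; there `t = 0`, so the node beyond the
  -- interval has weight zero.
  · have hhp : h = p := by
      have : (i : ℝ) * Δ = 2 * b := by rw [hiN, hNΔ]
      linarith [hh.2]
    have : t = 0 := by rw [ht, hhp, sub_self, zero_div]
    rw [this, ← hhp]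
    simp only [sub_zero, one_smul, zero_smul, add_zero, sub_self, norm_zero]
    positivity
  · have hqs : q ∈ Icc (-b) b := by
      constructor
      · linarith [hh.1]
      · have h1 : ((i : ℝ) + 1) * Δ ≤ N * Δ := by
          gcongr
          exact_mod_cast hiN
        rw [hnode']; linarith
    have hpq : q = p + Δ := by rw [hnode, hnode']; ring
    -- Both nodes are expanded about `h`. The first-order terms cancel because `h` is the same
    -- convex combination of `p` and `q`.
    have e1 : K h - ((1 - t) • K p + t • K q) =
        -((1 - t) • (K p - K h - (p - h) • K' h) + t • (K q - K h - (q - h) • K' h)) := by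
      have e2 : (1 - t) * (p - h) + t * (q - h) = 0 := by rw [hpq]; linear_combination htΔ
      have e3 : (1 - t) • (p - h) • K' h + t • (q - h) • K' h = 0 := by
        rw [smul_smul, smul_smul, ← add_smul, e2, zero_smul]
      rw [smul_sub, smul_sub (t : ℝ)]
      calc _ = -((1 - t) • (K p - K h) + t • (K q - K h)) + 0 := by module
        _ = _ := by rw [← e3]; module
    rw [e1, norm_neg]
    refine (norm_add_le _ _).trans ?_
    rw [norm_smul, norm_smul, Real.norm_of_nonneg ht0, Real.norm_of_nonneg (sub_nonneg.2 ht1)]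
    have b1 : ‖K p - K h - (p - h) • K' h‖ ≤ C * Δ ^ 2 := by
      refine (hK p hps h hh).trans (mul_le_mul_of_nonneg_left ?_ hC)
      exact sq_le_sq' (by linarith) (by linarith)
    have b2 : ‖K q - K h - (q - h) • K' h‖ ≤ C * Δ ^ 2 := by
      refine (hK q hqs h hh).trans (mul_le_mul_of_nonneg_left ?_ hC)
      exact sq_le_sq' (by linarith) (by linarith)
    nlinarith [sub_nonneg.2 ht1]

end Interpolation

/-! ### Equilibria and their energies -/

section Variational

variable {H : Type*} [NormedAddCommGroup H] [InnerProductSpace ℝ H]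

/-- `G` minimizes the energy of `A` on the affine space `e + V`. -/
def IsEquilibrium (A : H →L[ℝ] H) (V : Submodule ℝ H) (e G : H) : Prop :=
  G - e ∈ V ∧ ∀ w ∈ V, inner ℝ (A G) w = 0

/-- Lax–Milgram for the compression of `A` to `V`, after the affine constraint has been moved to the
right-hand side `-A e`. -/
lemma exists_isEquilibrium (A : H →L[ℝ] H) (V : Submodule ℝ H) [CompleteSpace V] {c : ℝ}
    (hc : 0 < c) (hA : ∀ x, c * ‖x‖ ^ 2 ≤ inner ℝ (A x) x) (e : H) :
    ∃ G, IsEquilibrium A V e G := by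
  let B : V →L[ℝ] V →L[ℝ] ℝ :=
    ((innerSL ℝ).comp (V.orthogonalProjectionOnto.comp (A.comp V.subtypeL)))
  have hB : ∀ v w : V, B v w = inner ℝ (A v) (w : H) := by
    intro v w
    simp [B]
  have hcoer : IsCoercive B := ⟨c, hc, fun u => by
    rw [hB, mul_assoc, ← pow_two]
    exact hA u⟩
  set v := hcoer.continuousLinearEquivOfBilin.symm (-V.orthogonalProjectionOnto (A e)) with hv
  refine ⟨e + v, by simp, fun w hw => ?_⟩
  have h1 := hcoer.continuousLinearEquivOfBilin_apply v ⟨w, hw⟩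
  rw [hv, ContinuousLinearEquiv.apply_symm_apply, ← hv, hB, inner_neg_left] at h1
  have h2 : inner ℝ (V.orthogonalProjectionOnto (A e)) (⟨w, hw⟩ : V) = inner ℝ (A e) w := by
    simp
  rw [map_add, inner_add_left, ← h1, h2]
  simp

namespace IsEquilibrium

variable {A : H →L[ℝ] H} {V : Submodule ℝ H} {e G : H}

lemma norm_le (hG : IsEquilibrium A V e G) {c M : ℝ} (hc : 0 < c)
    (hA : ∀ x, c * ‖x‖ ^ 2 ≤ inner ℝ (A x) x) (hM : ‖A‖ ≤ M) : ‖G‖ ≤ M * ‖e‖ / c := by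
  rw [le_div_iff₀ hc]
  rcases eq_or_ne G 0 with h0 | h0
  · rw [h0, norm_zero, zero_mul]
    exact mul_nonneg ((norm_nonneg _).trans hM) (norm_nonneg _)
  have h1 : inner ℝ (A G) G = inner ℝ (A G) e := by
    have := hG.2 _ hG.1
    rwa [inner_sub_right, sub_eq_zero] at this
  have h2 : inner ℝ (A G) e ≤ M * ‖G‖ * ‖e‖ :=
    (real_inner_le_norm _ _).trans (by gcongr; exact A.le_of_opNorm_le hM G)
  have h3 := hA G
  have h4 : 0 < ‖G‖ := norm_pos_iff.2 h0
  rw [h1] at h3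
  nlinarith

/-- Test both equilibrium conditions with `G - G' ∈ V`: coercivity of `A` leaves only `(A - A') G'`
on the right. -/
lemma norm_sub_le {A' : H →L[ℝ] H} {G' : H} (hG : IsEquilibrium A V e G)
    (hG' : IsEquilibrium A' V e G') {c δ : ℝ} (hc : 0 < c)
    (hA : ∀ x, c * ‖x‖ ^ 2 ≤ inner ℝ (A x) x) (hδ : ‖A - A'‖ ≤ δ) :
    ‖G - G'‖ ≤ δ * ‖G'‖ / c := by
  rw [le_div_iff₀ hc]
  rcases eq_or_ne (G - G') 0 with h0 | h0
  · rw [h0, norm_zero, zero_mul]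
    exact mul_nonneg ((norm_nonneg _).trans hδ) (norm_nonneg _)
  have hV : G - G' ∈ V := by
    have := V.sub_mem hG.1 hG'.1
    rwa [sub_sub_sub_cancel_right] at this
  have h1 : inner ℝ (A (G - G')) (G - G') = -inner ℝ ((A - A') G') (G - G') := by
    rw [map_sub, inner_sub_left, hG.2 _ hV, sub_apply, inner_sub_left,
      hG'.2 _ hV]
    ring
  have h2 : -inner ℝ ((A - A') G') (G - G') ≤ δ * ‖G'‖ * ‖G - G'‖ := by
    rw [← inner_neg_left]
    refine (real_inner_le_norm _ _).trans ?_
    rw [norm_neg]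
    gcongr
    exact (A - A').le_of_opNorm_le hδ G'
  have h3 := hA (G - G')
  have h4 : 0 < ‖G - G'‖ := norm_pos_iff.2 h0
  rw [h1] at h3
  nlinarith

end IsEquilibrium

/-- The energy of equilibria of a family of symmetric coercive operators depends on the parameter
as smoothly as the operators, up to second order. -/
lemma exists_energy_taylor {A A' : ℝ → H →L[ℝ] H} {s : Set ℝ} {V : Submodule ℝ H} {c M : ℝ}
    (hc : 0 < c) (hcoer : ∀ h ∈ s, ∀ x, c * ‖x‖ ^ 2 ≤ inner ℝ (A h x) x)
    (hsymm : ∀ h ∈ s, ∀ x y, inner ℝ (A h x) y = inner ℝ x (A h y))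
    (hM : ∀ h ∈ s, ‖A h‖ ≤ M) (hM' : ∀ h ∈ s, ‖A' h‖ ≤ M)
    (hlip : ∀ h ∈ s, ∀ k ∈ s, ‖A h - A k‖ ≤ M * |h - k|)
    (htaylor : ∀ h ∈ s, ∀ k ∈ s, ‖A h - A k - (h - k) • A' k‖ ≤ M * (h - k) ^ 2)
    {e e' : H} {G G' : ℝ → H} (hG : ∀ h ∈ s, IsEquilibrium (A h) V e (G h))
    (hG' : ∀ h ∈ s, IsEquilibrium (A h) V e' (G' h)) :
    ∃ (κ : ℝ → ℝ) (C : ℝ), ∀ h ∈ s, ∀ k ∈ s,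
      |inner ℝ (A h (G h)) (G' h) - inner ℝ (A k (G k)) (G' k) - (h - k) * κ k| ≤
        C * (h - k) ^ 2 := by
  set R := M * ‖e‖ / c
  set R' := M * ‖e'‖ / c
  refine ⟨fun k => inner ℝ (A' k (G k)) (G' k), M * R * R' + M * (M * R / c) * R',
    fun h hh k hk => ?_⟩
  have hM0 : 0 ≤ M := (norm_nonneg _).trans (hM h hh)
  have hR : ∀ h ∈ s, ‖G h‖ ≤ R := fun h hh => (hG h hh).norm_le hc (hcoer h hh) (hM h hh)
  have hR' : ∀ h ∈ s, ‖G' h‖ ≤ R' := fun h hh => (hG' h hh).norm_le hc (hcoer h hh) (hM h hh)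
  have hR0 : 0 ≤ R := (norm_nonneg _).trans (hR h hh)
  have hR0' : 0 ≤ R' := (norm_nonneg _).trans (hR' h hh)
  have hD : ‖G h - G k‖ ≤ M * |h - k| * R / c :=
    ((hG h hh).norm_sub_le (hG k hk) hc (hcoer h hh) (hlip h hh k hk)).trans
      (by gcongr; exact hR k hk)
  have hV : G h - G k ∈ V := by
    have := V.sub_mem (hG h hh).1 (hG k hk).1
    rwa [sub_sub_sub_cancel_right] at this
  have hV' : G' h - G' k ∈ V := by
    have := V.sub_mem (hG' h hh).1 (hG' k hk).1
    rwa [sub_sub_sub_cancel_right] at this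
  -- Each energy is a bilinear pairing in which one argument may be shifted along `V`. Here the
  -- second one is shifted; in `e2` symmetry allows shifting the first one, so both energies become
  -- pairings of `G h` with `G' k`.
  have e1 : inner ℝ (A h (G h)) (G' h) = inner ℝ (A h (G h)) (G' k) := by
    have := (hG h hh).2 _ hV'
    rwa [inner_sub_right, sub_eq_zero] at this
  have e2 : inner ℝ (A k (G k)) (G' k) = inner ℝ (A k (G h)) (G' k) := by
    have := (hG' k hk).2 _ hV
    rw [inner_sub_right, sub_eq_zero, real_inner_comm, ← hsymm k hk] at this
    rw [this, hsymm k hk, real_inner_comm]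
  have e3 : inner ℝ (A h (G h)) (G' h) - inner ℝ (A k (G k)) (G' k) -
      (h - k) * inner ℝ (A' k (G k)) (G' k) =
      inner ℝ ((A h - A k - (h - k) • A' k) (G h)) (G' k) +
        (h - k) * inner ℝ (A' k (G h - G k)) (G' k) := by
    rw [e1, e2]
    simp only [sub_apply, smul_apply, map_sub,
      inner_sub_left, real_inner_smul_left]
    ring
  rw [e3]
  refine (abs_add_le _ _).trans ?_
  rw [add_mul]
  refine add_le_add ?_ ?_
  · refine (abs_real_inner_le_norm _ _).trans ?_
    calc _ ≤ (M * (h - k) ^ 2 * R) * R' := by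
          refine mul_le_mul ?_ (hR' k hk) (norm_nonneg _) (by positivity)
          refine (ContinuousLinearMap.le_of_opNorm_le _ (htaylor h hh k hk) _).trans ?_
          gcongr
          exact hR h hh
      _ = _ := by ring
  · rw [abs_mul]
    calc _ ≤ |h - k| * ((M * (M * |h - k| * R / c)) * R') := by
          refine mul_le_mul_of_nonneg_left ((abs_real_inner_le_norm _ _).trans ?_) (abs_nonneg _)
          refine mul_le_mul ?_ (hR' k hk) (norm_nonneg _) (by positivity)
          exact ((A' k).le_of_opNorm_le (hM' k hk) _).trans (by gcongr)
      _ = _ := by rw [← sq_abs (h - k)]; ring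

end Variational

/-! ### Uniform Taylor estimates for `C²` maps -/

section Taylor

variable {V W : Type*} [NormedAddCommGroup V] [NormedSpace ℝ V] [NormedAddCommGroup W]
  [NormedSpace ℝ W]

/-- Uniform Taylor estimates on a compact convex set. -/
lemma exists_taylor_of_contDiffOn {f : V → W} {U S : Set V} (hU : IsOpen U)
    (hf : ContDiffOn ℝ 2 f U) (hSU : S ⊆ U) (hS : IsCompact S) (hconv : Convex ℝ S) :
    ∃ C : ℝ, 0 ≤ C ∧ (∀ x ∈ S, ‖f x‖ ≤ C) ∧ (∀ x ∈ S, ‖fderiv ℝ f x‖ ≤ C) ∧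
      (∀ x ∈ S, ∀ y ∈ S, ‖f y - f x‖ ≤ C * ‖y - x‖) ∧
      ∀ x ∈ S, ∀ y ∈ S, ‖f y - f x - fderiv ℝ f x (y - x)‖ ≤ C * ‖y - x‖ ^ 2 := by
  have hf1 : ContDiffOn ℝ 1 (fderiv ℝ f) U := hf.fderiv_of_isOpen hU (by norm_num)
  have hf2 : ContDiffOn ℝ 0 (fderiv ℝ (fderiv ℝ f)) U := hf1.fderiv_of_isOpen hU (by norm_num)
  obtain ⟨C₀, h₀⟩ := hS.exists_bound_of_continuousOn (hf.continuousOn.mono hSU)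
  obtain ⟨C₁, h₁⟩ := hS.exists_bound_of_continuousOn (hf1.continuousOn.mono hSU)
  obtain ⟨C₂, h₂⟩ := hS.exists_bound_of_continuousOn (f := fderiv ℝ (fderiv ℝ f)) (hf2.continuousOn.mono hSU)
  set C := max 0 (max C₀ (max C₁ C₂))
  have hC0 : 0 ≤ C := le_max_left _ _
  have hC1 : C₁ ≤ C := (le_max_left _ _).trans ((le_max_right _ _).trans (le_max_right _ _))
  have hC2 : C₂ ≤ C := (le_max_right _ _).trans ((le_max_right _ _).trans (le_max_right _ _))
  have hd : ∀ x ∈ S, DifferentiableAt ℝ f x := fun x hx =>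
    (hf.differentiableOn (by norm_num)).differentiableAt (hU.mem_nhds (hSU hx))
  have hd1 : ∀ x ∈ S, DifferentiableAt ℝ (fderiv ℝ f) x := fun x hx =>
    (hf1.differentiableOn (by norm_num)).differentiableAt (hU.mem_nhds (hSU hx))
  refine ⟨C, hC0, fun x hx => (h₀ x hx).trans ((le_max_left _ _).trans (le_max_right _ _)),
    fun x hx => (h₁ x hx).trans hC1, fun x hx y hy => ?_, fun x hx y hy => ?_⟩
  · exact hconv.norm_image_sub_le_of_norm_fderiv_le hd (fun z hz => (h₁ z hz).trans hC1) hx hy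
  · have hseg : segment ℝ x y ⊆ S := hconv.segment_subset hx hy
    have := (convex_segment x y).norm_image_sub_le_of_norm_hasFDerivWithin_le'
      (f := f) (f' := fderiv ℝ f) (φ := fderiv ℝ f x) (C := C * ‖y - x‖)
      (fun z hz => (hd z (hseg hz)).hasFDerivAt.hasFDerivWithinAt) (fun z hz => ?_)
      (left_mem_segment ℝ x y) (right_mem_segment ℝ x y)
    · rwa [mul_assoc, ← pow_two] at this
    · refine (hconv.norm_image_sub_le_of_norm_fderiv_le hd1 (fun z hz => (h₂ z hz).trans hC2)
        hx (hseg hz)).trans ?_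
      gcongr
      rw [← dist_eq_norm, ← dist_eq_norm]
      obtain ⟨s, hs, rfl⟩ := (segment_eq_image_lineMap ℝ x y) ▸ hz
      rw [dist_lineMap_left, Real.norm_of_nonneg hs.1, dist_comm y x]
      exact mul_le_of_le_one_left dist_nonneg hs.2

end Taylor

/-! ### The pulled back coefficient tensor -/

section Tensor

variable {V : Type*} [NormedAddCommGroup V] [InnerProductSpace ℝ V] [FiniteDimensional ℝ V]

lemma contDiff_det : ContDiff ℝ ∞ fun T : V →L[ℝ] V => T.det := by
  set b := Module.finBasis ℝ V
  have h : ∀ T : V →L[ℝ] V, T.det = (LinearMap.toMatrix b b T.toLinearMap).det := fun T =>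
    (LinearMap.det_toMatrix b _).symm
  simp_rw [h, Matrix.det_apply, LinearMap.toMatrix_apply]
  refine ContDiff.sum fun σ _ => ContDiff.const_smul _ (contDiff_prod fun i _ => ?_)
  have : ContDiff ℝ ∞ fun T : V →L[ℝ] V => (b.coord (σ i)).toContinuousLinearMap (T (b i)) := by
    fun_prop
  exact this

lemma contDiff_adjoint :
    ContDiff ℝ ∞ fun T : V →L[ℝ] V => ContinuousLinearMap.adjoint T := by
  let L : (V →L[ℝ] V) →ₗ[ℝ] (V →L[ℝ] V) :=
    { toFun := fun T => ContinuousLinearMap.adjoint T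
      map_add' := fun S T => map_add _ S T
      map_smul' := fun c T => by simp }
  exact (L.mkContinuous 1 fun T => by simp [L]).contDiff

lemma isUnit_one_add {T : V →L[ℝ] V} (hT : ‖T‖ < 1) : IsUnit (1 + T) := by
  rw [← sub_neg_eq_add]
  exact isUnit_one_sub_of_norm_lt_one (by rwa [norm_neg])

/-- The coefficient tensor `K`, pulled back by a map with derivative `1 + T`. -/
def pullbackTensor (K T : V →L[ℝ] V) : V →L[ℝ] V :=
  |(1 + T).det| • (Ring.inverse (1 + T) * (K * ContinuousLinearMap.adjoint (Ring.inverse (1 + T))))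

lemma det_one_add_ne_zero {T : V →L[ℝ] V} (hT : ‖T‖ < 1) : (1 + T).det ≠ 0 := by
  obtain ⟨u, hu⟩ := isUnit_one_add hT
  have h1 : (u : V →L[ℝ] V).toLinearMap ∘ₗ ((u⁻¹ : (V →L[ℝ] V)ˣ) : V →L[ℝ] V).toLinearMap =
      LinearMap.id := by
    ext x
    exact congrArg (fun S : V →L[ℝ] V => S x) u.mul_inv
  rw [← hu]
  intro h0
  have h2 := congrArg LinearMap.det h1
  rw [LinearMap.det_comp, LinearMap.det_id] at h2
  rw [ContinuousLinearMap.det] at h0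
  rw [h0, zero_mul] at h2
  exact zero_ne_one h2

/-- Inversion is smooth at units, and the absolute value is smooth at the determinant because `1 +
T` is invertible for `‖T‖ < 1`. -/
lemma contDiffOn_pullbackTensor (K : V →L[ℝ] V) :
    ContDiffOn ℝ ∞ (pullbackTensor K) (ball 0 1) := by
  intro T hT
  rw [mem_ball_zero_iff] at hT
  obtain ⟨u, hu⟩ := isUnit_one_add hT
  have h0 : ContDiffAt ℝ ∞ (fun T : V →L[ℝ] V => 1 + T) T := by fun_prop
  have h1 : ContDiffAt ℝ ∞ (fun T : V →L[ℝ] V => Ring.inverse (1 + T)) T := by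
    have := contDiffAt_ringInverse ℝ (n := ∞) u
    rw [hu] at this
    exact this.comp T h0
  have h2 : ContDiffAt ℝ ∞ (fun T : V →L[ℝ] V => |(1 + T).det|) T :=
    ContDiffAt.comp (g := fun r : ℝ => |r|) (f := fun T : V →L[ℝ] V => (1 + T).det) T
      (contDiffAt_abs (det_one_add_ne_zero hT)) (contDiff_det.contDiffAt.comp T h0)
  exact (h2.smul (h1.mul (contDiffAt_const.mul
    (contDiff_adjoint.contDiffAt.comp T h1)))).contDiffWithinAt

lemma inner_pullbackTensor (K T : V →L[ℝ] V) (x y : V) :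
    inner ℝ (pullbackTensor K T x) y = |(1 + T).det| *
      inner ℝ (K (ContinuousLinearMap.adjoint (Ring.inverse (1 + T)) x))
        (ContinuousLinearMap.adjoint (Ring.inverse (1 + T)) y) := by
  simp only [pullbackTensor, smul_apply, real_inner_smul_left,
    ContinuousLinearMap.adjoint_inner_right]
  rfl

lemma adjoint_inverse_adjoint {T : V →L[ℝ] V} (hT : ‖T‖ < 1) (x : V) :
    ContinuousLinearMap.adjoint (Ring.inverse (1 + T)) (ContinuousLinearMap.adjoint (1 + T) x) =
      x := by
  have h : (1 + T) * Ring.inverse (1 + T) = 1 := Ring.mul_inverse_cancel _ (isUnit_one_add hT)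
  have h2 := congrArg (fun S : V →L[ℝ] V => ContinuousLinearMap.adjoint S x) h
  simp only [ContinuousLinearMap.mul_def, ContinuousLinearMap.adjoint_comp] at h2
  simpa [ContinuousLinearMap.one_def, ContinuousLinearMap.adjoint_id] using h2

lemma adjoint_adjoint_inverse {T : V →L[ℝ] V} (hT : ‖T‖ < 1) (x : V) :
    ContinuousLinearMap.adjoint (1 + T) (ContinuousLinearMap.adjoint (Ring.inverse (1 + T)) x) =
      x := by
  have h : Ring.inverse (1 + T) * (1 + T) = 1 := Ring.inverse_mul_cancel _ (isUnit_one_add hT)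
  have h2 := congrArg (fun S : V →L[ℝ] V => ContinuousLinearMap.adjoint S x) h
  simp only [ContinuousLinearMap.mul_def, ContinuousLinearMap.adjoint_comp] at h2
  simpa [ContinuousLinearMap.one_def, ContinuousLinearMap.adjoint_id] using h2

/-- The defining property of the pulled back tensor. -/
lemma inner_pullbackTensor_adjoint (K : V →L[ℝ] V) {T : V →L[ℝ] V} (hT : ‖T‖ < 1) (p q : V) :
    inner ℝ (pullbackTensor K T (ContinuousLinearMap.adjoint (1 + T) p))
      (ContinuousLinearMap.adjoint (1 + T) q) = |(1 + T).det| * inner ℝ (K p) q := by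
  rw [inner_pullbackTensor, adjoint_inverse_adjoint hT, adjoint_inverse_adjoint hT]

lemma inner_pullbackTensor_comm {K : V →L[ℝ] V} (hK : ∀ x y, inner ℝ (K x) y = inner ℝ x (K y))
    (T : V →L[ℝ] V) (x y : V) :
    inner ℝ (pullbackTensor K T x) y = inner ℝ x (pullbackTensor K T y) := by
  have h := inner_pullbackTensor K T y x
  rw [real_inner_comm] at h
  rw [h, inner_pullbackTensor, hK, real_inner_comm]

/-- The determinant is bounded away from zero on the compact ball. With `y = (1 + T)⁻ᵀ x` one has
`‖x‖ ≤ 2 ‖y‖`, whence the factor `κ / 4`. -/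
lemma exists_coercive_pullbackTensor {K : V →L[ℝ] V} {κ r : ℝ} (hκ : 0 < κ)
    (hK : ∀ x, κ * ‖x‖ ^ 2 ≤ inner ℝ (K x) x) (hr0 : 0 ≤ r) (hr : r < 1) :
    ∃ c > 0, ∀ T : V →L[ℝ] V, ‖T‖ ≤ r → ∀ x, c * ‖x‖ ^ 2 ≤ inner ℝ (pullbackTensor K T x) x := by
  have : ProperSpace (V →L[ℝ] V) := FiniteDimensional.proper ℝ _
  have hc : Continuous fun T : V →L[ℝ] V => |(1 + T).det| :=
    (contDiff_det.continuous.comp (by fun_prop : Continuous fun T : V →L[ℝ] V => 1 + T)).abs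
  obtain ⟨T₀, hT₀, hmin⟩ := (isCompact_closedBall (0 : V →L[ℝ] V) r).exists_isMinOn
    ⟨0, by simpa using hr0⟩ hc.continuousOn
  rw [mem_closedBall_zero_iff] at hT₀
  have hδ : 0 < |(1 + T₀).det| := abs_pos.2 (det_one_add_ne_zero (hT₀.trans_lt hr))
  refine ⟨|(1 + T₀).det| * (κ / 4), by positivity, fun T hT x => ?_⟩
  set y := ContinuousLinearMap.adjoint (Ring.inverse (1 + T)) x with hy
  have h1 : ‖x‖ ≤ 2 * ‖y‖ := by
    have h2 := adjoint_adjoint_inverse (hT.trans_lt hr) x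
    rw [← hy] at h2
    rw [← h2]
    refine ContinuousLinearMap.le_of_opNorm_le _ ?_ _
    rw [LinearIsometryEquiv.norm_map]
    refine (norm_add_le _ _).trans ?_
    have h3 : ‖(1 : V →L[ℝ] V)‖ ≤ 1 := ContinuousLinearMap.norm_id_le
    linarith
  rw [inner_pullbackTensor, ← hy, mul_assoc]
  refine mul_le_mul (hmin (by simpa using hT)) ((?_ : _ ≤ κ * ‖y‖ ^ 2).trans (hK y))
    (by positivity) (abs_nonneg _)
  nlinarith [mul_self_le_mul_self (norm_nonneg x) h1]

end Tensor

/-! ### Multiplication operators on `L²` -/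

section Multiplication

variable {α V : Type*} [MeasurableSpace α] {μ : Measure α} [NormedAddCommGroup V] [NormedSpace ℝ V]

lemma exists_mulOp {T : α → V →L[ℝ] V} (hT : AEStronglyMeasurable T μ) {C : ℝ}
    (hC : ∀ᵐ x ∂μ, ‖T x‖ ≤ C) :
    ∃ A : Lp V 2 μ →L[ℝ] Lp V 2 μ, ∀ f, A f =ᵐ[μ] fun x => T x (f x) := by
  have hm : MemLp T ∞ μ := memLp_top_of_bound hT C hC
  refine ⟨(ContinuousLinearMap.id ℝ (V →L[ℝ] V)).holderL μ ∞ 2 2 hm.toLp, fun f => ?_⟩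
  filter_upwards [ContinuousLinearMap.coeFn_holder (r := 2) (ContinuousLinearMap.id ℝ (V →L[ℝ] V))
    hm.toLp f, hm.coeFn_toLp] with x h1 h2
  rw [ContinuousLinearMap.holderL_apply_apply, h1, h2]
  rfl

lemma norm_mulOp_le {T : α → V →L[ℝ] V} {A : Lp V 2 μ →L[ℝ] Lp V 2 μ}
    (hA : ∀ f, A f =ᵐ[μ] fun x => T x (f x)) {C : ℝ} (hC0 : 0 ≤ C) (hC : ∀ x, ‖T x‖ ≤ C) :
    ‖A‖ ≤ C := by
  refine A.opNorm_le_bound hC0 fun f => Lp.norm_le_mul_norm_of_ae_le_mul ?_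
  filter_upwards [hA f] with x hx
  rw [hx]
  exact (T x).le_of_opNorm_le (hC x) _

end Multiplication

/-- The operators of multiplication by the coefficients pulled back along a family of
deformations satisfy uniform second order Taylor estimates. -/
theorem exists_pullback_operators {α V : Type*} [MeasurableSpace α] {μ : Measure α}
    [NormedAddCommGroup V] [InnerProductSpace ℝ V] [FiniteDimensional ℝ V]
    {K : V →L[ℝ] V} (hsymm : ∀ x y, inner ℝ (K x) y = inner ℝ x (K y)) {κ : ℝ} (hκ : 0 < κ)
    (hK : ∀ x, κ * ‖x‖ ^ 2 ≤ inner ℝ (K x) x) {B : α → V →L[ℝ] V} (hB : Measurable B) {L b : ℝ}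
    (hL0 : 0 ≤ L) (hL : ∀ x, ‖B x‖ ≤ L) (hbL : b * L ≤ 3 / 4) :
    ∃ (A A' : ℝ → Lp V 2 μ →L[ℝ] Lp V 2 μ) (c M : ℝ), 0 < c ∧
      (∀ h ∈ Icc (-b) b, ∀ f, A h f =ᵐ[μ] fun x => pullbackTensor K (h • B x) (f x)) ∧
      (∀ h ∈ Icc (-b) b, ∀ x, c * ‖x‖ ^ 2 ≤ inner ℝ (A h x) x) ∧
      (∀ h ∈ Icc (-b) b, ∀ x y, inner ℝ (A h x) y = inner ℝ x (A h y)) ∧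
      (∀ h ∈ Icc (-b) b, ‖A h‖ ≤ M) ∧ (∀ h ∈ Icc (-b) b, ‖A' h‖ ≤ M) ∧
      (∀ h ∈ Icc (-b) b, ∀ k ∈ Icc (-b) b, ‖A h - A k‖ ≤ M * |h - k|) ∧
      (∀ h ∈ Icc (-b) b, ∀ k ∈ Icc (-b) b,
        ‖A h - A k - (h - k) • A' k‖ ≤ M * (h - k) ^ 2) := by
  have : ProperSpace (V →L[ℝ] V) := FiniteDimensional.proper ℝ _
  set S : Set (V →L[ℝ] V) := closedBall 0 (3 / 4) with hS
  have hSU : S ⊆ ball 0 1 := closedBall_subset_ball (by norm_num)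
  have hcd := contDiffOn_pullbackTensor K
  obtain ⟨C, hC0, h0, h1, h2, h3⟩ := exists_taylor_of_contDiffOn isOpen_ball
    (hcd.of_le (by norm_cast)) hSU (isCompact_closedBall _ _) (convex_closedBall _ _)
  obtain ⟨c, hc, hcoer⟩ := exists_coercive_pullbackTensor hκ hK (r := 3 / 4) (by norm_num)
    (by norm_num)
  have hmem : ∀ h ∈ Icc (-b) b, ∀ x, h • B x ∈ S := by
    intro h hh x
    rw [hS, mem_closedBall_zero_iff, norm_smul, Real.norm_eq_abs]
    refine le_trans (mul_le_mul (abs_le.2 hh) (hL x) (norm_nonneg _) ?_) hbL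
    linarith [hh.1, hh.2]
  have hmA : ∀ h ∈ Icc (-b) b, AEStronglyMeasurable (fun x => pullbackTensor K (h • B x)) μ := by
    intro h hh
    -- Continuity of the tensor is known only on the ball, so measurability is obtained by factoring
    -- through the subtype of `S`.
    have h4 := (continuousOn_iff_continuous_domRestrict.1 (hcd.continuousOn.mono hSU)).measurable.comp
      ((hB.const_smul h).subtype_mk (h := hmem h hh))
    exact h4.aestronglyMeasurable
  have hmA' : ∀ h ∈ Icc (-b) b,
      AEStronglyMeasurable (fun x => fderiv ℝ (pullbackTensor K) (h • B x) (B x)) μ := by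
    intro h hh
    exact (ContinuousLinearMap.id ℝ ((V →L[ℝ] V) →L[ℝ] (V →L[ℝ] V))).aestronglyMeasurable_comp₂
      ((measurable_fderiv ℝ _).comp (hB.const_smul h)).aestronglyMeasurable
      hB.aestronglyMeasurable
  have hbA' : ∀ h ∈ Icc (-b) b, ∀ x, ‖fderiv ℝ (pullbackTensor K) (h • B x) (B x)‖ ≤ C * L :=
    fun h hh x => ((fderiv ℝ (pullbackTensor K) (h • B x)).le_opNorm _).trans
      (mul_le_mul (h1 _ (hmem h hh x)) (hL x) (norm_nonneg _) hC0)
  choose! A hA using fun h (hh : h ∈ Icc (-b) b) => exists_mulOp (hmA h hh)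
    (.of_forall fun x => h0 _ (hmem h hh x))
  choose! A' hA' using fun h (hh : h ∈ Icc (-b) b) => exists_mulOp (hmA' h hh)
    (.of_forall fun x => hbA' h hh x)
  set M := C + C * L + C * L ^ 2 with hM
  have hM1 : C ≤ M := by rw [hM]; nlinarith [mul_nonneg hC0 hL0, mul_nonneg hC0 (sq_nonneg L)]
  have hM2 : C * L ≤ M := by rw [hM]; nlinarith [mul_nonneg hC0 (sq_nonneg L)]
  have hM3 : C * L ^ 2 ≤ M := by rw [hM]; nlinarith [mul_nonneg hC0 hL0]
  refine ⟨A, A', c, M, hc, hA, fun h hh f => ?_, fun h hh f g => ?_, fun h hh => ?_,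
    fun h hh => ?_, fun h hh k hk => ?_, fun h hh k hk => ?_⟩
  · rw [← real_inner_self_eq_norm_sq, L2.inner_def, L2.inner_def, ← integral_const_mul]
    refine integral_mono_ae ((L2.integrable_inner f f).const_mul c) (L2.integrable_inner _ _) ?_
    filter_upwards [hA h hh f] with x hx
    rw [hx, real_inner_self_eq_norm_sq]
    exact hcoer _ (by simpa [hS] using hmem h hh x) _
  · rw [L2.inner_def, L2.inner_def]
    refine integral_congr_ae ?_
    filter_upwards [hA h hh f, hA h hh g] with x hx hy
    rw [hx, hy, inner_pullbackTensor_comm hsymm]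
  · exact (norm_mulOp_le (hA h hh) hC0 fun x => h0 _ (hmem h hh x)).trans hM1
  · exact (norm_mulOp_le (hA' h hh) (mul_nonneg hC0 hL0) (hbA' h hh)).trans hM2
  · refine (norm_mulOp_le (T := fun x => pullbackTensor K (h • B x) - pullbackTensor K (k • B x))
      (fun f => ?_) (C := C * L * |h - k|) (by positivity) fun x => ?_).trans (by gcongr)
    · rw [sub_apply]
      filter_upwards [Lp.coeFn_sub (A h f) (A k f), hA h hh f, hA k hk f] with x e1 e2 e3
      rw [e1, Pi.sub_apply, e2, e3, sub_apply]
    · refine (h2 _ (hmem k hk x) _ (hmem h hh x)).trans ?_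
      rw [← sub_smul, norm_smul, Real.norm_eq_abs]
      calc C * (|h - k| * ‖B x‖) ≤ C * (|h - k| * L) := by gcongr; exact hL x
        _ = _ := by ring
  · refine (norm_mulOp_le (T := fun x => pullbackTensor K (h • B x) - pullbackTensor K (k • B x) -
      (h - k) • fderiv ℝ (pullbackTensor K) (k • B x) (B x))
      (fun f => ?_) (C := C * L ^ 2 * (h - k) ^ 2) (by positivity) fun x => ?_).trans (by gcongr)
    · rw [sub_apply, sub_apply, smul_apply]
      filter_upwards [Lp.coeFn_sub (A h f - A k f) ((h - k) • A' k f),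
        Lp.coeFn_sub (A h f) (A k f), Lp.coeFn_smul (h - k) (A' k f), hA h hh f, hA k hk f,
        hA' k hk f] with x e1 e2 e3 e4 e5 e6
      rw [e1, Pi.sub_apply, e2, e3, Pi.sub_apply, Pi.smul_apply, e4, e5, e6]
      rfl
    · rw [← map_smul, sub_smul]
      refine (h3 _ (hmem k hk x) _ (hmem h hh x)).trans ?_
      rw [← sub_smul, norm_smul, Real.norm_eq_abs, mul_pow, sq_abs]
      calc C * ((h - k) ^ 2 * ‖B x‖ ^ 2) ≤ C * ((h - k) ^ 2 * L ^ 2) := by gcongr; exact hL x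
        _ = _ := by ring

/-! ### Transport of the cell problems to the reference cell -/

namespace IsCellDeformation

variable {P Q : Set (EuclideanSpace ℝ (Fin d))}
  {f : EuclideanSpace ℝ (Fin d) ≃ₜ EuclideanSpace ℝ (Fin d)} {L : ℝ≥0}

lemma ae_comp (h : IsCellDeformation P Q f L) {p : EuclideanSpace ℝ (Fin d) → Prop}
    (hp : ∀ᵐ y, p y) : ∀ᵐ x, p (f x) := by
  rw [ae_iff] at hp ⊢
  refine le_antisymm ((volume_preimage_le h.antilipschitz {y | ¬ p y}).trans ?_) zero_le
  rw [hp, mul_zero]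

/-- Change of variables. -/
lemma setIntegral_eq (h : IsCellDeformation P Q f L) (hP : IsOpen P)
    (F : EuclideanSpace ℝ (Fin d) → ℝ) :
    ∫ y in unitCell d \ Q, F y = ∫ x in unitCell d \ P, |(fderiv ℝ f x).det| * F (f x) := by
  -- The area formula needs a derivative at every point, so it is applied on `D`. Both `D` and its
  -- image have full measure, the latter because the inverse of `f` is again anti-Lipschitz.
  set D := {x | DifferentiableAt ℝ f x} with hD
  have hDm : MeasurableSet D := measurableSet_of_differentiableAt ℝ f
  have hDae : ∀ᵐ x, x ∈ D := h.lipschitz.ae_differentiableAt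
  have hPm : MeasurableSet (unitCell d \ P) := isOpen_unitCell.measurableSet.diff hP.measurableSet
  have h1 := integral_image_eq_integral_abs_det_fderiv_smul volume (hPm.inter hDm)
    (f := f) (f' := fderiv ℝ f) (fun x hx => (DifferentiableAt.hasFDerivAt hx.2).hasFDerivWithinAt)
    f.injective.injOn F
  have h2 : (f '' ((unitCell d \ P) ∩ D) : Set (EuclideanSpace ℝ (Fin d))) =ᵐ[volume]
      (unitCell d \ Q : Set (EuclideanSpace ℝ (Fin d))) := by
    filter_upwards [h.symm.ae_comp hDae] with y hy
    refine propext ⟨?_, fun hyQ => ⟨f.symm y, ⟨h.symm.mapsTo hyQ, hy⟩, f.apply_symm_apply y⟩⟩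
    rintro ⟨x, hx, rfl⟩
    exact h.mapsTo hx.1
  have h3 : ((unitCell d \ P) ∩ D : Set (EuclideanSpace ℝ (Fin d))) =ᵐ[volume]
      (unitCell d \ P : Set (EuclideanSpace ℝ (Fin d))) := by
    filter_upwards [hDae] with x hx
    exact propext ⟨fun h => h.1, fun h => ⟨h, hx⟩⟩
  rw [setIntegral_congr_set h2, setIntegral_congr_set h3] at h1
  exact h1

/-- The chain rule for `f.symm ∘ f = id` holds where `f` is differentiable at `x` and `f.symm` at `f
x`; both fail only on null sets. -/
lemma ae_adjoint_fderiv_symm (h : IsCellDeformation P Q f L)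
    (g : EuclideanSpace ℝ (Fin d) → EuclideanSpace ℝ (Fin d)) :
    ∀ᵐ x, pullbackGrad f (pullbackGrad f.symm g) x = g x := by
  filter_upwards [h.lipschitz.ae_differentiableAt,
    h.ae_comp h.lipschitz_symm.ae_differentiableAt] with x hx hy
  have h1 := (hy.hasFDerivAt.comp x hx.hasFDerivAt)
  rw [show f.symm ∘ f = id from funext f.symm_apply_apply] at h1
  have h2 := h1.unique (hasFDerivAt_id x)
  rw [pullbackGrad, pullbackGrad, f.symm_apply_apply, ← ContinuousLinearMap.comp_apply,
    ← ContinuousLinearMap.adjoint_comp, h2, ContinuousLinearMap.adjoint_id]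
  rfl

end IsCellDeformation

instance (P : Set (EuclideanSpace ℝ (Fin d))) : IsFiniteMeasure (cellMeasure P) :=
  ⟨by
    rw [Measure.restrict_apply_univ]
    exact (measure_mono (sdiff_subset.trans unitCell_subset_closedCell)).trans_lt
      isCompact_closedCell.measure_lt_top⟩

/-- A constant vector field on the perforated cell. -/
def constField (P : Set (EuclideanSpace ℝ (Fin d))) (c : EuclideanSpace ℝ (Fin d)) :
    Lp (EuclideanSpace ℝ (Fin d)) 2 (cellMeasure P) :=
  (memLp_const c).toLp (fun _ => c)

lemma coeFn_constField (P : Set (EuclideanSpace ℝ (Fin d))) (c : EuclideanSpace ℝ (Fin d)) :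
    constField P c =ᵐ[cellMeasure P] fun _ => c := MemLp.coeFn_toLp _

/-- Lipschitz functions have their almost everywhere derivative as weak gradient. With `X` the
deformation field this makes `(Df_h)ᵀ c - c = h ∇(c · X)` an admissible gradient. -/
lemma isPeriodicSobolev_inner {X : EuclideanSpace ℝ (Fin d) → EuclideanSpace ℝ (Fin d)}
    {L : ℝ≥0} (hX : LipschitzWith L X) (hper : IsCellPeriodic X) {M : ℝ} (hM : ∀ x, ‖X x‖ ≤ M)
    (P : Set (EuclideanSpace ℝ (Fin d))) (c : EuclideanSpace ℝ (Fin d)) :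
    IsPeriodicSobolev P (fun x => inner ℝ c (X x))
      (fun x => ContinuousLinearMap.adjoint (fderiv ℝ X x) c) where
  periodic k x := by simp only [hper k x]
  periodic_grad k x := by
    have : fderiv ℝ X (x + latticePoint k) = fderiv ℝ X x := by
      rw [← fderiv_comp_add_right, show (fun y => X (y + latticePoint k)) = X from funext (hper k)]
    simp only [this]
  memLp := by
    have hc : Continuous fun x => inner ℝ c (X x) := continuous_const.inner hX.continuous
    exact MemLp.of_bound hc.aestronglyMeasurable (‖c‖ * M) (.of_forall fun x =>
      (norm_inner_le_norm _ _).trans (by gcongr; exact hM x))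
  memLp_grad := memLp_adjoint_fderiv_apply hX (memLp_const c)
  weak_grad φ hφ hφs _ i := by
    set e : EuclideanSpace ℝ (Fin d) := EuclideanSpace.single i 1 with he
    have hlip : LipschitzWith (‖c‖₊ * L) fun x => inner ℝ c (X x) := by
      refine LipschitzWith.of_dist_le_mul fun x y => ?_
      rw [Real.dist_eq, ← inner_sub_right]
      refine (abs_real_inner_le_norm _ _).trans ?_
      push_cast
      rw [mul_assoc, ← dist_eq_norm]
      gcongr
      exact hX.dist_le_mul x y
    obtain ⟨D, hD⟩ := (hφ.of_le (m := 1) (by norm_cast)).lipschitzWith_of_hasCompactSupport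
      hφs one_ne_zero
    have h0 := LipschitzWith.integral_lineDeriv_mul_eq (μ := volume) hlip hD hφs e
    have h1 : ∫ y, (ContinuousLinearMap.adjoint (fderiv ℝ X y) c) i * φ y =
        ∫ y, lineDeriv ℝ (fun x => inner ℝ c (X x)) y e * φ y := by
      refine integral_congr_ae ?_
      filter_upwards [hX.ae_differentiableAt (μ := volume)] with x hx
      have h2 : HasFDerivAt (fun x => inner ℝ c (X x)) ((innerSL ℝ c).comp (fderiv ℝ X x)) x :=
        (innerSL ℝ c).hasFDerivAt.comp x hx.hasFDerivAt
      have h3 : (ContinuousLinearMap.adjoint (fderiv ℝ X x) c) i =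
          inner ℝ (ContinuousLinearMap.adjoint (fderiv ℝ X x) c) e := by
        simp [he, EuclideanSpace.inner_single_right]
      rw [h2.differentiableAt.lineDeriv_eq_fderiv, h2.fderiv, h3,
        ContinuousLinearMap.adjoint_inner_left]
      rfl
    rw [h1, h0, ← integral_neg]
    refine integral_congr_ae (.of_forall fun x => ?_)
    have hφd : DifferentiableAt ℝ φ x := hφ.differentiable (by norm_num) x
    simp only [hφd.lineDeriv_eq_fderiv, map_neg]
    ring

namespace DeformationField

variable {P : ℝ → Set (EuclideanSpace ℝ (Fin d))} {b : ℝ}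
  {X : EuclideanSpace ℝ (Fin d) → EuclideanSpace ℝ (Fin d)} {L : ℝ≥0}
  {f : EuclideanSpace ℝ (Fin d) ≃ₜ EuclideanSpace ℝ (Fin d)} {h : ℝ}

lemma ae_fderiv_eq (hX : DeformationField P b X L) (hf : ∀ x, f x = x + h • X x) :
    ∀ᵐ x, fderiv ℝ f x = 1 + h • fderiv ℝ X x := by
  filter_upwards [hX.lipschitz.ae_differentiableAt (μ := volume)] with x hx
  rw [show (f : EuclideanSpace ℝ (Fin d) → EuclideanSpace ℝ (Fin d)) = fun x => x + h • X x from
    funext hf]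
  exact ((hasFDerivAt_id x).add (hx.hasFDerivAt.const_smul h)).fderiv

/-- The gradients of the components of the deformation field are admissible. -/
lemma exists_mem_gradientSpace (hX : DeformationField P b X L) (c : EuclideanSpace ℝ (Fin d)) :
    ∃ G ∈ gradientSpace hX.isOpen_zero,
      G =ᵐ[cellMeasure (P 0)] fun x => ContinuousLinearMap.adjoint (fderiv ℝ X x) c := by
  have h1 := isPeriodicSobolev_inner hX.lipschitz hX.periodic hX.bounded (P 0) c
  exact ⟨h1.memLp_grad.toLp, (mem_gradientSpace_iff _ _).2 ⟨_, _, h1, h1.memLp_grad.coeFn_toLp⟩,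
    h1.memLp_grad.coeFn_toLp⟩

/-- The affine space `c + V` in which the transported field lies is independent of `h`: the part of
`(Df)ᵀ c` that varies with `h` is a periodic gradient and is absorbed into `V`. -/
lemma exists_pullback_field (hX : DeformationField P b X L) (hh : |h| ≤ b)
    (hf : ∀ x, f x = x + h • X x) (hfd : IsCellDeformation (P 0) (P h) f 4)
    {u : EuclideanSpace ℝ (Fin d) → ℝ} {g : EuclideanSpace ℝ (Fin d) → EuclideanSpace ℝ (Fin d)}
    (hu : IsPeriodicSobolev (P h) u g) (c : EuclideanSpace ℝ (Fin d)) :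
    ∃ G : Lp (EuclideanSpace ℝ (Fin d)) 2 (cellMeasure (P 0)),
      G - constField (P 0) c ∈ gradientSpace hX.isOpen_zero ∧
      G =ᵐ[cellMeasure (P 0)] fun x => ContinuousLinearMap.adjoint (fderiv ℝ f x) (g (f x) + c) := by
  have h1 := hfd.isPeriodicSobolev_comp (hX.subset_cell h hh) hu
  obtain ⟨G₂, hG₂, hG₂'⟩ := hX.exists_mem_gradientSpace c
  refine ⟨h1.memLp_grad.toLp + h • G₂ + constField (P 0) c, ?_, ?_⟩
  · rw [add_sub_cancel_right]
    exact Submodule.add_mem _ ((mem_gradientSpace_iff _ _).2 ⟨_, _, h1, h1.memLp_grad.coeFn_toLp⟩)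
      (Submodule.smul_mem _ _ hG₂)
  · filter_upwards [Lp.coeFn_add (h1.memLp_grad.toLp + h • G₂) (constField (P 0) c),
      Lp.coeFn_add h1.memLp_grad.toLp (h • G₂), Lp.coeFn_smul h G₂, h1.memLp_grad.coeFn_toLp,
      coeFn_constField (P 0) c, hG₂', ae_restrict_of_ae (hX.ae_fderiv_eq hf)]
      with x e1 e2 e3 e4 e5 e6 e7
    rw [e1, Pi.add_apply, e2, Pi.add_apply, e3, Pi.smul_apply, e4, e5, e6, map_add, pullbackGrad,
      add_assoc]
    congr 1
    rw [e7, map_add, map_smulₛₗ]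
    simp [ContinuousLinearMap.one_def, ContinuousLinearMap.adjoint_id, add_comm]

/-- Inverse of the previous transport: subtract `c` and the correction `h ∇(c · X)`, then compose
the remaining gradient with `f.symm`. Taking `c = 0` shows that every element of `V` comes from a
test function on the deformed cell. -/
lemma exists_pushforward_field (hX : DeformationField P b X L)
    (hf : ∀ x, f x = x + h • X x) (hfd : IsCellDeformation (P 0) (P h) f 4)
    {c : EuclideanSpace ℝ (Fin d)} {G : Lp (EuclideanSpace ℝ (Fin d)) 2 (cellMeasure (P 0))}
    (hG : G - constField (P 0) c ∈ gradientSpace hX.isOpen_zero) :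
    ∃ u g, IsPeriodicSobolev (P h) u g ∧
      G =ᵐ[cellMeasure (P 0)] fun x => ContinuousLinearMap.adjoint (fderiv ℝ f x) (g (f x) + c) := by
  obtain ⟨G₂, hG₂, hG₂'⟩ := hX.exists_mem_gradientSpace c
  obtain ⟨u, g, hu, hg⟩ := (mem_gradientSpace_iff _ _).1
    (Submodule.sub_mem _ hG (Submodule.smul_mem _ h hG₂))
  refine ⟨_, _, hfd.symm.isPeriodicSobolev_comp
    (hX.subset_cell 0 (by rw [abs_zero]; exact hX.pos.le)) hu, ?_⟩
  filter_upwards [hg, Lp.coeFn_sub (G - constField (P 0) c) (h • G₂),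
    Lp.coeFn_sub G (constField (P 0) c), Lp.coeFn_smul h G₂, coeFn_constField (P 0) c, hG₂',
    ae_restrict_of_ae (hX.ae_fderiv_eq hf), ae_restrict_of_ae (hfd.ae_adjoint_fderiv_symm g)]
    with x e1 e2 e3 e4 e5 e6 e7 e8
  rw [e2, Pi.sub_apply, e3, Pi.sub_apply, e4, Pi.smul_apply, e5, e6] at e1
  rw [map_add]
  have e9 : ContinuousLinearMap.adjoint (fderiv ℝ f x) (pullbackGrad f.symm g (f x)) = g x := e8
  have e10 : ContinuousLinearMap.adjoint (fderiv ℝ f x) c =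
      c + h • ContinuousLinearMap.adjoint (fderiv ℝ X x) c := by
    rw [e7, map_add, map_smulₛₗ]
    simp [ContinuousLinearMap.one_def, ContinuousLinearMap.adjoint_id]
  rw [e9, e10, ← e1]
  abel

/-- The pulled back tensor is defined so that the Jacobian and the two factors `(Df)ᵀ` cancel under
the change of variables. -/
lemma setIntegral_inner_eq (hX : DeformationField P b X L) (hh : |h| ≤ b)
    (hf : ∀ x, f x = x + h • X x) (hfd : IsCellDeformation (P 0) (P h) f 4)
    {K : EuclideanSpace ℝ (Fin d) →L[ℝ] EuclideanSpace ℝ (Fin d)}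
    {A : Lp (EuclideanSpace ℝ (Fin d)) 2 (cellMeasure (P 0)) →L[ℝ]
      Lp (EuclideanSpace ℝ (Fin d)) 2 (cellMeasure (P 0))}
    (hA : ∀ G, A G =ᵐ[cellMeasure (P 0)] fun x => pullbackTensor K (h • fderiv ℝ X x) (G x))
    {v w : EuclideanSpace ℝ (Fin d) → EuclideanSpace ℝ (Fin d)}
    {G G' : Lp (EuclideanSpace ℝ (Fin d)) 2 (cellMeasure (P 0))}
    (hG : G =ᵐ[cellMeasure (P 0)] fun x => ContinuousLinearMap.adjoint (fderiv ℝ f x) (v (f x)))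
    (hG' : G' =ᵐ[cellMeasure (P 0)] fun x => ContinuousLinearMap.adjoint (fderiv ℝ f x) (w (f x))) :
    ∫ y in unitCell d \ P h, inner ℝ (K (v y)) (w y) = inner ℝ (A G) G' := by
  rw [hfd.setIntegral_eq hX.isOpen_zero, L2.inner_def]
  refine integral_congr_ae ?_
  filter_upwards [hA G, hG, hG', ae_restrict_of_ae (hX.ae_fderiv_eq hf)] with x e1 e2 e3 e4
  have hn : ‖h • fderiv ℝ X x‖ < 1 := by
    rw [norm_smul, Real.norm_eq_abs]
    calc |h| * ‖fderiv ℝ X x‖ ≤ b * L :=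
          mul_le_mul hh (norm_fderiv_le_of_lipschitz ℝ hX.lipschitz) (norm_nonneg _) hX.pos.le
      _ ≤ 3 / 4 := hX.small
      _ < 1 := by norm_num
  rw [e1, e2, e3, e4, inner_pullbackTensor_adjoint K hn]

end DeformationField

lemma frobenius_norm_le_of_forall_le {M : Matrix (Fin d) (Fin d) ℝ} {D : ℝ} (hD : 0 ≤ D)
    (h : ∀ i j, |M i j| ≤ D) : ‖M‖ ≤ d * D := by
  rw [Matrix.frobenius_norm_def, ← Real.sqrt_eq_rpow]
  refine Real.sqrt_le_iff.2 ⟨by positivity, ?_⟩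
  calc ∑ i, ∑ j, ‖M i j‖ ^ (2 : ℝ) ≤ ∑ _i : Fin d, ∑ _j : Fin d, D ^ 2 := by
        refine Finset.sum_le_sum fun i _ => Finset.sum_le_sum fun j _ => ?_
        rw [Real.rpow_two]
        exact pow_le_pow_left₀ (norm_nonneg _) (h i j) 2
    _ = _ := by simp; ring

lemma exists_coercive_of_posDef {𝒦 : Matrix (Fin d) (Fin d) ℝ} (h𝒦 : 𝒦.PosDef) :
    ∃ κ > 0, ∀ x, κ * ‖x‖ ^ 2 ≤ inner ℝ (Matrix.toEuclideanCLM (𝕜 := ℝ) 𝒦 x) x := by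
  set K := Matrix.toEuclideanCLM (𝕜 := ℝ) 𝒦 with hK
  have hpos : ∀ x, x ≠ 0 → 0 < inner ℝ (K x) x := by
    intro x hx
    rw [real_inner_comm, hK, Matrix.inner_toEuclideanCLM]
    have := h𝒦.dotProduct_mulVec_pos (x := x.ofLp) (by simpa using hx)
    simpa using this
  rcases subsingleton_or_nontrivial (EuclideanSpace ℝ (Fin d)) with hs | hs
  · refine ⟨1, one_pos, fun x => ?_⟩
    rw [Subsingleton.elim x 0]
    simp
  have hc : Continuous fun x => inner ℝ (K x) x := K.continuous.inner continuous_id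
  obtain ⟨z, hz, hmin⟩ := (isCompact_sphere (0 : EuclideanSpace ℝ (Fin d)) 1).exists_isMinOn
    (NormedSpace.sphere_nonempty.2 zero_le_one) hc.continuousOn
  have hz0 : z ≠ 0 := ne_zero_of_mem_unit_sphere ⟨z, hz⟩
  refine ⟨_, hpos z hz0, fun x => ?_⟩
  rcases eq_or_ne x 0 with rfl | hx
  · simp
  have hx' : 0 < ‖x‖ := norm_pos_iff.2 hx
  have h1 : inner ℝ (K z) z ≤ inner ℝ (K (‖x‖⁻¹ • x)) (‖x‖⁻¹ • x) := hmin (by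
    rw [mem_sphere_zero_iff_norm, norm_smul, norm_inv, norm_norm, inv_mul_cancel₀ hx'.ne'])
  rw [map_smul, real_inner_smul_left, real_inner_smul_right] at h1
  calc _ ≤ (‖x‖⁻¹ * (‖x‖⁻¹ * inner ℝ (K x) x)) * ‖x‖ ^ 2 := by gcongr
    _ = _ := by field_simp

/-- The definition picks some solutions; a value common to all solutions makes that choice
irrelevant. -/
lemma effectiveConductivity_eq {𝒦 : Matrix (Fin d) (Fin d) ℝ}
    {Q : Set (EuclideanSpace ℝ (Fin d))} {S : Matrix (Fin d) (Fin d) ℝ}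
    (hex : ∀ j, ∃ ξ g, IsCellSolution 𝒦 Q j ξ g)
    (h : ∀ (ξ : Fin d → EuclideanSpace ℝ (Fin d) → ℝ)
      (g : Fin d → EuclideanSpace ℝ (Fin d) → EuclideanSpace ℝ (Fin d)),
      (∀ j, IsCellSolution 𝒦 Q j (ξ j) (g j)) → conductivityMatrix 𝒦 Q g = S) :
    effectiveConductivity 𝒦 Q = S := by
  choose ξ g hξ using hex
  have H : ∃ (ξ : Fin d → EuclideanSpace ℝ (Fin d) → ℝ)
      (g : Fin d → EuclideanSpace ℝ (Fin d) → EuclideanSpace ℝ (Fin d)),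
      ∀ j, IsCellSolution 𝒦 Q j (ξ j) (g j) := ⟨ξ, g, hξ⟩
  rw [effectiveConductivity, dif_pos H]
  exact h _ _ H.choose_spec.choose_spec

lemma IsEquilibrium.eq {H : Type*} [NormedAddCommGroup H] [InnerProductSpace ℝ H] {A : H →L[ℝ] H}
    {V : Submodule ℝ H} {e G G' : H} {c : ℝ} (hc : 0 < c)
    (hA : ∀ x, c * ‖x‖ ^ 2 ≤ inner ℝ (A x) x) (hG : IsEquilibrium A V e G)
    (hG' : IsEquilibrium A V e G') : G = G' := by
  have := hG.norm_sub_le hG' hc hA (δ := 0) (by simp)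
  rw [zero_mul, zero_div] at this
  exact sub_eq_zero.1 (norm_le_zero_iff.1 this)

/-! ### Solvability and Taylor estimate for the effective conductivity -/

namespace DeformationField

variable {P : ℝ → Set (EuclideanSpace ℝ (Fin d))} {b : ℝ}
  {X : EuclideanSpace ℝ (Fin d) → EuclideanSpace ℝ (Fin d)} {L : ℝ≥0} {h : ℝ}
  {𝒦 : Matrix (Fin d) (Fin d) ℝ}
  {A : Lp (EuclideanSpace ℝ (Fin d)) 2 (cellMeasure (P 0)) →L[ℝ]
    Lp (EuclideanSpace ℝ (Fin d)) 2 (cellMeasure (P 0))}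

lemma setIntegral_inner_toEuclideanLin_eq (hX : DeformationField P b X L) (hh : |h| ≤ b)
    {f : EuclideanSpace ℝ (Fin d) ≃ₜ EuclideanSpace ℝ (Fin d)}
    (hf : ∀ x, f x = x + h • X x) (hfd : IsCellDeformation (P 0) (P h) f 4)
    (hA : ∀ G, A G =ᵐ[cellMeasure (P 0)] fun x =>
      pullbackTensor (Matrix.toEuclideanCLM (𝕜 := ℝ) 𝒦) (h • fderiv ℝ X x) (G x))
    {g w : EuclideanSpace ℝ (Fin d) → EuclideanSpace ℝ (Fin d)} {c c' : EuclideanSpace ℝ (Fin d)}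
    {G G' : Lp (EuclideanSpace ℝ (Fin d)) 2 (cellMeasure (P 0))}
    (hG : G =ᵐ[cellMeasure (P 0)] fun x =>
      ContinuousLinearMap.adjoint (fderiv ℝ f x) (g (f x) + c))
    (hG' : G' =ᵐ[cellMeasure (P 0)] fun x =>
      ContinuousLinearMap.adjoint (fderiv ℝ f x) (w (f x) + c')) :
    ∫ y in unitCell d \ P h, inner ℝ (𝒦.toEuclideanLin (g y + c)) (w y + c') =
      inner ℝ (A G) G' := by
  rw [← hX.setIntegral_inner_eq hh hf hfd hA (v := fun y => g y + c) (w := fun y => w y + c')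
    hG hG']
  rfl

lemma constField_zero (P : Set (EuclideanSpace ℝ (Fin d))) : constField P 0 = 0 :=
  MemLp.toLp_zero _

/-- Equilibria on the reference cell are transported to solutions of the cell problems. -/
lemma exists_isCellSolution (hX : DeformationField P b X L) (hh : |h| ≤ b)
    (hA : ∀ G, A G =ᵐ[cellMeasure (P 0)] fun x =>
      pullbackTensor (Matrix.toEuclideanCLM (𝕜 := ℝ) 𝒦) (h • fderiv ℝ X x) (G x))
    {j : Fin d} {G : Lp (EuclideanSpace ℝ (Fin d)) 2 (cellMeasure (P 0))}
    (hG : IsEquilibrium A (gradientSpace hX.isOpen_zero)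
      (constField (P 0) (EuclideanSpace.single j 1)) G) :
    ∃ ξ g, IsCellSolution 𝒦 (P h) j ξ g := by
  obtain ⟨f, hf, hfd⟩ := hX.exists_isCellDeformation hh
  obtain ⟨ξ, g, hξ, hg⟩ := hX.exists_pushforward_field hf hfd hG.1
  refine ⟨ξ, g, hξ, fun φ w hφ => ?_⟩
  obtain ⟨W, hW, hw⟩ := hX.exists_pullback_field hh hf hfd hφ 0
  have hW' : W ∈ gradientSpace hX.isOpen_zero := by
    rwa [constField_zero, sub_zero] at hW
  have h1 := hX.setIntegral_inner_toEuclideanLin_eq hh hf hfd hA hg hw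
  simp only [add_zero] at h1
  rw [h1, hG.2 W hW']

/-- The conductivity of the perforated cell is the energy of equilibria on the reference cell. -/
lemma conductivityMatrix_eq (hX : DeformationField P b X L) (hh : |h| ≤ b)
    (hA : ∀ G, A G =ᵐ[cellMeasure (P 0)] fun x =>
      pullbackTensor (Matrix.toEuclideanCLM (𝕜 := ℝ) 𝒦) (h • fderiv ℝ X x) (G x))
    {c : ℝ} (hc : 0 < c) (hcoer : ∀ x, c * ‖x‖ ^ 2 ≤ inner ℝ (A x) x)
    {G : Fin d → Lp (EuclideanSpace ℝ (Fin d)) 2 (cellMeasure (P 0))}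
    (hG : ∀ j, IsEquilibrium A (gradientSpace hX.isOpen_zero)
      (constField (P 0) (EuclideanSpace.single j 1)) (G j))
    {ξ : Fin d → EuclideanSpace ℝ (Fin d) → ℝ}
    {g : Fin d → EuclideanSpace ℝ (Fin d) → EuclideanSpace ℝ (Fin d)}
    (hξ : ∀ j, IsCellSolution 𝒦 (P h) j (ξ j) (g j)) :
    conductivityMatrix 𝒦 (P h) g = Matrix.of fun i j => inner ℝ (A (G j)) (G i) := by
  obtain ⟨f, hf, hfd⟩ := hX.exists_isCellDeformation hh
  have key : ∀ j, G j =ᵐ[cellMeasure (P 0)] fun x =>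
      ContinuousLinearMap.adjoint (fderiv ℝ f x) (g j (f x) + EuclideanSpace.single j 1) := by
    intro j
    obtain ⟨G', hG', hg'⟩ := hX.exists_pullback_field hh hf hfd (hξ j).1 (EuclideanSpace.single j 1)
    -- Any solution of the cell problem pulls back to an equilibrium, and equilibria are unique by
    -- coercivity. Hence the conductivity does not depend on the solutions.
    have heq : IsEquilibrium A (gradientSpace hX.isOpen_zero)
        (constField (P 0) (EuclideanSpace.single j 1)) G' := by
      refine ⟨hG', fun W hW => ?_⟩
      obtain ⟨φ, w, hφ, hw⟩ := hX.exists_pushforward_field hf hfd (c := 0) (G := W)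
        (by rwa [constField_zero, sub_zero])
      have h1 := hX.setIntegral_inner_toEuclideanLin_eq hh hf hfd hA hg' hw
      simp only [add_zero] at h1
      rw [← h1, (hξ j).2 φ w hφ]
    rwa [(hG j).eq hc hcoer heq]
  ext i j
  exact hX.setIntegral_inner_toEuclideanLin_eq hh hf hfd hA (key j) (key i)

/-- Cell problems on a deformed family of perforated cells: solvability, uniqueness of the
effective conductivity, and its dependence on the parameter up to second order. -/
theorem exists_conductivity_taylor (hX : DeformationField P b X L) (h𝒦 : 𝒦.PosDef) :
    (∀ h ∈ Icc (-b) b, ∀ j, ∃ ξ g, IsCellSolution 𝒦 (P h) j ξ g) ∧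
    (∀ h ∈ Icc (-b) b, ∀ (ξ : Fin d → EuclideanSpace ℝ (Fin d) → ℝ)
      (g : Fin d → EuclideanSpace ℝ (Fin d) → EuclideanSpace ℝ (Fin d)), (∀ j, IsCellSolution 𝒦 (P h) j (ξ j) (g j)) →
      effectiveConductivity 𝒦 (P h) = conductivityMatrix 𝒦 (P h) g) ∧
    ∃ (K' : ℝ → Matrix (Fin d) (Fin d) ℝ) (C : ℝ), ∀ h ∈ Icc (-b) b, ∀ k ∈ Icc (-b) b,
      ‖effectiveConductivity 𝒦 (P h) - effectiveConductivity 𝒦 (P k) - (h - k) • K' k‖ ≤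
        C * (h - k) ^ 2 := by
  obtain ⟨κ, hκ, hcoer𝒦⟩ := exists_coercive_of_posDef h𝒦
  have hsymm𝒦 : ∀ x y, inner ℝ (Matrix.toEuclideanCLM (𝕜 := ℝ) 𝒦 x) y =
      inner ℝ x (Matrix.toEuclideanCLM (𝕜 := ℝ) 𝒦 y) :=
    Matrix.isSymmetric_toEuclideanLin_iff.2 h𝒦.isHermitian
  obtain ⟨A, A', c, M, hc, hA, hcoer, hsymm, hM, hM', hlip, htaylor⟩ :=
    exists_pullback_operators (μ := cellMeasure (P 0)) hsymm𝒦 hκ hcoer𝒦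
      (measurable_fderiv ℝ X) L.coe_nonneg
      (fun x => norm_fderiv_le_of_lipschitz ℝ hX.lipschitz) hX.small
  have : CompleteSpace (gradientSpace hX.isOpen_zero) :=
    hX.isClosed_gradientSpace.completeSpace_coe
  choose! G hG using fun h (hh : h ∈ Icc (-b) b) (j : Fin d) =>
    exists_isEquilibrium (A h) (gradientSpace hX.isOpen_zero) hc (hcoer h hh)
      (constField (P 0) (EuclideanSpace.single j 1))
  have habs : ∀ h ∈ Icc (-b) b, |h| ≤ b := fun h hh => abs_le.2 hh
  have hsol : ∀ h ∈ Icc (-b) b, ∀ j, ∃ ξ g, IsCellSolution 𝒦 (P h) j ξ g := fun h hh j =>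
    hX.exists_isCellSolution (habs h hh) (hA h hh) (hG h hh j)
  have hcond : ∀ h ∈ Icc (-b) b, ∀ (ξ : Fin d → EuclideanSpace ℝ (Fin d) → ℝ)
      (g : Fin d → EuclideanSpace ℝ (Fin d) → EuclideanSpace ℝ (Fin d)), (∀ j, IsCellSolution 𝒦 (P h) j (ξ j) (g j)) →
      conductivityMatrix 𝒦 (P h) g = Matrix.of fun i j => inner ℝ (A h (G h j)) (G h i) :=
    fun h hh ξ g hξ => hX.conductivityMatrix_eq (habs h hh) (hA h hh) hc (hcoer h hh) (hG h hh) hξ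
  have heff : ∀ h ∈ Icc (-b) b, effectiveConductivity 𝒦 (P h) =
      Matrix.of fun i j => inner ℝ (A h (G h j)) (G h i) := fun h hh =>
    effectiveConductivity_eq (hsol h hh) (hcond h hh)
  refine ⟨hsol, fun h hh ξ g hξ => (heff h hh).trans (hcond h hh ξ g hξ).symm, ?_⟩
  choose κ' C hC using fun i j : Fin d => exists_energy_taylor hc hcoer hsymm hM hM' hlip htaylor
    (G := fun h => G h j) (G' := fun h => G h i) (fun h hh => hG h hh j) (fun h hh => hG h hh i)
  -- The entrywise constants are dominated by their sum; the factor `d` passes from entries to the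
  -- Frobenius norm.
  refine ⟨fun k => Matrix.of fun i j => κ' i j k, d * ∑ i, ∑ j, |C i j|, fun h hh k hk => ?_⟩
  rw [heff h hh, heff k hk, mul_assoc]
  refine frobenius_norm_le_of_forall_le (by positivity) fun i j => ?_
  refine (hC i j h hh k hk).trans (mul_le_mul_of_nonneg_right ?_ (sq_nonneg _))
  exact (le_abs_self _).trans ((Finset.single_le_sum (f := fun j => |C i j|)
    (fun _ _ => abs_nonneg _) (Finset.mem_univ j)).trans
    (Finset.single_le_sum (f := fun i => ∑ j, |C i j|)
      (fun _ _ => Finset.sum_nonneg fun _ _ => abs_nonneg _) (Finset.mem_univ i)))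

end DeformationField

end CellProblem
end

theorem lemma4p1 {d : ℕ} (hd : 2 ≤ d)
    (Y₀ : Set (EuclideanSpace ℝ (Fin d))) (hY₀ : CellProblem.IsC3Domain Y₀)
    (hY₀_sub : closure Y₀ ⊆ CellProblem.unitCell d)
    (a : ℝ) (ha : CellProblem.IsTubularRadius Y₀ a)
    (hU : CellProblem.tubularNhd Y₀ a ⊆ CellProblem.unitCell d)
    (𝒦 : Matrix (Fin d) (Fin d) ℝ) (h𝒦 : 𝒦.PosDef) :
    -- the cell problems are solvable for every height
    (∀ h ∈ Icc (-(a / 8)) (a / 8), ∀ j : Fin d,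
      ∃ ξ g, CellProblem.IsCellSolution 𝒦 (CellProblem.shifted Y₀ a h) j ξ g) ∧
    -- the effective conductivity does not depend on the choice of the solutions
    (∀ h ∈ Icc (-(a / 8)) (a / 8),
      ∀ (ξ : Fin d → EuclideanSpace ℝ (Fin d) → ℝ)
        (g : Fin d → EuclideanSpace ℝ (Fin d) → EuclideanSpace ℝ (Fin d)),
        (∀ j, CellProblem.IsCellSolution 𝒦 (CellProblem.shifted Y₀ a h) j (ξ j) (g j)) →
        CellProblem.effectiveConductivity 𝒦 (CellProblem.shifted Y₀ a h) =
          CellProblem.conductivityMatrix 𝒦 (CellProblem.shifted Y₀ a h) g) ∧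
    -- it is of class `C^{1,1}` as a function of the height
    CellProblem.IsC11On
      (fun h => CellProblem.effectiveConductivity 𝒦 (CellProblem.shifted Y₀ a h))
      (Icc (-(a / 8)) (a / 8)) ∧
    -- piecewise linear interpolation is second order accurate
    (∃ C : ℝ, ∀ N : ℕ, 1 ≤ N → ∀ h ∈ Icc (-(a / 8)) (a / 8),
      ‖CellProblem.effectiveConductivity 𝒦 (CellProblem.shifted Y₀ a h) -
          CellProblem.piecewiseLinear
            (fun s => CellProblem.effectiveConductivity 𝒦 (CellProblem.shifted Y₀ a s))
            (a / 8) N h‖ ≤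
        C * CellProblem.gridStep (a / 8) N ^ 2) := by
  have hX := ha.deformationField hY₀ (by omega) hY₀_sub hU
  obtain ⟨h1, h2, K', C, h3⟩ := hX.exists_conductivity_taylor h𝒦
  exact ⟨h1, h2, CellProblem.isC11On_of_taylor h3, C, fun N hN h hh =>
    CellProblem.norm_sub_piecewiseLinear_le hX.pos h3 hN hh⟩
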